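/- **Setting.** All random variables live on one probability space; $\|W\|_q=(\mathbb E|W|^q)^{1/q}$. Let $X_{t,n}$ be a triangular array of real random variables ($t=1,\dots,n$; where lagged values are used below, $X_{t,n}$ with $t\le 0$ are arbitrary further random variables), and for each $u\in[0,1]$ let $(\tilde X_t(u))_{t\in\mathbb Z}$ be a stationary and ergodic real process. Let $(\varepsilon_t)_{t\in\mathbb Z}$ be i.i.d. real random variables and, for each $s$, let $\varepsilon_s^*$ have the distribution of $\varepsilon_1$ and be independent of $(\varepsilon_t)_{t\in\mathbb Z}$. Put $\mathcal F_t=(\varepsilon_t,\varepsilon_{t-1},\dots)$, and let $\mathcal F_t^{*(t-k)}$ be $\mathcal F_t$ with $\varepsilon_{t-k}$ replaced by $\varepsilon_{t-k}^*$. For $q>0$ and $0<\alpha\le 1$ consider the conditions * (S1) $\sup_{u\in[0,1]}\|\tilde X_t(u)\|_q<\infty$, and there is $C_B>0$ such that for all $n$, all $t=1,\dots,n$ and all $u,v\in[0,1]$: $\|\tilde X_t(u)-\tilde X_t(v)\|_q\le C_B|u-v|^\alpha$ and $\|X_{t,n}-\tilde X_t(t/n)\|_q\le C_Bn^{-\alpha}$.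 * (S2) For all $t\in\mathbb Z$, $u\mapsto\tilde X_t(u)$ is almost surely continuous on $[0,1]$ and $\big\|\sup_{u\in[0,1]}|\tilde X_t(u)|\big\|_q<\infty$. * (M1) For each $u\in[0,1]$ there is a measurable $H(u,\cdot):\mathbb R^{\mathbb N}\to\mathbb R$ with $\tilde X_t(u)=H(u,\mathcal F_t)$ a.s. for all $t\in\mathbb Z$, and $\sum_{k=0}^\infty\sup_{u\in[0,1]}\sup_{t\in\mathbb Z}\|H(u,\mathcal F_t)-H(u,\mathcal F_t^{*(t-k)})\|_q<\infty$. Let $K:\mathbb R\to\mathbb R$ be bounded and of bounded variation, vanish outside $[-\tfrac12,\tfrac12]$, and satisfy $\int K\,dx=1$. **Theorem 2.10 (Central limit theorem, local version).** Let $q\ge 2$, $0<\alpha\le1$, and let $b=b_n$ satisfy $b\to0$, $nb\to\infty$ and $\sqrt{nb}\,n^{-\alpha}\to0$. Let $u\in(0,1)$. (a) If (S1), (S2) and (M1) hold with $q$ and $\alpha$, then the series $$\sigma^2(u)=\sum_{k\in\mathbb Z}\operatorname{Cov}(\tilde X_0(u),\tilde X_k(u))$$ converges absolutely, $\sigma^2(u)\ge0$,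 and $$\frac1{\sqrt{nb}}\sum_{t=1}^nK\Big(\frac{t/n-u}{b}\Big)\big\{X_{t,n}-\mathbb EX_{t,n}\big\}\ \xrightarrow{d}\ N\Big(0,\int K(x)^2\,dx\cdot\sigma^2(u)\Big).$$ (b) Let $r\in\mathbb N$, $M\ge0$, $C\in\mathbb R$, and let $g:\mathbb R^r\to\mathbb R$ satisfy $$|g(y)-g(y')|\le C\,|y-y'|_1\,(1+|y|_1^M+|y'|_1^M)\quad\text{for all }y\ne y',\qquad |y|_1=\sum_{i=1}^r|y_i|.$$ If (S1), (S2) and (M1) hold for $X_{t,n}$, $\tilde X_t(u)$ with $q(M+1)$ in place of $q$ and with $\alpha$, then the conclusion of (a) holds with $X_{t,n}$ replaced by $g(X_{t,n},\dots,X_{t-r+1,n})$ and $\tilde X_t(u)$ replaced by $g(\tilde X_t(u),\dots,\tilde X_{t-r+1}(u))$, in particular in the definition of $\sigma^2(u)$. -/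

import Mathlib

open MeasureTheory ProbabilityTheory Filter Topology
open scoped ENNReal NNReal

noncomputable section

namespace LocStat

/-- Localizing kernel: bounded, of bounded variation on `ℝ`, vanishing outside `[-1/2, 1/2]`,
with integral one. -/
structure LocalizingKernel (K : ℝ → ℝ) : Prop where
  bounded : ∃ B : ℝ, ∀ x, |K x| ≤ B
  boundedVariation : BoundedVariationOn K Set.univ
  support_subset : Function.support K ⊆ Set.Icc (-(1 / 2)) (1 / 2)
  integral_eq_one : ∫ x, K x = 1

variable {Ω : Type*} [MeasurableSpace Ω]

/-- `‖W‖_q = (E |W|^q)^{1/q}`, with values in `[0, ∞]`. -/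
def lqNorm (P : Measure Ω) (q : ℝ) (W : Ω → ℝ) : ℝ≥0∞ :=
  eLpNorm W (ENNReal.ofReal q) P

/-- The real process `(Y t)`, `t ∈ ℤ`, is stationary and ergodic: the left shift on `ℝ^ℤ`
preserves the law of the process and is ergodic for it. -/
def StationaryErgodic (P : Measure Ω) (Y : ℤ → Ω → ℝ) : Prop :=
  Ergodic (fun (x : ℤ → ℝ) (t : ℤ) => x (t + 1)) (P.map (fun ω t => Y t ω))

/-- Condition (S1) with moment order `q` and exponent `α`, for the array `X t n` (constrained for
`1 ≤ t ≤ n` only) and the stationary approximation `Xs t u`, `u ∈ [0, 1]`. -/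
structure CondS1 (P : Measure Ω) (X : ℤ → ℕ → Ω → ℝ) (Xs : ℤ → ℝ → Ω → ℝ) (q α : ℝ) : Prop where
  moment : ∀ t, (⨆ u ∈ Set.Icc (0 : ℝ) 1, lqNorm P q (Xs t u)) < ∞
  approx : ∃ CB : ℝ, 0 < CB ∧ ∀ (n : ℕ) (t : ℤ), 1 ≤ t → t ≤ n →
    (∀ u ∈ Set.Icc (0 : ℝ) 1, ∀ v ∈ Set.Icc (0 : ℝ) 1,
      lqNorm P q (fun ω => Xs t u ω - Xs t v ω) ≤ ENNReal.ofReal (CB * |u - v| ^ α)) ∧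
    lqNorm P q (fun ω => X t n ω - Xs t ((t : ℝ) / n) ω) ≤ ENNReal.ofReal (CB * (n : ℝ) ^ (-α))

/-- Condition (S2): almost surely continuous paths in `u`, and
`‖ sup_{u ∈ [0,1]} |Xs t u| ‖_q < ∞`. -/
structure CondS2 (P : Measure Ω) (Xs : ℤ → ℝ → Ω → ℝ) (q : ℝ) : Prop where
  continuous : ∀ t, ∀ᵐ ω ∂P, ContinuousOn (fun u => Xs t u ω) (Set.Icc 0 1)
  moment : ∀ t, eLpNorm (fun ω => ⨆ u ∈ Set.Icc (0 : ℝ) 1, ‖Xs t u ω‖ₑ) (ENNReal.ofReal q) P < ∞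

/-- `ε t`, `t ∈ ℤ`, are i.i.d. real random variables; each `ε' s` has the same distribution and
is independent of the whole sequence `ε`. -/
structure Innovations (P : Measure Ω) (ε ε' : ℤ → Ω → ℝ) : Prop where
  measurable : ∀ t, Measurable (ε t)
  measurable_copy : ∀ s, Measurable (ε' s)
  indep : iIndepFun ε P
  identDistrib : ∀ t, IdentDistrib (ε t) (ε 1) P P
  identDistrib_copy : ∀ s, IdentDistrib (ε' s) (ε 1) P P
  indep_copy : ∀ s, IndepFun (ε' s) (fun ω t => ε t ω) P

/-- The past `F_t = (ε_t, ε_{t-1}, …)`. -/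
def past (ε : ℤ → Ω → ℝ) (t : ℤ) (ω : Ω) : ℕ → ℝ :=
  fun j => ε (t - j) ω

/-- The past `F_t^{*s}`, in which the innovation at time `s` is replaced by its copy `ε' s`. -/
def coupledPast (ε ε' : ℤ → Ω → ℝ) (t s : ℤ) (ω : Ω) : ℕ → ℝ :=
  fun j => if t - j = s then ε' s ω else ε (t - j) ω

/-- The functional dependence measure `δ_q(k) = sup_t ‖W_t - W_t^{*(t-k)}‖_q` of the process
`W_t = H(F_t)`. -/
def depMeasure (P : Measure Ω) (ε ε' : ℤ → Ω → ℝ) (H : (ℕ → ℝ) → ℝ) (q : ℝ) (k : ℕ) : ℝ≥0∞ :=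
  ⨆ t : ℤ, lqNorm P q (fun ω => H (past ε t ω) - H (coupledPast ε ε' t (t - k) ω))

/-- Condition (M1): `Xs t u = H(u, F_t)` almost surely with `H(u, ·)` measurable, and the uniform
dependence measure `sup_{u ∈ [0,1]} δ_q^{Xs(u)}(k)` is summable over `k ≥ 0`. -/
def CondM1 (P : Measure Ω) (ε ε' : ℤ → Ω → ℝ) (Xs : ℤ → ℝ → Ω → ℝ) (q : ℝ) : Prop :=
  ∃ H : ℝ → (ℕ → ℝ) → ℝ,
    (∀ u ∈ Set.Icc (0 : ℝ) 1, Measurable (H u)) ∧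
    (∀ u ∈ Set.Icc (0 : ℝ) 1, ∀ t, Xs t u =ᵐ[P] fun ω => H u (past ε t ω)) ∧
    (∑' k : ℕ, (⨆ u ∈ Set.Icc (0 : ℝ) 1, depMeasure P ε ε' (H u) q k)) < ∞

/-- The class `L_r(M, C)` of functions on `ℝ^r` that are locally Lipschitz with polynomially
growing constant, with respect to `|y|_1 = ∑ i, |y i|`. -/
def ClassL (r : ℕ) (M C : ℝ) (g : (Fin r → ℝ) → ℝ) : Prop :=
  0 ≤ M ∧ ∀ y y' : Fin r → ℝ, y ≠ y' →
    |g y - g y'| / ((∑ i, |y i - y' i|) * (1 + (∑ i, |y i|) ^ M + (∑ i, |y' i|) ^ M)) ≤ C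

/-- The autocovariance `Cov(Xs_0(u), Xs_k(u))`. -/
def autocov (P : Measure Ω) (Xs : ℤ → ℝ → Ω → ℝ) (u : ℝ) (k : ℤ) : ℝ :=
  covariance (Xs 0 u) (Xs k u) P

/-- The long-run variance `σ²(u) = ∑_{k ∈ ℤ} Cov(Xs_0(u), Xs_k(u))`. -/
def longRunVar (P : Measure Ω) (Xs : ℤ → ℝ → Ω → ℝ) (u : ℝ) : ℝ :=
  ∑' k : ℤ, autocov P Xs u k

/-- `(n b)^{-1/2} ∑_{t=1}^n K((t/n - u)/b) (X_{t,n} - E X_{t,n})`. -/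
def localSum (P : Measure Ω) (K : ℝ → ℝ) (X : ℤ → ℕ → Ω → ℝ) (b u : ℝ) (n : ℕ) (ω : Ω) : ℝ :=
  (√(n * b))⁻¹ * ∑ t ∈ Finset.Icc (1 : ℤ) n,
    K (((t : ℝ) / n - u) / b) * (X t n ω - ∫ ω', X t n ω' ∂P)

/-- The local central limit theorem for `X` with stationary approximation `Xs` at `u`: the series
`σ²(u)` converges, its value is nonnegative, and the local sums with bandwidths `b n` converge in
distribution to `N(0, ∫ K² · σ²(u))`. -/
def LocalCLT (P : Measure Ω) [IsProbabilityMeasure P] (K : ℝ → ℝ) (X : ℤ → ℕ → Ω → ℝ)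
    (Xs : ℤ → ℝ → Ω → ℝ) (b : ℕ → ℝ) (u : ℝ) : Prop :=
  Summable (autocov P Xs u) ∧ 0 ≤ longRunVar P Xs u ∧
  TendstoInDistribution (fun n : ℕ => localSum P K X (b n) u n) atTop (id : ℝ → ℝ) (fun _ => P)
    (gaussianReal 0 ((∫ x, K x ^ 2) * longRunVar P Xs u).toNNReal)

/-- `g(Z_{t,n})` with `Z_{t,n} = (X_{t,n}, …, X_{t-r+1,n})`. The second index is either the sample
size `n` or the rescaled time `u`. -/
def lagTransform {ι : Type*} {r : ℕ} (g : (Fin r → ℝ) → ℝ) (X : ℤ → ι → Ω → ℝ) : ℤ → ι → Ω → ℝ :=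
  fun t i ω => g (fun j : Fin r => X (t - (j : ℕ)) i ω)

end LocStat

end

/-! Let `P_a` be the L² projection onto functionals of the innovations `ε_a, ε_{a+1}, …`. These
projections decrease in `a`, so the increments `Q_a = P_a - P_{a+1}` are mutually orthogonal
projections. If `W_t` is a square integrable functional of the past `F_t`, then `P_{t+1} W_t` is its
mean, and `W_t - E W_t = ∑_{k ≥ 0} Q_{t-k} W_t`. The vector `Q_{t-k} W_t` is orthogonal to the
coupled version of `W_t`, so its norm is at most the dependence measure `d k`
(`norm_increment_le_of_coupled`). For a fixed lag `k` the terms with different `t` are orthogonal,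
hence `‖∑ w_t (W_t - E W_t)‖ ≤ ∑_k (∑_t w_t² ‖Q_{t-k} W_t‖²)^{1/2}` (`norm_sum_smul_le`).
Truncation, blocking and freezing of the rescaled time are all controlled by this bound, each with
dominated convergence in `k`.

Projecting on the future makes blocking exact: for `s ≤ t`, `P_s W_t` depends on `ε_s, …, ε_t` only.
With `s = L ⌊t/L⌋`, sums over different blocks of length `L` are independent, without gaps between
the blocks. Only the lags `k > t mod L` are lost, which at lag `k` affects a proportion of about
`min 1 (k/L)` of the times. Truncation is 1-Lipschitz and keeps the same `d`; after it each block
sum is bounded by a constant tending to zero, and `norm_charFun_sum_sub_exp_le` compares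
characteristic functions directly.

The variance converges because `∑_t w_t w_{t+h} → ∫ K²` for every `h` (bounded variation of `K`) and
the autocovariances are summable, being bounded by `∑_k d_k d_{k+h}`. The limit `∫ K² · σ²` of
squared norms is nonnegative, and `∫ K² > 0`, so `σ² ≥ 0`.

For the array, replacing `X_{t,n}` by its stationary approximation at `t/n` costs a multiple of
`√(nb) n^{-α}` by the triangle inequality. The time `t/n` is then frozen at `u`: the increments of
the difference are at most `min (2 d_k) (C θ^α)` when the weights live within `θ` of `u`.

For `g` of lagged values, Hölder's inequality (`ClassL.eLpNorm_sub_le`) turns the `L^{2(M+1)}`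
hypotheses into L² ones, and lag `j` shifts the dependence measure by `j`. The statement for `X`
itself is the case where `g` is a coordinate. -/

open scoped RealInnerProductSpace

noncomputable section

namespace LocStat

/-! ### Orthogonal increments of decreasing projections in a Hilbert space -/

section Hilbert

variable {E : Type*} [NormedAddCommGroup E] [InnerProductSpace ℝ E]

/-- A decreasing family of orthogonal projections indexed by `ℤ`. -/
structure DecreasingProjections (Pr : ℤ → E →L[ℝ] E) : Prop where
  symm : ∀ a x y, ⟪Pr a x, y⟫ = ⟪x, Pr a y⟫
  comp : ∀ a b x, Pr a (Pr b x) = Pr (max a b) x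

/-- The increment `Pr a - Pr (a + 1)` of a family of projections. -/
def increment (Pr : ℤ → E →L[ℝ] E) (a : ℤ) : E →L[ℝ] E := Pr a - Pr (a + 1)

namespace DecreasingProjections

variable {Pr : ℤ → E →L[ℝ] E}

lemma inner_increment_left (h : DecreasingProjections Pr) (a : ℤ) (x y : E) :
    ⟪increment Pr a x, y⟫ = ⟪x, increment Pr a y⟫ := by
  simp [increment, inner_sub_left, inner_sub_right, h.symm]

lemma increment_proj_of_le (h : DecreasingProjections Pr) {a b : ℤ} (hab : b ≤ a) (x : E) :
    increment Pr a (Pr b x) = increment Pr a x := by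
  simp [increment, h.comp, max_eq_left hab, max_eq_left (hab.trans (Int.le_add_one le_rfl))]

lemma increment_proj_of_lt (h : DecreasingProjections Pr) {a b : ℤ} (hab : a < b) (x : E) :
    increment Pr a (Pr b x) = 0 := by
  simp [increment, h.comp, max_eq_right hab.le, max_eq_right (Int.add_one_le_of_lt hab)]

lemma increment_increment_of_ne (h : DecreasingProjections Pr) {a b : ℤ} (hab : a ≠ b) (x : E) :
    increment Pr a (increment Pr b x) = 0 := by
  rcases lt_or_gt_of_ne hab with hab | hab
  · have : increment Pr b x = Pr b x - Pr (b + 1) x := rfl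
    rw [this, map_sub, h.increment_proj_of_lt hab, h.increment_proj_of_lt (by lia), sub_zero]
  · have : increment Pr b x = Pr b x - Pr (b + 1) x := rfl
    rw [this, map_sub, h.increment_proj_of_le hab.le, h.increment_proj_of_le (by lia), sub_self]

lemma increment_increment_self (h : DecreasingProjections Pr) (a : ℤ) (x : E) :
    increment Pr a (increment Pr a x) = increment Pr a x := by
  have : increment Pr a x = Pr a x - Pr (a + 1) x := rfl
  rw [this, map_sub, h.increment_proj_of_le le_rfl, h.increment_proj_of_lt (lt_add_one a),
    sub_zero, this]

lemma inner_increment_increment_of_ne (h : DecreasingProjections Pr) {a b : ℤ} (hab : a ≠ b) (x y : E) :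
    ⟪increment Pr a x, increment Pr b y⟫ = 0 := by
  rw [h.inner_increment_left, h.increment_increment_of_ne hab, inner_zero_right]

lemma inner_increment_eq (h : DecreasingProjections Pr) (a : ℤ) (x y : E) :
    ⟪increment Pr a x, y⟫ = ⟪increment Pr a x, increment Pr a y⟫ := by
  rw [← h.inner_increment_left, h.increment_increment_self]

lemma norm_increment_le (h : DecreasingProjections Pr) (a : ℤ) (x : E) : ‖increment Pr a x‖ ≤ ‖x‖ := by
  rcases (norm_nonneg (increment Pr a x)).eq_or_lt with h0 | h0
  · rw [← h0]; exact norm_nonneg x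
  · have h1 : ‖increment Pr a x‖ * ‖increment Pr a x‖ = ⟪increment Pr a x, x⟫ := by
      rw [h.inner_increment_eq, real_inner_self_eq_norm_mul_norm]
    have h2 := real_inner_le_norm (increment Pr a x) x
    rw [← h1] at h2
    exact le_of_mul_le_mul_left h2 h0

lemma sum_range_increment (t : ℤ) (x : E) (m : ℕ) :
    ∑ k ∈ Finset.range m, increment Pr (t - k) x = Pr (t + 1 - m) x - Pr (t + 1) x := by
  induction m with
  | zero => simp
  | succ m ih =>
    rw [Finset.sum_range_succ, ih, increment]
    have e1 : t - (m : ℤ) + 1 = t + 1 - m := by ring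
    have e2 : t + 1 - ((m + 1 : ℕ) : ℤ) = t - m := by push_cast; ring
    rw [e2]
    simp only [sub_apply, e1]
    abel

/-- Expansion of a centered vector along the increments. -/
lemma tendsto_sum_increment {t : ℤ} {x : E} (hx0 : Pr (t + 1) x = 0)
    (hx : Tendsto (fun m : ℕ => Pr (t + 1 - m) x) atTop (𝓝 x)) :
    Tendsto (fun m : ℕ => ∑ k ∈ Finset.range m, increment Pr (t - k) x) atTop (𝓝 x) := by
  simpa only [sum_range_increment, hx0, sub_zero] using hx

/-- Pythagoras: with the lag `k` fixed, distinct times `t` give distinct indices `t - k`, hence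
orthogonal increments. -/
lemma norm_sq_sum_increment (h : DecreasingProjections Pr) (T : Finset ℤ) (w : ℤ → ℝ) (x : ℤ → E) (k : ℤ) :
    ‖∑ t ∈ T, w t • increment Pr (t - k) (x t)‖ ^ 2
      = ∑ t ∈ T, w t ^ 2 * ‖increment Pr (t - k) (x t)‖ ^ 2 := by
  rw [← real_inner_self_eq_norm_sq, sum_inner]
  refine Finset.sum_congr rfl fun s hs => ?_
  rw [inner_sum, Finset.sum_eq_single_of_mem s hs]
  · rw [real_inner_smul_left, real_inner_smul_right, real_inner_self_eq_norm_sq]; ring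
  · intro t _ hts
    rw [real_inner_smul_left, real_inner_smul_right,
      h.inner_increment_increment_of_ne (by lia), mul_zero, mul_zero]

/-- Bound on the norm of a weighted sum through the sizes of the increments at each lag. -/
lemma norm_sum_smul_le (h : DecreasingProjections Pr) {T : Finset ℤ} {w : ℤ → ℝ} {x : ℤ → E}
    (hx0 : ∀ t ∈ T, Pr (t + 1) (x t) = 0)
    (hx : ∀ t ∈ T, Tendsto (fun m : ℕ => Pr (t + 1 - m) (x t)) atTop (𝓝 (x t)))
    {B : ℕ → ℝ} (hB0 : ∀ k, 0 ≤ B k) (hB : Summable B)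
    (hle : ∀ k : ℕ, ∑ t ∈ T, w t ^ 2 * ‖increment Pr (t - k) (x t)‖ ^ 2 ≤ B k ^ 2) :
    ‖∑ t ∈ T, w t • x t‖ ≤ ∑' k, B k := by
  have hlim : Tendsto (fun m : ℕ => ∑ t ∈ T, w t • ∑ k ∈ Finset.range m, increment Pr (t - k) (x t))
      atTop (𝓝 (∑ t ∈ T, w t • x t)) :=
    tendsto_finsetSum _ fun t ht => (tendsto_sum_increment (hx0 t ht) (hx t ht)).const_smul _
  refine le_of_tendsto hlim.norm (Eventually.of_forall fun m => ?_)
  simp_rw [Finset.smul_sum]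
  rw [Finset.sum_comm]
  refine (norm_sum_le _ _).trans ((Finset.sum_le_sum fun k _ => ?_).trans
    (hB.sum_le_tsum _ fun k _ => hB0 k))
  refine le_of_sq_le_sq ?_ (hB0 k)
  rw [h.norm_sq_sum_increment T w x k]
  exact hle k

/-- Only increments with the same index pair nontrivially, and the index at lag `k` seen from time
`s` is at lag `k + h'` seen from time `s + h'`. Cauchy–Schwarz on each pair gives the product of the
two bounds. -/
lemma abs_inner_le (h : DecreasingProjections Pr) {d : ℕ → ℝ} (hd : Summable d) {s : ℤ} {h' : ℕ} {x y : E}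
    (hx0 : Pr (s + 1) x = 0)
    (hx : Tendsto (fun m : ℕ => Pr (s + 1 - m) x) atTop (𝓝 x))
    (hdx : ∀ k : ℕ, ‖increment Pr (s - k) x‖ ≤ d k)
    (hdy : ∀ k : ℕ, ‖increment Pr (s + h' - k) y‖ ≤ d k) :
    |⟪x, y⟫| ≤ ∑' k, d k * d (k + h') := by
  have hd0 : ∀ k, 0 ≤ d k := fun k => (norm_nonneg _).trans (hdx k)
  have hsum : Summable fun k => d k * d (k + h') :=
    Summable.of_nonneg_of_le (fun k => mul_nonneg (hd0 _) (hd0 _))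
      (fun k => mul_le_mul_of_nonneg_left (hd.le_tsum (k + h') fun j _ => hd0 j) (hd0 k))
      (hd.mul_right (∑' j, d j))
  have hlim := ((tendsto_sum_increment hx0 hx).inner (𝕜 := ℝ) (tendsto_const_nhds (x := y))).abs
  refine le_of_tendsto hlim (Eventually.of_forall fun m => ?_)
  rw [sum_inner]
  refine (Finset.abs_sum_le_sum_abs _ _).trans ((Finset.sum_le_sum fun k _ => ?_).trans
    (hsum.sum_le_tsum _ fun k _ => mul_nonneg (hd0 _) (hd0 _)))
  rw [h.inner_increment_eq]
  refine (abs_real_inner_le_norm _ _).trans ?_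
  refine mul_le_mul (hdx k) ?_ (norm_nonneg _) (hd0 k)
  have := hdy (k + h')
  have e : s + (h' : ℤ) - ((k + h' : ℕ) : ℤ) = s - k := by push_cast; ring
  rwa [e] at this

end DecreasingProjections

/-- After interchanging the sums, the partial sum in `h` of `d (k + h)` is at most the total sum, so
everything is bounded by `(∑ d)²`. -/
lemma summable_tsum_mul_add {d : ℕ → ℝ} (hd0 : ∀ k, 0 ≤ d k) (hd : Summable d) :
    Summable fun h : ℕ => ∑' k, d k * d (k + h) := by
  have hsum : ∀ h, Summable fun k => d k * d (k + h) := fun h =>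
    Summable.of_nonneg_of_le (fun k => mul_nonneg (hd0 _) (hd0 _))
      (fun k => mul_le_mul_of_nonneg_left (hd.le_tsum (k + h) fun j _ => hd0 j) (hd0 k))
      (hd.mul_right (∑' j, d j))
  refine summable_of_sum_range_le (c := (∑' k, d k) * ∑' k, d k)
    (fun h => tsum_nonneg fun k => mul_nonneg (hd0 _) (hd0 _)) fun N => ?_
  rw [← Summable.tsum_finsetSum fun h _ => hsum h, ← tsum_mul_right]
  refine (summable_sum fun h _ => hsum h).tsum_le_tsum (fun k => ?_) (hd.mul_right _)
  rw [← Finset.mul_sum]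
  refine mul_le_mul_of_nonneg_left ?_ (hd0 k)
  have := (hd.sum_le_tsum ((Finset.range N).map (addLeftEmbedding k)) fun j _ => hd0 j)
  simpa using this

lemma DecreasingProjections.summable_inner {Pr : ℤ → E →L[ℝ] E} (h : DecreasingProjections Pr)
    {d : ℕ → ℝ} (hd : Summable d) {x : ℤ → E}
    (hx0 : ∀ t, Pr (t + 1) (x t) = 0)
    (hx : ∀ t, Tendsto (fun m : ℕ => Pr (t + 1 - m) (x t)) atTop (𝓝 (x t)))
    (hdx : ∀ t (k : ℕ), ‖increment Pr (t - k) (x t)‖ ≤ d k) :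
    Summable fun t : ℤ => ⟪x 0, x t⟫ := by
  have hd0 : ∀ k, 0 ≤ d k := fun k => (norm_nonneg _).trans (hdx 0 k)
  refine Summable.of_nat_of_neg ?_ ?_
  · refine Summable.of_norm_bounded (summable_tsum_mul_add hd0 hd) fun n => ?_
    exact h.abs_inner_le hd (hx0 0) (hx 0) (hdx 0) fun k => by simpa using hdx n k
  · refine Summable.of_norm_bounded (summable_tsum_mul_add hd0 hd) fun n => ?_
    rw [real_inner_comm]
    exact h.abs_inner_le hd (hx0 _) (hx _) (hdx _) fun k => by simpa using hdx 0 k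

end Hilbert

/-! ### Independence and joins of σ-algebras -/

section SigmaAlgebra

lemma sup_eq_generateFrom_inter {Ω : Type*} (m₁ m₂ : MeasurableSpace Ω) :
    m₁ ⊔ m₂ = MeasurableSpace.generateFrom
      {s | ∃ A B, MeasurableSet[m₁] A ∧ MeasurableSet[m₂] B ∧ s = A ∩ B} := by
  apply le_antisymm
  · refine sup_le ?_ ?_
    · exact fun A hA => MeasurableSpace.measurableSet_generateFrom
        ⟨A, Set.univ, hA, MeasurableSet.univ, by simp⟩
    · exact fun B hB => MeasurableSpace.measurableSet_generateFrom
        ⟨Set.univ, B, MeasurableSet.univ, hB, by simp⟩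
  · refine MeasurableSpace.generateFrom_le ?_
    rintro s ⟨A, B, hA, hB, rfl⟩
    exact MeasurableSet.inter ((le_sup_left : m₁ ≤ m₁ ⊔ m₂) A hA)
      ((le_sup_right : m₂ ≤ m₁ ⊔ m₂) B hB)

lemma isPiSystem_inter {Ω : Type*} (m₁ m₂ : MeasurableSpace Ω) :
    IsPiSystem {s | ∃ A B, MeasurableSet[m₁] A ∧ MeasurableSet[m₂] B ∧ s = A ∩ B} := by
  rintro s ⟨A, B, hA, hB, rfl⟩ s' ⟨A', B', hA', hB', rfl⟩ _
  exact ⟨A ∩ A', B ∩ B', hA.inter hA', hB.inter hB', Set.inter_inter_inter_comm A B A' B'⟩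

variable {Ω : Type*} {m₁ m₂ m₃ m₀ : MeasurableSpace Ω} {P : Measure Ω} [IsProbabilityMeasure P]

/-- If `m₁` is independent of `m₂` and `m₁ ⊔ m₂` of `m₃`, then `m₁` is independent of `m₂ ⊔ m₃`. -/
lemma indep_sup_of_indep_sup (h₁ : m₁ ≤ m₀) (h₂ : m₂ ≤ m₀) (h₃ : m₃ ≤ m₀)
    (h : Indep m₁ m₂ P) (h' : Indep (m₁ ⊔ m₂) m₃ P) : Indep m₁ (m₂ ⊔ m₃) P := by
  refine IndepSets.indep h₁ (sup_le h₂ h₃) m₁.isPiSystem_measurableSet (isPiSystem_inter m₂ m₃)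
    (@MeasurableSpace.generateFrom_measurableSet _ m₁).symm (sup_eq_generateFrom_inter m₂ m₃) ?_
  rw [IndepSets_iff]
  rintro A _ hA ⟨B, C, hB, hC, rfl⟩
  rw [Indep_iff] at h h'
  have hA' : MeasurableSet[m₁] A := hA
  have hB' : MeasurableSet[m₁ ⊔ m₂] B := (le_sup_right : m₂ ≤ m₁ ⊔ m₂) B hB
  have hAB : MeasurableSet[m₁ ⊔ m₂] (A ∩ B) :=
    MeasurableSet.inter ((le_sup_left : m₁ ≤ m₁ ⊔ m₂) A hA') hB'
  rw [← Set.inter_assoc, h' _ _ hAB hC, h' _ _ hB' hC, h _ _ hA' hB, mul_assoc]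

/-- The conditional expectation of `1_A f` given `m₂` is the constant `∫_A f`; integrating it over
`B` gives the product. -/
lemma setIntegral_inter_of_indep (h₁ : m₁ ≤ m₀) (h₂ : m₂ ≤ m₀) (hind : Indep m₁ m₂ P)
    {f : Ω → ℝ} (hf : StronglyMeasurable[m₁] f) (hint : Integrable f P) {A B : Set Ω}
    (hA : MeasurableSet[m₁] A) (hB : MeasurableSet[m₂] B) :
    ∫ ω in A ∩ B, f ω ∂P = P.real B * ∫ ω in A, f ω ∂P := by
  have hAf : StronglyMeasurable[m₁] (A.indicator f) := hf.indicator hA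
  have hAi : Integrable (A.indicator f) P := hint.indicator (h₁ A hA)
  have h := condExp_indep_eq h₁ h₂ hAf hind
  have h3 : ∫ ω in B, (P[A.indicator f | m₂]) ω ∂P = ∫ ω in B, A.indicator f ω ∂P :=
    setIntegral_condExp h₂ hAi hB
  rw [setIntegral_congr_ae (h₂ B hB) (h.mono fun ω hω _ => hω), setIntegral_const,
    integral_indicator (h₁ A hA), setIntegral_indicator (h₁ A hA), smul_eq_mul] at h3
  rw [Set.inter_comm, ← h3]

/-- Enlarging the conditioning σ-algebra by an independent one does not change the conditional
expectation. -/
lemma condExp_sup_eq_of_indep {mf : MeasurableSpace Ω} (h₁ : m₁ ≤ mf) (hmf : mf ≤ m₀)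
    (h₂ : m₂ ≤ m₀) (hind : Indep mf m₂ P) {f : Ω → ℝ} (hf : StronglyMeasurable[mf] f)
    (hint : Integrable f P) : P[f | m₁ ⊔ m₂] =ᵐ[P] P[f | m₁] := by
  have hle : m₁ ⊔ m₂ ≤ m₀ := sup_le (h₁.trans hmf) h₂
  have hg : Integrable (P[f | m₁]) P := integrable_condExp
  have hgm : StronglyMeasurable[m₁ ⊔ m₂] (P[f | m₁]) := stronglyMeasurable_condExp.mono le_sup_left
  symm
  refine ae_eq_condExp_of_forall_setIntegral_eq hle hint (fun s _ _ => hg.integrableOn) ?_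
    hgm.aestronglyMeasurable
  intro s hs _
  induction s, hs using MeasurableSpace.induction_on_inter (sup_eq_generateFrom_inter m₁ m₂)
    (isPiSystem_inter m₁ m₂) with
  | empty => simp
  | basic s hs =>
    obtain ⟨A, B, hA, hB, rfl⟩ := hs
    -- On a rectangle both integrals factor, with common factor `P(B)`, and the integrals over `A`
    -- agree by the definition of conditional expectation given `m₁`.
    rw [setIntegral_inter_of_indep (h₁.trans hmf) h₂ (indep_of_indep_of_le_left hind h₁)
        stronglyMeasurable_condExp hg hA hB,
      setIntegral_inter_of_indep hmf h₂ hind hf hint (h₁ A hA) hB,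
      setIntegral_condExp (h₁.trans hmf) hint hA]
  | compl s hs ih =>
    have ih := ih (measure_lt_top _ _)
    have e1 := setIntegral_compl (hle s hs) hg
    have e2 := setIntegral_compl (hle s hs) hint
    rw [e1, e2, ih, integral_condExp (h₁.trans hmf)]
  | iUnion s hd hs ih =>
    rw [integral_iUnion (fun n => hle _ (hs n)) hd hg.integrableOn,
      integral_iUnion (fun n => hle _ (hs n)) hd hint.integrableOn]
    exact tsum_congr fun n => ih n (measure_lt_top _ _)

end SigmaAlgebra

/-! ### Conditional expectation as an L² projection -/

section L2Projection

variable {Ω : Type*} {m m' m₀ : MeasurableSpace Ω} {P : Measure Ω} [IsProbabilityMeasure P]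

/-- Conditional expectation as an operator on `L²`. -/
def condProj (P : Measure Ω) [IsProbabilityMeasure P] (hm : m ≤ m₀) : Lp ℝ 2 P →L[ℝ] Lp ℝ 2 P :=
  (lpMeas ℝ ℝ m 2 P).subtypeL ∘L condExpL2 ℝ ℝ hm

lemma condProj_toLp_ae_eq (hm : m ≤ m₀) {f : Ω → ℝ} (hf : MemLp f 2 P) :
    (condProj P hm (hf.toLp f) : Ω → ℝ) =ᵐ[P] P[f | m] :=
  hf.condExpL2_ae_eq_condExp (𝕜 := ℝ) hm

lemma condProj_ae_eq (hm : m ≤ m₀) (x : Lp ℝ 2 P) :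
    (condProj P hm x : Ω → ℝ) =ᵐ[P] P[(x : Ω → ℝ) | m] := by
  have := condProj_toLp_ae_eq hm (Lp.memLp x)
  rwa [Lp.toLp_coeFn] at this

lemma inner_condProj_left (hm : m ≤ m₀) (x y : Lp ℝ 2 P) :
    ⟪condProj P hm x, y⟫ = ⟪x, condProj P hm y⟫ :=
  inner_condExpL2_left_eq_right hm

lemma condProj_eq_self (hm : m ≤ m₀) {x : Lp ℝ 2 P} (hx : AEStronglyMeasurable[m] x P) :
    condProj P hm x = x := by
  refine Lp.ext ((condProj_ae_eq hm x).trans ?_)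
  exact condExp_of_aestronglyMeasurable' hm hx ((Lp.memLp x).integrable one_le_two)

lemma aestronglyMeasurable_condProj (hm : m ≤ m₀) (x : Lp ℝ 2 P) :
    AEStronglyMeasurable[m] (condProj P hm x) P :=
  aestronglyMeasurable_condExpL2 hm x

lemma condProj_condProj_of_le (hm : m ≤ m') (hm' : m' ≤ m₀) (x : Lp ℝ 2 P) :
    condProj P hm' (condProj P (hm.trans hm') x) = condProj P (hm.trans hm') x :=
  condProj_eq_self hm' ((aestronglyMeasurable_condProj _ x).mono hm)

/-- Self-adjointness moves both operators to the other argument, which reverses their order. -/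
lemma condProj_condProj_of_ge (hm : m ≤ m') (hm' : m' ≤ m₀) (x : Lp ℝ 2 P) :
    condProj P (hm.trans hm') (condProj P hm' x) = condProj P (hm.trans hm') x := by
  refine ext_inner_right ℝ fun y => ?_
  rw [inner_condProj_left, inner_condProj_left, condProj_condProj_of_le hm hm', ← inner_condProj_left]

/-- `L²` version of Lévy's upward theorem. -/
lemma tendsto_condProj_of_measurable_iSup {ℱ : Filtration ℕ m₀} {f : Ω → ℝ} (hf : MemLp f 2 P)
    (hmeas : StronglyMeasurable[⨆ n, ℱ n] f) :
    Tendsto (fun n => condProj P (ℱ.le n) (hf.toLp f)) atTop (𝓝 (hf.toLp f)) := by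
  have : ∀ n, Fact (ℱ n ≤ m₀) := fun n => ⟨ℱ.le n⟩
  have hmono : Monotone fun n => lpMeas ℝ ℝ (ℱ n) 2 P := by
    intro i j hij x hx
    rw [mem_lpMeas_iff_aestronglyMeasurable] at hx ⊢
    exact hx.mono (ℱ.mono hij)
  have : (⨆ n, lpMeas ℝ ℝ (ℱ n) 2 P).topologicalClosure.HasOrthogonalProjection :=
    have : CompleteSpace (⨆ n, lpMeas ℝ ℝ (ℱ n) 2 P).topologicalClosure :=
      (Submodule.isClosed_topologicalClosure _).completeSpace_coe
    inferInstance
  -- Norm convergence holds for projections onto any increasing sequence of closed subspaces. It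
  -- remains to identify the limit `y` with `f`.
  have hconv := Submodule.starProjection_tendsto_closure_iSup
    (fun n => lpMeas ℝ ℝ (ℱ n) 2 P) hmono (hf.toLp f)
  set y := (⨆ n, lpMeas ℝ ℝ (ℱ n) 2 P).topologicalClosure.starProjection (hf.toLp f) with hy
  have hconv' : Tendsto (fun n => condProj P (ℱ.le n) (hf.toLp f)) atTop (𝓝 y) := hconv
  suffices y = hf.toLp f by rwa [this] at hconv'
  -- L² convergence and Lévy's almost sure theorem both imply convergence in measure, whose limit is
  -- unique.
  have hmeas1 := tendstoInMeasure_of_tendsto_Lp hconv'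
  have hmeas2 : TendstoInMeasure P (fun n => (condProj P (ℱ.le n) (hf.toLp f) : Ω → ℝ)) atTop
      (hf.toLp f) := by
    refine (tendstoInMeasure_of_tendsto_ae
      (fun n => (stronglyMeasurable_condExp.mono (ℱ.le n)).aestronglyMeasurable)
      ((hf.integrable one_le_two).tendsto_ae_condExp hmeas)).congr ?_ hf.coeFn_toLp.symm
    exact fun n => (condProj_toLp_ae_eq (ℱ.le n) hf).symm
  exact Lp.ext (tendstoInMeasure_ae_unique hmeas1 hmeas2)

end L2Projection

/-! ### Projections generated by the innovations and the coupling bound -/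

section Innovation

variable {Ω : Type*} {ε ε' : ℤ → Ω → ℝ}

/-- The σ-algebra generated by the innovations with index in `S`. -/
@[reducible] def sigmaOf (ε : ℤ → Ω → ℝ) (S : Set ℤ) : MeasurableSpace Ω :=
  ⨆ i ∈ S, MeasurableSpace.comap (ε i) inferInstance

lemma sigmaOf_mono {S T : Set ℤ} (h : S ⊆ T) : sigmaOf ε S ≤ sigmaOf ε T :=
  biSup_mono fun _ hi => h hi

lemma sigmaOf_union (S T : Set ℤ) : sigmaOf ε (S ∪ T) = sigmaOf ε S ⊔ sigmaOf ε T :=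
  iSup_union

lemma measurable_sigmaOf {S : Set ℤ} {i : ℤ} (hi : i ∈ S) : Measurable[sigmaOf ε S] (ε i) :=
  (comap_measurable (ε i)).mono
    (le_iSup₂_of_le (f := fun i (_ : i ∈ S) => MeasurableSpace.comap (ε i) inferInstance)
      i hi le_rfl) le_rfl

lemma measurable_past (t : ℤ) : Measurable[sigmaOf ε (Set.Iic t)] (past ε t) := by
  refine @measurable_pi_lambda _ _ _ (sigmaOf ε (Set.Iic t)) _ _ fun j => ?_
  exact measurable_sigmaOf (by simp)

/-- The bracketing isolates the innovations after `a` from the rest, which is independent of `σ(ε_i,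
i ≥ a)`; this is the shape needed to discard the rest in a conditional expectation. -/
lemma measurable_coupledPast (t a : ℤ) :
    Measurable[sigmaOf ε (Set.Ici (a + 1)) ⊔ (sigmaOf ε (Set.Iio a) ⊔
      MeasurableSpace.comap (ε' a) inferInstance)] (coupledPast ε ε' t a) := by
  refine @measurable_pi_lambda _ _ _ (_) _ _ fun j => ?_
  by_cases hj : t - j = a
  · simp only [coupledPast, hj, if_true]
    exact (comap_measurable (ε' a)).mono (le_sup_of_le_right le_sup_right) le_rfl
  · simp only [coupledPast, hj, if_false]
    rcases lt_or_gt_of_ne hj with h | h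
    · exact (measurable_sigmaOf (S := Set.Iio a) h).mono (le_sup_of_le_right le_sup_left) le_rfl
    · exact (measurable_sigmaOf (S := Set.Ici (a + 1)) (Int.add_one_le_of_lt h)).mono
        le_sup_left le_rfl

variable [m₀ : MeasurableSpace Ω] {P : Measure Ω}

lemma sigmaOf_le (hε : ∀ t, Measurable (ε t)) (S : Set ℤ) : sigmaOf ε S ≤ m₀ :=
  iSup₂_le fun i _ => (hε i).comap_le

lemma indep_sigmaOf (hε : Innovations P ε ε') {S T : Set ℤ} (h : Disjoint S T) :
    Indep (sigmaOf ε S) (sigmaOf ε T) P :=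
  indep_iSup_of_disjoint (fun i => (hε.measurable i).comap_le) hε.indep.iIndep h

variable [IsProbabilityMeasure P]

lemma indep_sigmaOf_sup_copy (hε : Innovations P ε ε') {S T : Set ℤ} (h : Disjoint S T) (a : ℤ) :
    Indep (sigmaOf ε S) (sigmaOf ε T ⊔ MeasurableSpace.comap (ε' a) inferInstance) P := by
  refine indep_sup_of_indep_sup (sigmaOf_le hε.measurable S) (sigmaOf_le hε.measurable T)
    (hε.measurable_copy a).comap_le (indep_sigmaOf hε h) ?_
  rw [← sigmaOf_union]
  have h1 : Indep (MeasurableSpace.comap (ε' a) inferInstance)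
      (MeasurableSpace.comap (fun ω t => ε t ω) inferInstance) P := hε.indep_copy a
  refine (indep_of_indep_of_le_right h1 ?_).symm
  refine iSup₂_le fun i _ => ?_
  have : ε i = (fun x : ℤ → ℝ => x i) ∘ fun ω t => ε t ω := rfl
  rw [this, ← MeasurableSpace.comap_comp]
  exact MeasurableSpace.comap_mono (measurable_pi_apply i).comap_le

/-- The projection onto the square integrable functionals of the innovations from time `a` on. -/
def futureProj (P : Measure Ω) [IsProbabilityMeasure P] (hε : ∀ t, Measurable (ε t)) (a : ℤ) :
    Lp ℝ 2 P →L[ℝ] Lp ℝ 2 P :=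
  condProj P (sigmaOf_le hε (Set.Ici a))

lemma decreasingProjections_futureProj (hε : ∀ t, Measurable (ε t)) :
    DecreasingProjections (futureProj P hε) where
  symm a x y := inner_condProj_left _ x y
  comp a b x := by
    rcases le_total a b with h | h
    · rw [max_eq_right h]
      exact condProj_condProj_of_le (sigmaOf_mono (Set.Ici_subset_Ici.2 h)) _ x
    · rw [max_eq_left h]
      exact condProj_condProj_of_ge (sigmaOf_mono (Set.Ici_subset_Ici.2 h)) _ x

/-- Innovations from `t + 1` on are independent of those up to `t`. Hence removing the part in the
range of `futureProj` at `t + 1` is the same as centering. -/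
lemma futureProj_succ_ae_eq (hε : Innovations P ε ε') {t : ℤ} {f : Ω → ℝ}
    (hf : Measurable[sigmaOf ε (Set.Iic t)] f) (hf2 : MemLp f 2 P) :
    (futureProj P hε.measurable (t + 1) (hf2.toLp f) : Ω → ℝ) =ᵐ[P] fun _ => ∫ ω, f ω ∂P := by
  refine (condProj_toLp_ae_eq _ hf2).trans ?_
  refine condExp_indep_eq (sigmaOf_le hε.measurable (Set.Iic t)) (sigmaOf_le hε.measurable _) hf.stronglyMeasurable
    (indep_sigmaOf hε ?_)
  rw [Set.disjoint_left]
  intro i hi hi'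
  simp only [Set.mem_Iic, Set.mem_Ici] at hi hi'
  lia

lemma tendsto_futureProj (hε : ∀ t, Measurable (ε t)) {S : Set ℤ} {f : Ω → ℝ}
    (hf : Measurable[sigmaOf ε S] f) (hf2 : MemLp f 2 P) (t : ℤ) :
    Tendsto (fun m : ℕ => futureProj P hε (t - m) (hf2.toLp f)) atTop (𝓝 (hf2.toLp f)) := by
  let ℱ : Filtration ℕ m₀ :=
    { seq := fun m => sigmaOf ε (Set.Ici (t - m))
      mono' := fun i j hij => sigmaOf_mono (Set.Ici_subset_Ici.2 (by lia))
      le' := fun m => sigmaOf_le hε _ }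
  have hle : sigmaOf ε S ≤ ⨆ m, ℱ m := by
    refine iSup₂_le fun i _ => ?_
    refine le_trans ?_ (le_iSup (fun m => ℱ m) (t - i).toNat)
    have hi : i ∈ Set.Ici (t - ((t - i).toNat : ℤ)) := by
      simp only [Set.mem_Ici]; lia
    exact le_iSup₂_of_le (f := fun i (_ : i ∈ Set.Ici (t - ((t - _).toNat : ℤ))) =>
      MeasurableSpace.comap (ε i) inferInstance) i hi le_rfl
  exact tendsto_condProj_of_measurable_iSup (ℱ := ℱ) hf2 (hf.mono hle le_rfl).stronglyMeasurable

/-- Conditioning a functional of the innovations up to time `t` on the innovations from time `s`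
on amounts to conditioning on the innovations between times `s` and `t`. -/
lemma condExp_Ici_eq_Icc (hε : Innovations P ε ε') {s t : ℤ} (hst : s ≤ t + 1) {f : Ω → ℝ}
    (hf : Measurable[sigmaOf ε (Set.Iic t)] f) (hint : Integrable f P) :
    P[f | sigmaOf ε (Set.Ici s)] =ᵐ[P] P[f | sigmaOf ε (Set.Icc s t)] := by
  have h : Set.Ici s = Set.Icc s t ∪ Set.Ioi t := by
    ext i; simp only [Set.mem_Ici, Set.mem_union, Set.mem_Icc, Set.mem_Ioi]; lia
  rw [h, sigmaOf_union]
  refine condExp_sup_eq_of_indep (sigmaOf_mono Set.Icc_subset_Iic_self)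
    (sigmaOf_le hε.measurable _) (sigmaOf_le hε.measurable _) (indep_sigmaOf hε ?_)
    hf.stronglyMeasurable hint
  exact Set.Iic_disjoint_Ioi le_rfl

/-- The increment at lag `k` is dominated by the functional dependence measure. -/
lemma norm_increment_le_of_coupled (hε : Innovations P ε ε') {H : (ℕ → ℝ) → ℝ} (hH : Measurable H)
    {t a : ℤ} (hf : MemLp (fun ω => H (past ε t ω)) 2 P)
    (hfc : MemLp (fun ω => H (past ε t ω) - H (coupledPast ε ε' t a ω)) 2 P) :
    ‖increment (futureProj P hε.measurable) a (hf.toLp _)‖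
      ≤ (eLpNorm (fun ω => H (past ε t ω) - H (coupledPast ε ε' t a ω)) 2 P).toReal := by
  have hD := decreasingProjections_futureProj (P := P) hε.measurable
  set Q := increment (futureProj P hε.measurable) a (hf.toLp _) with hQ
  have hstar : MemLp (fun ω => H (coupledPast ε ε' t a ω)) 2 P := by
    refine (hf.sub hfc).ae_eq (.of_forall fun ω => ?_)
    simp
  have hle : sigmaOf ε (Set.Ici (a + 1)) ⊔ (sigmaOf ε (Set.Iio a) ⊔
      MeasurableSpace.comap (ε' a) inferInstance) ≤ m₀ :=
    sup_le (sigmaOf_le hε.measurable _)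
      (sup_le (sigmaOf_le hε.measurable _) (hε.measurable_copy a).comap_le)
  -- `Q` depends on the innovations from `a` on and has conditional mean zero given those from `a +
  -- 1` on.
  have hQm : AEStronglyMeasurable[sigmaOf ε (Set.Ici a)] Q P := by
    have h1 : futureProj P hε.measurable a Q = Q := by
      rw [hQ, increment, sub_apply, map_sub, hD.comp, hD.comp, max_self,
        max_eq_right (by lia)]
    rw [← h1]
    exact aestronglyMeasurable_condProj _ _
  have hQ0 : futureProj P hε.measurable (a + 1) Q = 0 := by
    rw [hQ, increment, sub_apply, map_sub, hD.comp, hD.comp, max_self,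
        max_eq_left (by lia), sub_self]
  have hQint : Integrable Q P := (Lp.memLp Q).integrable one_le_two
  have hQ1 : P[(Q : Ω → ℝ) | sigmaOf ε (Set.Ici (a + 1))] =ᵐ[P] 0 := by
    refine (condProj_ae_eq (sigmaOf_le hε.measurable _) Q).symm.trans ?_
    change (futureProj P hε.measurable (a + 1) Q : Ω → ℝ) =ᵐ[P] 0
    rw [hQ0]
    exact Lp.coeFn_zero _ _ _
  -- Adjoining the innovations before `a` and the copy at `a` adds only information independent of
  -- `σ(ε_i, i ≥ a)`, so the conditional mean stays zero.
  have hQ2 : condProj P hle Q = 0 := by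
    refine Lp.ext ((condProj_ae_eq hle Q).trans ?_)
    refine EventuallyEq.trans ?_ (Lp.coeFn_zero _ _ _).symm
    obtain ⟨g, hg, hgQ⟩ := hQm
    have hgint : Integrable g P := hQint.congr hgQ
    refine (condExp_congr_ae hgQ).trans ?_
    refine (condExp_sup_eq_of_indep (sigmaOf_mono (Set.Ici_subset_Ici.2 (by lia)))
      (sigmaOf_le hε.measurable (Set.Ici a))
      (sup_le (sigmaOf_le hε.measurable _) (hε.measurable_copy a).comap_le)
      (indep_sigmaOf_sup_copy hε ?_ a) hg hgint).trans ?_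
    · exact (Set.Iio_disjoint_Ici le_rfl).symm
    · exact (condExp_congr_ae hgQ.symm).trans hQ1
  have horth : ⟪Q, hstar.toLp _⟫ = 0 := by
    have h1 : condProj P hle (hstar.toLp _) = hstar.toLp _ := by
      refine condProj_eq_self hle ?_
      refine AEStronglyMeasurable.congr ?_ hstar.coeFn_toLp.symm
      exact (hH.comp (measurable_coupledPast t a)).stronglyMeasurable.aestronglyMeasurable
    rw [← h1, ← inner_condProj_left, hQ2, inner_zero_left]
  -- Since `Q` is orthogonal to the coupled variable, that variable can be subtracted for free
  -- before Cauchy–Schwarz.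
  have hsq : ‖Q‖ * ‖Q‖ ≤ ‖Q‖ * ‖hfc.toLp _‖ := by
    calc ‖Q‖ * ‖Q‖ = ⟪Q, hf.toLp _⟫ := by
          rw [hQ, hD.inner_increment_eq, real_inner_self_eq_norm_mul_norm]
      _ = ⟪Q, hf.toLp _ - hstar.toLp _⟫ := by rw [inner_sub_right, horth, sub_zero]
      _ = ⟪Q, hfc.toLp _⟫ := by rw [← MemLp.toLp_sub]; rfl
      _ ≤ _ := real_inner_le_norm _ _
  rw [← Lp.norm_toLp _ hfc]
  rcases (norm_nonneg Q).eq_or_lt with h0 | h0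
  · rw [← h0]; exact norm_nonneg _
  · exact le_of_mul_le_mul_left hsq h0

end Innovation

/-! ### Characteristic function estimates -/

section CharFun

variable {Ω : Type*} [MeasurableSpace Ω] {P : Measure Ω}

lemma charFun_map_eq {S : Ω → ℝ} (hS : AEMeasurable S P) (s : ℝ) :
    charFun (P.map S) s = ∫ ω, Complex.exp ((s * S ω : ℝ) * Complex.I) ∂P := by
  rw [charFun_apply_real, integral_map hS (by fun_prop)]
  simp

variable [IsProbabilityMeasure P]

lemma norm_exp_mul_I_sub_le {x : ℝ} (hx : |x| ≤ 1) :
    ‖Complex.exp (x * Complex.I) - (1 + x * Complex.I - (x : ℂ) ^ 2 / 2)‖ ≤ |x| ^ 3 / 2 := by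
  have hn : ‖(x * Complex.I : ℂ)‖ = |x| := by simp
  have h := Complex.exp_bound (x := x * Complex.I) (by rw [hn]; exact hx) (n := 3) (by norm_num)
  rw [hn] at h
  have e : ∑ m ∈ Finset.range 3, (x * Complex.I : ℂ) ^ m / (m.factorial : ℂ)
      = 1 + x * Complex.I - (x : ℂ) ^ 2 / 2 := by
    simp [Finset.sum_range_succ, mul_pow, Nat.factorial]
    ring
  rw [e] at h
  refine h.trans ?_
  have h3 : 0 ≤ |x| ^ 3 := by positivity
  -- `Complex.exp_bound` gives the constant `4 / (3! · 3) = 2/9`, which is relaxed to `1/2`.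
  norm_num [Nat.factorial]
  nlinarith

lemma integrable_exp_mul_I {S : Ω → ℝ} (hS : AEMeasurable S P) (s : ℝ) :
    Integrable (fun ω => Complex.exp ((s * S ω : ℝ) * Complex.I)) P := by
  refine Integrable.of_bound (C := 1) ?_ (.of_forall fun ω => ?_)
  · refine AEMeasurable.aestronglyMeasurable ?_
    fun_prop
  · rw [Complex.norm_exp_ofReal_mul_I]

/-- `x ↦ exp(isx)` is `|s|`-Lipschitz and the L¹ norm is at most the L² norm. Through this bound,
small L² errors become small errors of characteristic functions. -/
lemma norm_charFun_map_sub_le {S T : Ω → ℝ} (hS : MemLp S 2 P) (hT : MemLp T 2 P) (s : ℝ) :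
    ‖charFun (P.map S) s - charFun (P.map T) s‖ ≤ |s| * ‖hS.toLp S - hT.toLp T‖ := by
  have hSm := hS.aestronglyMeasurable.aemeasurable
  have hTm := hT.aestronglyMeasurable.aemeasurable
  rw [charFun_map_eq hSm, charFun_map_eq hTm,
    ← integral_sub (integrable_exp_mul_I hSm s) (integrable_exp_mul_I hTm s)]
  have hd : MemLp (S - T) 2 P := hS.sub hT
  have h1 : ∀ ω, ‖Complex.exp ((s * S ω : ℝ) * Complex.I) - Complex.exp ((s * T ω : ℝ) * Complex.I)‖
      ≤ |s| * ‖(S - T) ω‖ := by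
    intro ω
    have e : Complex.exp ((s * S ω : ℝ) * Complex.I) - Complex.exp ((s * T ω : ℝ) * Complex.I)
        = Complex.exp ((s * T ω : ℝ) * Complex.I) *
          (Complex.exp (Complex.I * (s * (S ω - T ω) : ℝ)) - 1) := by
      rw [mul_sub, ← Complex.exp_add, mul_one]
      congr 2
      push_cast; ring
    rw [e, norm_mul, Complex.norm_exp_ofReal_mul_I, one_mul]
    refine (Real.norm_exp_I_mul_ofReal_sub_one_le).trans ?_
    rw [norm_mul, Real.norm_eq_abs s, Pi.sub_apply]
  have hint : Integrable (fun ω => |s| * ‖(S - T) ω‖) P :=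
    (hd.integrable one_le_two).norm.const_mul _
  refine (norm_integral_le_of_norm_le hint (.of_forall h1)).trans ?_
  rw [integral_const_mul]
  refine mul_le_mul_of_nonneg_left ?_ (abs_nonneg s)
  rw [← MemLp.toLp_sub, Lp.norm_toLp, integral_norm_eq_lintegral_enorm hd.aestronglyMeasurable,
    ← eLpNorm_one_eq_lintegral_enorm]
  exact ENNReal.toReal_mono hd.eLpNorm_ne_top
    (eLpNorm_le_eLpNorm_of_exponent_le one_le_two hd.aestronglyMeasurable)

/-- Both quantities are compared with `1 - s² v / 2`, where `v` is the second moment. Each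
comparison costs at most `|s|³ η v / 2`. -/
lemma norm_charFun_map_sub_exp_le {U : Ω → ℝ} (hU : AEMeasurable U P) {η s : ℝ}
    (hb : ∀ᵐ ω ∂P, |U ω| ≤ η) (h0 : ∫ ω, U ω ∂P = 0) (hs : |s| * η ≤ 1) :
    ‖charFun (P.map U) s - Real.exp (-(s ^ 2 / 2 * ∫ ω, U ω ^ 2 ∂P))‖
      ≤ |s| ^ 3 * η * ∫ ω, U ω ^ 2 ∂P := by
  have hη : 0 ≤ η := by
    obtain ⟨ω, hω⟩ := hb.exists
    exact (abs_nonneg _).trans hω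
  have hUi : Integrable U P := Integrable.of_bound hU.aestronglyMeasurable η hb
  have hU2 : Integrable (fun ω => U ω ^ 2) P := by
    refine Integrable.of_bound (hU.pow_const 2).aestronglyMeasurable (η ^ 2) ?_
    filter_upwards [hb] with ω hω
    rw [Real.norm_eq_abs, abs_pow]
    exact pow_le_pow_left₀ (abs_nonneg _) hω 2
  set v := ∫ ω, U ω ^ 2 ∂P with hv
  have hv0 : 0 ≤ v := integral_nonneg fun ω => sq_nonneg _
  have hvη : v ≤ η ^ 2 := by
    have := integral_mono_ae hU2 (integrable_const (η ^ 2)) (hb.mono fun ω hω => by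
      simpa using pow_le_pow_left₀ (abs_nonneg _) hω 2)
    simpa using this
  have i1 : Integrable (fun ω => ((s * U ω : ℝ) : ℂ) * Complex.I) P :=
    (hUi.const_mul s).ofReal.mul_const _
  have i2 : Integrable (fun ω => ((s * U ω : ℝ) : ℂ) ^ 2 / 2) P := by
    have := ((hU2.const_mul (s ^ 2)).ofReal (𝕜 := ℂ)).div_const 2
    refine this.congr (.of_forall fun ω => ?_)
    simp [mul_pow]
  have i3 : Integrable (fun ω => 1 + ((s * U ω : ℝ) : ℂ) * Complex.I) P :=
    (integrable_const _).add i1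
  have hmain : ‖charFun (P.map U) s - (1 - s ^ 2 / 2 * v : ℝ)‖ ≤ |s| ^ 3 * η / 2 * v := by
    have e : ((1 - s ^ 2 / 2 * v : ℝ) : ℂ)
        = ∫ ω, (1 + (s * U ω : ℝ) * Complex.I - ((s * U ω : ℝ) : ℂ) ^ 2 / 2) ∂P := by
      rw [integral_sub i3 i2, integral_add (integrable_const _) i1,
        integral_mul_const, integral_div, integral_complex_ofReal, integral_const_mul, h0]
      have e2 : ∫ ω, ((s * U ω : ℝ) : ℂ) ^ 2 ∂P = ((s ^ 2 * v : ℝ) : ℂ) := by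
        rw [hv, ← integral_const_mul, ← integral_complex_ofReal]
        refine integral_congr_ae (.of_forall fun ω => ?_)
        simp [mul_pow]
      rw [e2]
      simp
      ring
    rw [charFun_map_eq hU, e, ← integral_sub (integrable_exp_mul_I hU s)]
    · refine (norm_integral_le_of_norm_le (hU2.const_mul (|s| ^ 3 * η / 2)) ?_).trans_eq
        (integral_const_mul _ _)
      filter_upwards [hb] with ω hω
      have hx : |s * U ω| ≤ 1 := by
        rw [abs_mul]
        exact (mul_le_mul_of_nonneg_left hω (abs_nonneg s)).trans hs
      refine (norm_exp_mul_I_sub_le hx).trans ?_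
      rw [abs_mul, mul_pow, pow_succ |U ω| 2, sq_abs]
      have : 0 ≤ |s| ^ 3 * U ω ^ 2 := by positivity
      nlinarith [mul_le_mul_of_nonneg_left hω this]
    · exact i3.sub i2
  have hy : |s| ^ 2 * v ≤ 1 := by
    have : |s| ^ 2 * v ≤ (|s| * η) ^ 2 := by
      rw [mul_pow]; exact mul_le_mul_of_nonneg_left hvη (by positivity)
    exact this.trans (pow_le_one₀ (by positivity) hs)
  have hexp : ‖((1 - s ^ 2 / 2 * v : ℝ) : ℂ) - Real.exp (-(s ^ 2 / 2 * v))‖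
      ≤ |s| ^ 3 * η / 2 * v := by
    rw [← Complex.ofReal_sub, Complex.norm_real, Real.norm_eq_abs, abs_sub_comm]
    rw [← sq_abs s]
    have h2 := Real.abs_exp_sub_one_sub_id_le (x := -(|s| ^ 2 / 2 * v)) (by
      rw [abs_neg, abs_of_nonneg (by positivity)]; linarith)
    have e : Real.exp (-(|s| ^ 2 / 2 * v)) - (1 - |s| ^ 2 / 2 * v)
        = Real.exp (-(|s| ^ 2 / 2 * v)) - 1 - -(|s| ^ 2 / 2 * v) := by ring
    rw [e]
    refine h2.trans ?_
    -- The quadratic remainder of the exponential is `(s² v)² / 4`; one factor `s² v ≤ (|s| η)² ≤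
    -- |s| η` is traded to reach the form `|s|³ η v`.
    have h3 : |s| ^ 2 * v ≤ |s| * η := by
      have h4 : |s| ^ 2 * v ≤ (|s| * η) ^ 2 := by
        rw [mul_pow]; exact mul_le_mul_of_nonneg_left hvη (by positivity)
      have h5 : 0 ≤ |s| * η := by positivity
      nlinarith
    have h6 : 0 ≤ |s| ^ 2 * v := by positivity
    nlinarith [mul_le_mul_of_nonneg_right h3 h6]
  calc _ ≤ ‖charFun (P.map U) s - (1 - s ^ 2 / 2 * v : ℝ)‖ +
        ‖((1 - s ^ 2 / 2 * v : ℝ) : ℂ) - Real.exp (-(s ^ 2 / 2 * v))‖ :=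
        norm_sub_le_norm_sub_add_norm_sub _ _ _
    _ ≤ |s| ^ 3 * η / 2 * v + |s| ^ 3 * η / 2 * v := add_le_add hmain hexp
    _ = _ := by ring

/-- Quantitative central limit theorem for sums of independent, centered, uniformly bounded
random variables. -/
lemma norm_charFun_sum_sub_exp_le {ι : Type*} (J : Finset ι) {U : ι → Ω → ℝ}
    (hU : ∀ j, AEMeasurable (U j) P) {η s : ℝ}
    (hb : ∀ j, ∀ᵐ ω ∂P, |U j ω| ≤ η) (h0 : ∀ j, ∫ ω, U j ω ∂P = 0) (hs : |s| * η ≤ 1)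
    (hind : ∀ (I : Finset ι) (j : ι), j ∉ I → IndepFun (fun ω => ∑ i ∈ I, U i ω) (U j) P) :
    ‖charFun (P.map fun ω => ∑ j ∈ J, U j ω) s
        - Real.exp (-(s ^ 2 / 2 * ∫ ω, (∑ j ∈ J, U j ω) ^ 2 ∂P))‖
      ≤ |s| ^ 3 * η * ∫ ω, (∑ j ∈ J, U j ω) ^ 2 ∂P := by
  classical
  induction J using Finset.induction_on with
  | empty =>
    simp
  | insert j J hj ih =>
    have hU2 : ∀ j, MemLp (U j) 2 P := fun j =>
      MemLp.of_bound (hU j).aestronglyMeasurable η (hb j)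
    set S : Ω → ℝ := fun ω => ∑ i ∈ J, U i ω with hSdef
    have hS2 : MemLp S 2 P := memLp_finsetSum J fun i _ => hU2 i
    have hSm : AEMeasurable S P := hS2.aestronglyMeasurable.aemeasurable
    have hi := hind J j hj
    have esum : (fun ω => ∑ i ∈ insert j J, U i ω) = S + U j := by
      ext ω; simp [hSdef, Finset.sum_insert hj, add_comm]
    have esum' : ∀ ω, ∑ i ∈ insert j J, U i ω = S ω + U j ω := fun ω => congrFun esum ω
    -- The cross term vanishes, so the variance is additive and the Gaussian factor splits as a
    -- product.
    have hmul : ∫ ω, S ω * U j ω ∂P = 0 := by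
      have := hi.integral_mul_eq_mul_integral hS2.aestronglyMeasurable (hU j).aestronglyMeasurable
      rw [h0 j, mul_zero] at this
      exact this
    have hSS : Integrable (fun ω => S ω ^ 2) P := hS2.integrable_sq
    have hUU : Integrable (fun ω => U j ω ^ 2) P := (hU2 j).integrable_sq
    have hSU : Integrable (fun ω => S ω * U j ω) P := hS2.integrable_mul (hU2 j)
    have hvar : ∫ ω, (∑ i ∈ insert j J, U i ω) ^ 2 ∂P
        = ∫ ω, S ω ^ 2 ∂P + ∫ ω, U j ω ^ 2 ∂P := by
      simp_rw [esum', add_sq]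
      rw [integral_add _ hUU, integral_add hSS]
      · simp_rw [mul_assoc]
        rw [integral_const_mul, hmul]; ring
      · simp_rw [mul_assoc]; exact hSU.const_mul 2
      · simp_rw [mul_assoc]; exact hSS.add (hSU.const_mul 2)
    rw [hvar, esum, hi.charFun_map_add_eq_mul hSm (hU j), Pi.mul_apply]
    set a := charFun (P.map S) s
    set b := charFun (P.map (U j)) s
    have hone := norm_charFun_map_sub_exp_le (hU j) (hb j) (h0 j) hs
    set A : ℝ := Real.exp (-(s ^ 2 / 2 * ∫ ω, S ω ^ 2 ∂P)) with hA
    set B : ℝ := Real.exp (-(s ^ 2 / 2 * ∫ ω, U j ω ^ 2 ∂P)) with hB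
    have hexp : Real.exp (-(s ^ 2 / 2 * (∫ ω, S ω ^ 2 ∂P + ∫ ω, U j ω ^ 2 ∂P))) = A * B := by
      rw [hA, hB, ← Real.exp_add]; congr 1; ring
    have hA1 : ‖(A : ℂ)‖ ≤ 1 := by
      rw [Complex.norm_real, Real.norm_eq_abs, abs_of_pos (Real.exp_pos _), Real.exp_le_one_iff]
      have : 0 ≤ ∫ ω, S ω ^ 2 ∂P := integral_nonneg fun ω => sq_nonneg _
      nlinarith [mul_nonneg (sq_nonneg s) this]
    have hb1 : ‖b‖ ≤ 1 := by
      have := Measure.isProbabilityMeasure_map (hU j)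
      exact norm_charFun_le_one s
    rw [hexp]
    -- All four factors have modulus at most one where needed, so the errors of the two factors
    -- simply add up along the induction.
    have e : a * b - ((A * B : ℝ) : ℂ) = (a - A) * b + A * (b - B) := by push_cast; ring
    rw [e]
    calc _ ≤ ‖a - A‖ * ‖b‖ + ‖(A : ℂ)‖ * ‖b - B‖ := by
          refine (norm_add_le _ _).trans ?_
          rw [norm_mul, norm_mul]
      _ ≤ ‖a - A‖ * 1 + 1 * ‖b - B‖ := by gcongr
      _ ≤ _ := by rw [mul_one, one_mul, mul_add]; exact add_le_add ih hone

end CharFun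

/-! ### Functions of bounded variation: shifts, Riemann sums, counting -/

section Kernel

lemma sum_Icc_one_int {M : Type*} [AddCommMonoid M] (f : ℤ → M) (n : ℕ) :
    ∑ t ∈ Finset.Icc (1 : ℤ) n, f t = ∑ i ∈ Finset.range n, f (i + 1) := by
  induction n with
  | zero => simp
  | succ n ih =>
    have : Finset.Icc (1 : ℤ) ((n + 1 : ℕ) : ℤ) = insert ((n : ℤ) + 1) (Finset.Icc (1 : ℤ) n) := by
      ext t; simp only [Finset.mem_insert, Finset.mem_Icc]; push_cast; lia
    rw [this, Finset.sum_insert (by simp), ih, Finset.sum_range_succ, add_comm]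

/-- A shift by one telescopes to two boundary values, each at most `V`; a shift by `m` is `m` such
shifts. -/
lemma sum_shift_sub_le {g : ℤ → ℝ} {V : ℝ} (hV : ∀ t, |g t| ≤ V) (n m : ℕ) :
    ∑ t ∈ Finset.Icc (1 : ℤ) n, (g (t + m) - g t) ≤ 2 * V * m := by
  induction m with
  | zero => simp
  | succ m ih =>
    have h1 : ∑ t ∈ Finset.Icc (1 : ℤ) n, (g (t + (m + 1 : ℕ)) - g (t + m)) ≤ 2 * V := by
      rw [sum_Icc_one_int]
      have := Finset.sum_range_sub (fun i : ℕ => g (i + 1 + m)) n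
      have e : ∀ i : ℕ, g ((i : ℤ) + 1 + (m + 1 : ℕ)) = g (((i + 1 : ℕ) : ℤ) + 1 + m) := by
        intro i; congr 1; push_cast; ring
      simp only [e]
      rw [this]
      have h2 := abs_le.1 (hV ((n : ℤ) + 1 + m))
      have h3 := abs_le.1 (hV (((0 : ℕ) : ℤ) + 1 + m))
      linarith [h2.2, h3.1]
    have h2 : ∑ t ∈ Finset.Icc (1 : ℤ) n, (g (t + (m + 1 : ℕ)) - g t)
        = ∑ t ∈ Finset.Icc (1 : ℤ) n, (g (t + (m + 1 : ℕ)) - g (t + m))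
          + ∑ t ∈ Finset.Icc (1 : ℤ) n, (g (t + m) - g t) := by
      rw [← Finset.sum_add_distrib]
      exact Finset.sum_congr rfl fun t _ => by ring
    rw [h2]
    have h3 : 2 * V * ((m + 1 : ℕ) : ℝ) = 2 * V + 2 * V * m := by push_cast; ring
    linarith

lemma sum_abs_shift_sub_le {g : ℤ → ℝ} (hg : Monotone g) {V : ℝ} (hV : ∀ t, |g t| ≤ V) (n : ℕ)
    (h : ℤ) : ∑ t ∈ Finset.Icc (1 : ℤ) n, |g (t + h) - g t| ≤ 2 * V * |(h : ℝ)| := by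
  obtain ⟨m, rfl | rfl⟩ := h.eq_nat_or_neg
  · have := sum_shift_sub_le hV n m
    refine (Finset.sum_congr rfl fun t _ => abs_of_nonneg (sub_nonneg.2 (hg (by lia)))).trans_le ?_
    simpa using this
  · have := sum_shift_sub_le (g := fun t => g (t - m)) (fun t => hV _) n m
    simp only [add_sub_cancel_right] at this
    refine (Finset.sum_congr rfl fun t _ => ?_).trans_le (this.trans_eq (by simp))
    rw [abs_of_nonpos (sub_nonpos.2 (hg (by lia))), neg_sub]
    rfl

/-- `v x` is the total variation of `f` on `(-∞, x]`. The regularity of the kernel is used below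
through this dominating function. -/
lemma exists_monotone_variation {f : ℝ → ℝ} (hf : BoundedVariationOn f Set.univ) :
    ∃ (v : ℝ → ℝ) (V : ℝ), Monotone v ∧ (∀ x, |v x| ≤ V) ∧
      ∀ x y, x ≤ y → |f y - f x| ≤ v y - v x := by
  have hfin : ∀ s, eVariationOn f s ≠ ∞ := fun s => (hf.mono (Set.subset_univ s))
  refine ⟨fun x => (eVariationOn f (Set.Iic x)).toReal, (eVariationOn f Set.univ).toReal, ?_, ?_, ?_⟩
  · exact fun x y hxy => ENNReal.toReal_mono (hfin _) (eVariationOn.mono f (Set.Iic_subset_Iic.2 hxy))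
  · intro x
    rw [abs_of_nonneg ENNReal.toReal_nonneg]
    exact ENNReal.toReal_mono (hfin _) (eVariationOn.mono f (Set.subset_univ _))
  · intro x y hxy
    have h1 := eVariationOn.union f (isGreatest_Iic (a := x)) (isLeast_Icc hxy)
    rw [Set.Iic_union_Icc_eq_Iic hxy] at h1
    have h2 := eVariationOn.edist_le f (Set.right_mem_Icc.2 hxy) (Set.left_mem_Icc.2 hxy)
    simp only [h1]
    rw [ENNReal.toReal_add (hfin _) (hfin _), add_sub_cancel_left, ← Real.dist_eq, dist_edist]
    exact ENNReal.toReal_mono (hfin _) h2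

/-- `v - f` is monotone too, so `f` is a difference of monotone functions. -/
lemma measurable_of_abs_sub_le {f v : ℝ → ℝ} (hv : Monotone v)
    (h : ∀ x y, x ≤ y → |f y - f x| ≤ v y - v x) : Measurable f := by
  have h1 : Monotone fun x => v x - f x := by
    intro x y hxy
    have := (abs_le.1 (h x y hxy)).2
    simp only
    linarith
  have h2 : f = fun x => v x - (v x - f x) := by ext x; ring
  rw [h2]
  exact hv.measurable.sub h1.measurable

/-- Riemann sums of a function whose oscillation is controlled by a bounded monotone function. -/
lemma abs_riemann_sum_sub_integral_le {f v : ℝ → ℝ} (hv : Monotone v) {V : ℝ} (hV : ∀ x, |v x| ≤ V)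
    (hf : ∀ x y, x ≤ y → |f y - f x| ≤ v y - v x) {B : ℝ} (hB : ∀ x, |f x| ≤ B)
    {x₀ h : ℝ} (hh : 0 ≤ h) {N : ℕ} (hsupp : Function.support f ⊆ Set.Ioc x₀ (x₀ + N * h)) :
    |h * ∑ i ∈ Finset.range N, f (x₀ + (i + 1 : ℕ) * h) - ∫ x, f x| ≤ h * (2 * V) := by
  have hmeas := measurable_of_abs_sub_le hv hf
  have hint : ∀ a b : ℝ, IntervalIntegrable f volume a b := by
    intro a b
    refine (intervalIntegrable_const (c := B)).mono_fun hmeas.aestronglyMeasurable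
      (.of_forall fun x => ?_)
    simp only [Real.norm_eq_abs]
    exact (hB x).trans (le_abs_self B)
  let p : ℕ → ℝ := fun i => x₀ + i * h
  have hp : ∀ i, p (i + 1) = p i + h := fun i => by simp only [p]; push_cast; ring
  have e1 : ∫ x, f x = ∑ i ∈ Finset.range N, ∫ x in p i..p (i + 1), f x := by
    rw [intervalIntegral.sum_integral_adjacent_intervals fun i _ => hint _ _,
      intervalIntegral.integral_eq_integral_of_support_subset]
    simpa [p] using hsupp
  rw [e1, Finset.mul_sum, ← Finset.sum_sub_distrib]
  calc _ ≤ ∑ i ∈ Finset.range N, |h * f (p (i + 1)) - ∫ x in p i..p (i + 1), f x| :=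
        Finset.abs_sum_le_sum_abs _ _
    _ ≤ ∑ i ∈ Finset.range N, h * (v (p (i + 1)) - v (p i)) := by
        -- On one cell the oscillation of `f` is at most the increase of `v` over the cell, and
        -- these increases telescope.
        refine Finset.sum_le_sum fun i _ => ?_
        have hle : p i ≤ p (i + 1) := by rw [hp]; linarith
        have e2 : h * f (p (i + 1)) - ∫ x in p i..p (i + 1), f x
            = ∫ x in p i..p (i + 1), (f (p (i + 1)) - f x) := by
          rw [intervalIntegral.integral_sub intervalIntegrable_const (hint _ _),
            intervalIntegral.integral_const, hp, smul_eq_mul]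
          ring
        rw [e2, ← Real.norm_eq_abs]
        refine (intervalIntegral.norm_integral_le_of_norm_le_const
          (C := v (p (i + 1)) - v (p i)) fun x hx => ?_).trans_eq ?_
        · rw [Set.uIoc_of_le hle] at hx
          rw [Real.norm_eq_abs]
          refine (hf _ _ hx.2).trans ?_
          have := hv hx.1.le
          linarith
        · rw [hp, add_sub_cancel_left, abs_of_nonneg hh]; ring
    _ = h * (v (p N) - v (p 0)) := by rw [← Finset.mul_sum, Finset.sum_range_sub (fun i => v (p i))]
    _ ≤ h * (2 * V) := by
        refine mul_le_mul_of_nonneg_left ?_ hh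
        have h2 := abs_le.1 (hV (p N))
        have h3 := abs_le.1 (hV (p 0))
        linarith [h2.2, h3.1]

/-- Number of integers in an interval whose residue modulo `L` is less than `k`. -/
lemma card_emod_lt_le {L : ℕ} (hL : 0 < L) (k : ℕ) {x y : ℝ} (hxy : x ≤ y + L) (s : Finset ℤ)
    (hs : ∀ t ∈ s, x ≤ t ∧ (t : ℝ) ≤ y) :
    ((s.filter fun t : ℤ => t % L < k).card : ℝ) ≤ ((y - x) / L + 2) * (min k L : ℕ) := by
  classical
  have hL' : (0 : ℤ) < L := by exact_mod_cast hL
  have hLr : (0 : ℝ) < L := by exact_mod_cast hL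
  let A : ℤ := ⌈x⌉ / L
  let B : ℤ := ⌊y⌋ / L
  -- Quotient and remainder embed the counted integers in a box with at most `(y - x)/L + 2`
  -- quotients and `min k L` remainders.
  have hinj : Set.InjOn (fun t : ℤ => (t / L, t % L)) (s.filter fun t : ℤ => t % L < k) := by
    intro t _ t' _ h
    simp only [Prod.mk.injEq] at h
    rw [← Int.mul_ediv_add_emod t L, ← Int.mul_ediv_add_emod t' L, h.1, h.2]
  have hmap : Set.MapsTo (fun t : ℤ => (t / L, t % L)) (s.filter fun t : ℤ => t % L < k)
      ((Finset.Icc A B ×ˢ Finset.Ico (0 : ℤ) ((min k L : ℕ) : ℤ) : Finset (ℤ × ℤ))) := by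
    intro t ht
    simp only [Finset.coe_filter, Set.mem_ofPred_eq] at ht
    obtain ⟨h1, h2⟩ := hs t ht.1
    simp only [Finset.coe_product, Finset.coe_Icc, Finset.coe_Ico, Set.mem_prod, Set.mem_Icc,
      Set.mem_Ico]
    refine ⟨⟨Int.ediv_le_ediv hL' (Int.ceil_le.2 h1), Int.ediv_le_ediv hL' (Int.le_floor.2 h2)⟩,
      Int.emod_nonneg _ hL'.ne', ?_⟩
    have h3 := Int.emod_lt_of_pos t hL'
    rw [Nat.cast_min]
    exact lt_min ht.2 h3
  have hcard := Finset.card_le_card_of_injOn _ hmap hinj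
  rw [Finset.card_product, Int.card_Icc, Int.card_Ico, sub_zero, Int.toNat_natCast] at hcard
  have hcard' : ((s.filter fun t : ℤ => t % L < k).card : ℝ)
      ≤ ((B + 1 - A).toNat : ℝ) * (min k L : ℕ) := by exact_mod_cast hcard
  refine hcard'.trans (mul_le_mul_of_nonneg_right ?_ (Nat.cast_nonneg _))
  have hB : (B : ℝ) ≤ y / L := by
    have h1 : (L : ℤ) * B ≤ ⌊y⌋ := Int.mul_ediv_self_le hL'.ne'
    have h2 : (L : ℝ) * B ≤ ⌊y⌋ := by exact_mod_cast h1
    rw [le_div_iff₀ hLr]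
    linarith [Int.floor_le y]
  have hA : x / L - 1 ≤ (A : ℝ) := by
    have h1 : ⌈x⌉ < (L : ℤ) * A + L := Int.lt_mul_ediv_self_add hL'
    have h2 : (⌈x⌉ : ℝ) ≤ L * A + L := by exact_mod_cast h1.le
    rw [sub_le_iff_le_add, div_le_iff₀ hLr]
    linarith [Int.le_ceil x]
  -- The hypothesis `x ≤ y + L` keeps the bound nonnegative even for an empty interval.
  have hnn : 0 ≤ (y - x) / L + 2 := by
    have : -1 ≤ (y - x) / L := by rw [le_div_iff₀ hLr]; linarith
    linarith
  have h3 : ((B + 1 - A).toNat : ℝ) = max ((B : ℝ) + 1 - A) 0 := by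
    have : (((B + 1 - A).toNat : ℤ) : ℝ) = ((max (B + 1 - A) 0 : ℤ) : ℝ) := by
      rw [Int.toNat_eq_max]
    push_cast at this
    exact_mod_cast this
  rw [h3]
  refine max_le ?_ hnn
  rw [sub_div]
  linarith

end Kernel

/-! ### Kernel weights -/

section Weights

/-- Weights on the observation times `1, …, n` that are uniformly small, concentrate around the
rescaled time `u`, and have all lagged correlations converging to `κ`. -/
structure LocalWeights (w : ℕ → ℤ → ℝ) (κ u α : ℝ) : Prop where
  sup_tendsto : ∃ e : ℕ → ℝ, Tendsto e atTop (𝓝 0) ∧ ∀ᶠ n in atTop, ∀ t, |w n t| ≤ e n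
  support : ∀ t₀ : ℤ, ∀ᶠ n : ℕ in atTop, ∀ t, w n t ≠ 0 → t₀ ≤ t ∧ t ≤ n
  localized : ∀ η : ℝ, 0 < η → ∀ᶠ n : ℕ in atTop, ∀ t : ℤ, w n t ≠ 0 → |(t : ℝ) / n - u| ≤ η
  corr : ∀ h : ℤ, Tendsto (fun n : ℕ => ∑ t ∈ Finset.Icc (1 : ℤ) n, w n t * w n (t + h)) atTop (𝓝 κ)
  residue : ∃ C : ℝ, 0 ≤ C ∧ ∀ L : ℕ, 0 < L → ∀ᶠ n : ℕ in atTop, ∀ k : ℕ,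
    ∑ t ∈ (Finset.Icc (1 : ℤ) n).filter (fun t : ℤ => t % L < k), w n t ^ 2
      ≤ C * min 1 ((k : ℝ) / L)
  sum_abs : Tendsto (fun n : ℕ => (∑ t ∈ Finset.Icc (1 : ℤ) n, |w n t|) * (n : ℝ) ^ (-α))
    atTop (𝓝 0)

/-- The weight `(n b)^{-1/2} K((t/n - u)/b)` of time `t` in the local sum. -/
def kernelWeight (K : ℝ → ℝ) (b : ℕ → ℝ) (u : ℝ) (n : ℕ) (t : ℤ) : ℝ :=
  (√(n * b n))⁻¹ * K (((t : ℝ) / n - u) / b n)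

variable {K : ℝ → ℝ} {b : ℕ → ℝ} {u : ℝ}

lemma abs_sub_le_of_kernelWeight_ne_zero (hK : LocalizingKernel K) {n : ℕ} (hb : 0 < b n) {t : ℤ}
    (h : kernelWeight K b u n t ≠ 0) : |(t : ℝ) / n - u| ≤ b n / 2 := by
  have h1 : K (((t : ℝ) / n - u) / b n) ≠ 0 := right_ne_zero_of_mul h
  have h2 := hK.support_subset h1
  rw [Set.mem_Icc, ← abs_le, abs_div, abs_of_pos hb, div_le_iff₀ hb] at h2
  linarith

/-- The weights are at most `B / √(nb)` and live on an interval of length `nb` of times; counting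
points there gives the residue and absolute-sum bounds. The lag-zero correlation is a Riemann sum of
`K²` with mesh `1/(nb)`, and other lags differ from it by `O(1/(nb))`. -/
lemma localWeights_kernelWeight (hK : LocalizingKernel K) {α : ℝ} (hb : Tendsto b atTop (𝓝 0))
    (hnb : Tendsto (fun n : ℕ => (n : ℝ) * b n) atTop atTop)
    (hbα : Tendsto (fun n : ℕ => √((n : ℝ) * b n) * (n : ℝ) ^ (-α)) atTop (𝓝 0))
    (hu : u ∈ Set.Ioo (0 : ℝ) 1) :
    LocalWeights (kernelWeight K b u) (∫ x, K x ^ 2) u α := by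
  obtain ⟨B, hB⟩ := hK.bounded
  have hB0 : 0 ≤ B := (abs_nonneg _).trans (hB 0)
  obtain ⟨v, V, hv, hV, hKv⟩ := exists_monotone_variation hK.boundedVariation
  have hV0 : 0 ≤ V := (abs_nonneg _).trans (hV 0)
  have hn0 : ∀ᶠ n : ℕ in atTop, (0 : ℝ) < n := (eventually_gt_atTop 0).mono fun n hn => by
    exact_mod_cast hn
  have hbpos : ∀ᶠ n in atTop, 0 < b n := by
    filter_upwards [hnb.eventually_gt_atTop 0, hn0] with n h1 h2
    exact (pos_iff_pos_of_mul_pos h1).1 h2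
  have hsmall : ∀ η : ℝ, 0 < η → ∀ᶠ n in atTop, b n < η := fun η hη => hb.eventually_lt_const hη
  have hsq : ∀ᶠ n : ℕ in atTop, 0 < √((n : ℝ) * b n) := by
    filter_upwards [hnb.eventually_gt_atTop 0] with n h1 using Real.sqrt_pos.2 h1
  have hwle : ∀ᶠ n : ℕ in atTop, ∀ t, |kernelWeight K b u n t| ≤ B * (√((n : ℝ) * b n))⁻¹ := by
    filter_upwards [hsq] with n h1 t
    rw [kernelWeight, abs_mul, abs_of_pos (inv_pos.2 h1), mul_comm]
    exact mul_le_mul_of_nonneg_right (hB _) (inv_pos.2 h1).le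
  have hsqrt_top : Tendsto (fun n : ℕ => √((n : ℝ) * b n)) atTop atTop :=
    Real.tendsto_sqrt_atTop.comp hnb
  have hcount : ∀ L : ℕ, 0 < L → ∀ᶠ n : ℕ in atTop, ∀ k : ℕ,
      ((((Finset.Icc (1 : ℤ) n).filter fun t => kernelWeight K b u n t ≠ 0).filter
        fun t : ℤ => t % L < k).card : ℝ) ≤ (n * b n / L + 2) * (min k L : ℕ) := by
    intro L hL
    filter_upwards [hbpos, hn0, hnb.eventually_gt_atTop 0] with n h1 h2 h3 k
    have := card_emod_lt_le hL k (x := n * (u - b n / 2)) (y := n * (u + b n / 2))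
      (by nlinarith [Nat.cast_nonneg (α := ℝ) L])
      ((Finset.Icc (1 : ℤ) n).filter fun t => kernelWeight K b u n t ≠ 0) (by
        intro t ht
        have h4 := abs_sub_le_of_kernelWeight_ne_zero hK h1 (Finset.mem_filter.1 ht).2
        rw [abs_le] at h4
        have h5 : (t : ℝ) = n * (t / n) := by field_simp
        constructor
        · rw [h5]; exact mul_le_mul_of_nonneg_left (by linarith [h4.1]) h2.le
        · rw [h5]; exact mul_le_mul_of_nonneg_left (by linarith [h4.2]) h2.le)
    have e : (n : ℝ) * (u + b n / 2) - n * (u - b n / 2) = n * b n := by ring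
    rwa [e] at this
  have hres : ∃ C : ℝ, 0 ≤ C ∧ ∀ L : ℕ, 0 < L → ∀ᶠ n : ℕ in atTop, ∀ k : ℕ,
      ∑ t ∈ (Finset.Icc (1 : ℤ) n).filter (fun t : ℤ => t % L < k), kernelWeight K b u n t ^ 2
        ≤ C * min 1 ((k : ℝ) / L) := by
    -- Once `nb ≥ L`, the count `(nb/L + 2) min(k, L)` is at most `3 nb min(1, k/L)`, and each
    -- squared weight is at most `B²/(nb)`.
    refine ⟨B ^ 2 * 3, by positivity, fun L hL => ?_⟩
    have hLr : (0 : ℝ) < L := by exact_mod_cast hL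
    filter_upwards [hcount L hL, hwle, hsq, hnb.eventually_ge_atTop (L : ℝ),
      hnb.eventually_gt_atTop 0] with n h1 h2 h3 h4 h5 k
    have e1 : ∑ t ∈ (Finset.Icc (1 : ℤ) n).filter (fun t : ℤ => t % L < k),
        kernelWeight K b u n t ^ 2
        = ∑ t ∈ ((Finset.Icc (1 : ℤ) n).filter fun t => kernelWeight K b u n t ≠ 0).filter
          (fun t : ℤ => t % L < k), kernelWeight K b u n t ^ 2 := by
      rw [Finset.filter_comm]
      symm
      apply Finset.sum_filter_of_ne
      intro t _ ht h0
      exact ht (by rw [h0]; simp)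
    rw [e1]
    have h6 : ∀ t, kernelWeight K b u n t ^ 2 ≤ B ^ 2 / (n * b n) := by
      intro t
      rw [← sq_abs]
      refine (pow_le_pow_left₀ (abs_nonneg _) (h2 t) 2).trans_eq ?_
      rw [mul_pow, inv_pow, Real.sq_sqrt h5.le, div_eq_mul_inv]
    refine (Finset.sum_le_card_nsmul _ _ _ fun t _ => h6 t).trans ?_
    rw [nsmul_eq_mul]
    refine (mul_le_mul_of_nonneg_right (h1 k) (by positivity)).trans ?_
    have h7 : n * b n / L + 2 ≤ 3 * (n * b n / L) := by
      have : 1 ≤ n * b n / L := by rwa [le_div_iff₀ hLr, one_mul]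
      linarith
    have h8 : ((min k L : ℕ) : ℝ) = L * min 1 ((k : ℝ) / L) := by
      rw [mul_min_of_nonneg _ _ hLr.le, mul_one, mul_div_cancel₀ _ hLr.ne', min_comm]
      push_cast; rfl
    rw [h8]
    calc _ ≤ 3 * (n * b n / L) * (L * min 1 ((k : ℝ) / L)) * (B ^ 2 / (n * b n)) := by
          gcongr
      _ = B ^ 2 * 3 * min 1 ((k : ℝ) / L) := by
          have := h5.ne'
          field_simp
          rw [mul_assoc]
          exact mul_div_cancel_left₀ _ this
  have hsumabs : ∀ᶠ n : ℕ in atTop, ∑ t ∈ Finset.Icc (1 : ℤ) n, |kernelWeight K b u n t|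
      ≤ 3 * B * √((n : ℝ) * b n) := by
    filter_upwards [hcount 1 one_pos, hwle, hsq, hnb.eventually_ge_atTop 1] with n h1 h2 h3 h4
    have e1 : ∑ t ∈ Finset.Icc (1 : ℤ) n, |kernelWeight K b u n t|
        = ∑ t ∈ (Finset.Icc (1 : ℤ) n).filter (fun t => kernelWeight K b u n t ≠ 0),
          |kernelWeight K b u n t| := by
      rw [Finset.sum_filter_of_ne]
      intro t _ ht h0
      exact ht (by rw [h0]; simp)
    -- Modulo `L = 1` with `k = 1` the residue condition is void, so this counts every time with
    -- nonzero weight.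
    have h5 := h1 1
    simp only [Nat.cast_one, Int.emod_one, zero_lt_one, Finset.filter_true, div_one, min_self,
      mul_one] at h5
    rw [e1]
    refine (Finset.sum_le_card_nsmul _ _ _ fun t _ => h2 t).trans ?_
    rw [nsmul_eq_mul]
    have h6 : (n : ℝ) * b n + 2 ≤ 3 * (√((n : ℝ) * b n) * √((n : ℝ) * b n)) := by
      rw [Real.mul_self_sqrt (by linarith)]; linarith
    calc _ ≤ 3 * (√((n : ℝ) * b n) * √((n : ℝ) * b n)) * (B * (√((n : ℝ) * b n))⁻¹) :=
          mul_le_mul_of_nonneg_right (h5.trans h6) (by positivity)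
      _ = _ := by field_simp
  have hcorr0 : Tendsto (fun n : ℕ => ∑ t ∈ Finset.Icc (1 : ℤ) n, kernelWeight K b u n t ^ 2) atTop
      (𝓝 (∫ x, K x ^ 2)) := by
    have hlim : Tendsto (fun n : ℕ => ((n : ℝ) * b n)⁻¹ * (2 * (2 * B * V))) atTop (𝓝 0) := by
      simpa using hnb.inv_tendsto_atTop.mul_const (2 * (2 * B * V))
    rw [tendsto_iff_norm_sub_tendsto_zero]
    refine squeeze_zero' (.of_forall fun n => norm_nonneg _) ?_ hlim
    -- For `b < 2u` and `b < 2(1 - u)` the support of `K` lies in `(-u/b, (1-u)/b]`, the interval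
    -- swept by `(t/n - u)/b` for `t ≤ n`.
    filter_upwards [hbpos, hn0, hnb.eventually_gt_atTop 0, hsmall (2 * u) (by linarith [hu.1]),
      hsmall (2 * (1 - u)) (by linarith [hu.2])] with n h1 h2 h3 h4 h5
    have h6 : ∀ x y, x ≤ y → |K y ^ 2 - K x ^ 2| ≤ 2 * B * v y - 2 * B * v x := by
      intro x y hxy
      have e : K y ^ 2 - K x ^ 2 = (K y + K x) * (K y - K x) := by ring
      rw [e, abs_mul, ← mul_sub]
      refine mul_le_mul ?_ (hKv x y hxy) (abs_nonneg _) (by positivity)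
      linarith [abs_add_le (K y) (K x), hB y, hB x]
    have h7 := abs_riemann_sum_sub_integral_le (f := fun x => K x ^ 2) (v := fun x => 2 * B * v x)
      (fun x y hxy => mul_le_mul_of_nonneg_left (hv hxy) (by positivity)) (V := 2 * B * V)
      (fun x => by
        rw [abs_mul, abs_of_nonneg (by positivity : 0 ≤ 2 * B)]
        exact mul_le_mul_of_nonneg_left (hV x) (by positivity)) h6 (B := B ^ 2)
      (fun x => by
        rw [abs_pow]; exact pow_le_pow_left₀ (abs_nonneg _) (hB x) 2)
      (x₀ := -u / b n) (h := ((n : ℝ) * b n)⁻¹) (inv_nonneg.2 h3.le) (N := n) (by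
        intro x hx
        have h8 : K x ≠ 0 := fun h0 => hx (by simp [h0])
        have h9 := hK.support_subset h8
        have e : -u / b n + n * (n * b n)⁻¹ = (1 - u) / b n := by field_simp; ring
        rw [e]
        constructor
        · refine lt_of_lt_of_le ?_ h9.1
          rw [div_lt_iff₀ h1]; linarith
        · refine h9.2.trans ?_
          rw [le_div_iff₀ h1]; linarith)
    rw [Real.norm_eq_abs]
    convert h7 using 3
    rw [sum_Icc_one_int, Finset.mul_sum]
    refine Finset.sum_congr rfl fun i _ => ?_
    rw [kernelWeight, mul_pow, inv_pow, Real.sq_sqrt h3.le]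
    congr 3
    push_cast
    field_simp
    ring
  refine ⟨⟨fun n => B * (√((n : ℝ) * b n))⁻¹, ?_, hwle⟩, ?_, ?_, ?_, hres, ?_⟩
  · simpa using hsqrt_top.inv_tendsto_atTop.const_mul B
  · intro t₀
    have hnu : Tendsto (fun n : ℕ => (n : ℝ) * (u / 2)) atTop atTop :=
      tendsto_natCast_atTop_atTop.atTop_mul_const (by linarith [hu.1])
    -- With `b < u` nonzero weight forces `t ≥ n u / 2`, which eventually exceeds `t₀`; with `b <
    -- 2(1 - u)` it forces `t ≤ n`.
    filter_upwards [hbpos, hn0, hsmall u hu.1, hsmall (2 * (1 - u)) (by linarith [hu.2]),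
      hnu.eventually_ge_atTop (t₀ : ℝ)] with n h1 h2 h3 h4 h5 t ht
    have h6 := abs_le.1 (abs_sub_le_of_kernelWeight_ne_zero hK h1 ht)
    constructor
    · have h7 : u / 2 ≤ (t : ℝ) / n := by linarith [h6.1]
      rw [le_div_iff₀ h2] at h7
      have : (t₀ : ℝ) ≤ t := by linarith
      exact_mod_cast this
    · have h7 : (t : ℝ) / n ≤ 1 := by linarith [h6.2]
      rw [div_le_one h2] at h7
      exact_mod_cast h7
  · intro η hη
    filter_upwards [hbpos, hsmall η hη] with n h1 h2 t ht
    have := abs_sub_le_of_kernelWeight_ne_zero hK h1 ht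
    linarith
  · intro h
    have hlim : Tendsto (fun n : ℕ => ((n : ℝ) * b n)⁻¹ * (B * (2 * V * |(h : ℝ)|))) atTop (𝓝 0) := by
      simpa using hnb.inv_tendsto_atTop.mul_const (B * (2 * V * |(h : ℝ)|))
    have hdiff : Tendsto (fun n : ℕ => ∑ t ∈ Finset.Icc (1 : ℤ) n,
        (kernelWeight K b u n t * kernelWeight K b u n (t + h) - kernelWeight K b u n t ^ 2)) atTop
        (𝓝 0) := by
      refine squeeze_zero_norm' ?_ hlim
      filter_upwards [hbpos, hn0, hnb.eventually_gt_atTop 0] with n h1 h2 h3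
      -- Composing `v` with the increasing map `t ↦ (t/n - u)/b` gives a bounded monotone sequence,
      -- so the summed effect of a shift by `h` is bounded independently of `n`.
      set g : ℤ → ℝ := fun t => v (((t : ℝ) / n - u) / b n) with hg
      have hgm : Monotone g := by
        intro s t hst
        refine hv ?_
        have : (s : ℝ) ≤ t := by exact_mod_cast hst
        gcongr
      have hKg : ∀ s t : ℤ, |K (((s : ℝ) / n - u) / b n) - K (((t : ℝ) / n - u) / b n)|
          ≤ |g s - g t| := by
        intro s t
        rcases le_total s t with hst | hst
        · have : (s : ℝ) ≤ t := by exact_mod_cast hst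
          rw [abs_sub_comm, abs_sub_comm (g s)]
          exact (hKv _ _ (by gcongr)).trans (le_abs_self _)
        · have : (t : ℝ) ≤ s := by exact_mod_cast hst
          exact (hKv _ _ (by gcongr)).trans (le_abs_self _)
      rw [Real.norm_eq_abs]
      calc _ ≤ ∑ t ∈ Finset.Icc (1 : ℤ) n, |kernelWeight K b u n t * kernelWeight K b u n (t + h)
              - kernelWeight K b u n t ^ 2| := Finset.abs_sum_le_sum_abs _ _
        _ ≤ ∑ t ∈ Finset.Icc (1 : ℤ) n, ((n : ℝ) * b n)⁻¹ * (B * |g (t + h) - g t|) := by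
            refine Finset.sum_le_sum fun t _ => ?_
            have e : kernelWeight K b u n t * kernelWeight K b u n (t + h)
                - kernelWeight K b u n t ^ 2 = ((n : ℝ) * b n)⁻¹ * (K (((t : ℝ) / n - u) / b n) *
                  (K ((((t + h : ℤ) : ℝ) / n - u) / b n) - K (((t : ℝ) / n - u) / b n))) := by
              have : ((n : ℝ) * b n)⁻¹ = (√((n : ℝ) * b n))⁻¹ * (√((n : ℝ) * b n))⁻¹ := by
                rw [← mul_inv, Real.mul_self_sqrt h3.le]
              rw [this, kernelWeight, kernelWeight]
              ring
            rw [e, abs_mul, abs_of_pos (inv_pos.2 h3), abs_mul]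
            refine mul_le_mul_of_nonneg_left ?_ (inv_pos.2 h3).le
            exact mul_le_mul (hB _) (hKg _ _) (abs_nonneg _) hB0
        _ ≤ _ := by
            rw [← Finset.mul_sum, ← Finset.mul_sum]
            have := sum_abs_shift_sub_le hgm (V := V) (fun t => hV _) n h
            gcongr
    have := hdiff.add hcorr0
    simp only [zero_add, ← Finset.sum_add_distrib, sub_add_cancel] at this
    exact this
  · have hlim := hbα.const_mul (3 * B)
    rw [mul_zero] at hlim
    refine squeeze_zero' (.of_forall fun n => by positivity) ?_ hlim
    filter_upwards [hsumabs] with n h1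
    rw [← mul_assoc]
    exact mul_le_mul_of_nonneg_right h1 (by positivity)

end Weights

/-! ### Centering, norm bounds for weighted sums, and the limiting variance -/

section HilbertCenter

variable {E : Type*} [NormedAddCommGroup E] [InnerProductSpace ℝ E]

/-- The part of a vector at time `t` that is orthogonal to the range of `Pr (t + 1)`. -/
def center (Pr : ℤ → E →L[ℝ] E) (t : ℤ) : E →L[ℝ] E := ContinuousLinearMap.id ℝ E - Pr (t + 1)

/-- A vector recovered from its projections along the index going to `-∞`. -/
def Exhausted (Pr : ℤ → E →L[ℝ] E) (y : E) : Prop :=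
  ∀ t : ℤ, Tendsto (fun m : ℕ => Pr (t - m) y) atTop (𝓝 y)

variable {Pr : ℤ → E →L[ℝ] E}

lemma Exhausted.sub {x y : E} (hx : Exhausted Pr x) (hy : Exhausted Pr y) :
    Exhausted Pr (x - y) := fun t => by
  simpa only [map_sub] using (hx t).sub (hy t)

namespace DecreasingProjections

lemma exhausted_proj (h : DecreasingProjections Pr) (s : ℤ) (y : E) : Exhausted Pr (Pr s y) := by
  intro t
  refine tendsto_const_nhds.congr' ?_
  filter_upwards [eventually_ge_atTop (t - s).toNat] with m hm
  rw [h.comp, max_eq_right (by lia)]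

lemma exhausted_center (h : DecreasingProjections Pr) {y : E} (hy : Exhausted Pr y) (t : ℤ) :
    Exhausted Pr (center Pr t y) := hy.sub (h.exhausted_proj (t + 1) y)

lemma proj_center (h : DecreasingProjections Pr) (t : ℤ) (y : E) :
    Pr (t + 1) (center Pr t y) = 0 := by
  simp [center, h.comp]

lemma increment_center (h : DecreasingProjections Pr) (t : ℤ) (k : ℕ) (y : E) :
    increment Pr (t - k) (center Pr t y) = increment Pr (t - k) y := by
  simp only [center, sub_apply, ContinuousLinearMap.id_apply, map_sub]
  rw [h.increment_proj_of_lt (by lia), sub_zero]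

lemma center_proj (h : DecreasingProjections Pr) {s t : ℤ} (hst : s ≤ t + 1) (y : E) :
    center Pr t (Pr s y) = Pr s y - Pr (t + 1) y := by
  simp [center, h.comp, max_eq_left hst]

lemma norm_sum_smul_center_le (h : DecreasingProjections Pr) {T : Finset ℤ} {w : ℤ → ℝ}
    {y : ℤ → E} (hy : ∀ t ∈ T, Exhausted Pr (y t))
    {B : ℕ → ℝ} (hB0 : ∀ k, 0 ≤ B k) (hB : Summable B)
    (hle : ∀ k : ℕ, ∑ t ∈ T, w t ^ 2 * ‖increment Pr (t - k) (y t)‖ ^ 2 ≤ B k ^ 2) :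
    ‖∑ t ∈ T, w t • center Pr t (y t)‖ ≤ ∑' k, B k :=
  h.norm_sum_smul_le (fun t _ => h.proj_center t _)
    (fun t ht => h.exhausted_center (hy t ht) t (t + 1)) hB0 hB fun k => by
      simpa only [h.increment_center] using hle k

/-- The norm bound when the increments are bounded by `c k` uniformly in time. -/
lemma norm_sum_smul_center_le_of_forall (h : DecreasingProjections Pr) {T : Finset ℤ} {w : ℤ → ℝ}
    {y : ℤ → E} (hy : ∀ t ∈ T, Exhausted Pr (y t)) {C : ℝ} (hC : ∑ t ∈ T, w t ^ 2 ≤ C)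
    {c : ℕ → ℝ} (hc0 : ∀ k, 0 ≤ c k) (hc : Summable c)
    (hle : ∀ t ∈ T, w t ≠ 0 → ∀ k : ℕ, ‖increment Pr (t - k) (y t)‖ ≤ c k) :
    ‖∑ t ∈ T, w t • center Pr t (y t)‖ ≤ √C * ∑' k, c k := by
  have hC0 : 0 ≤ C := (Finset.sum_nonneg fun t _ => sq_nonneg (w t)).trans hC
  rw [← tsum_mul_left]
  refine h.norm_sum_smul_center_le hy (fun k => mul_nonneg (Real.sqrt_nonneg _) (hc0 k))
    (hc.mul_left _) fun k => ?_
  rw [mul_pow, Real.sq_sqrt hC0]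
  calc _ ≤ ∑ t ∈ T, w t ^ 2 * c k ^ 2 := by
        refine Finset.sum_le_sum fun t ht => ?_
        rcases eq_or_ne (w t) 0 with h0 | h0
        · simp [h0]
        · exact mul_le_mul_of_nonneg_left (pow_le_pow_left₀ (norm_nonneg _) (hle t ht h0 k) 2)
            (sq_nonneg _)
    _ ≤ _ := by
        rw [← Finset.sum_mul]
        exact mul_le_mul_of_nonneg_right hC (sq_nonneg _)

end DecreasingProjections

/-- Dominated convergence. Here `ρ` is an L² error uniform in time; it need not be summable over
lags, since `d` supplies the summability. -/
lemma tendsto_tsum_min_zero {d : ℕ → ℝ} (hd0 : ∀ k, 0 ≤ d k) (hd : Summable d) :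
    Tendsto (fun ρ : ℝ => ∑' k, min (d k) ρ) (𝓝[≥] 0) (𝓝 0) := by
  have h := tendsto_tsum_of_dominated_convergence (𝓕 := 𝓝[≥] (0 : ℝ))
    (f := fun ρ k => min (d k) ρ) (g := fun _ => (0 : ℝ)) hd (fun k => ?_) ?_
  · simpa using h
  · have h1 : Tendsto (fun ρ : ℝ => min (d k) ρ) (𝓝 0) (𝓝 (min (d k) 0)) :=
      (continuous_const.min continuous_id).tendsto 0
    rw [min_eq_right (hd0 k)] at h1
    exact h1.mono_left nhdsWithin_le_nhds
  · filter_upwards [self_mem_nhdsWithin] with ρ hρ k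
    rw [Real.norm_eq_abs, abs_of_nonneg (le_min (hd0 k) hρ)]
    exact min_le_left _ _

/-- Dominated convergence for the loss at block boundaries: a fixed lag `k` affects a vanishing
proportion of the times in a long block. -/
lemma tendsto_tsum_mul_sqrt_min_zero {d : ℕ → ℝ} (hd0 : ∀ k, 0 ≤ d k) (hd : Summable d) :
    Tendsto (fun L : ℕ => ∑' k : ℕ, d k * √(min 1 ((k : ℝ) / L))) atTop (𝓝 0) := by
  have h := tendsto_tsum_of_dominated_convergence (𝓕 := (atTop : Filter ℕ))
    (f := fun L k => d k * √(min 1 ((k : ℝ) / L))) (g := fun _ => (0 : ℝ)) hd (fun k => ?_) ?_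
  · simpa using h
  · have h1 : Tendsto (fun L : ℕ => (k : ℝ) / L) atTop (𝓝 0) :=
      tendsto_const_div_atTop_nhds_zero_nat _
    have h2 : Tendsto (fun L : ℕ => √(min 1 ((k : ℝ) / L))) atTop (𝓝 (√(min 1 0))) :=
      (Real.continuous_sqrt.tendsto _).comp ((tendsto_const_nhds (x := (1 : ℝ))).min h1)
    simpa using h2.const_mul (d k)
  · filter_upwards with L k
    rw [Real.norm_eq_abs, abs_of_nonneg (mul_nonneg (hd0 k) (Real.sqrt_nonneg _))]
    refine mul_le_of_le_one_right (hd0 k) ?_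
    exact Real.sqrt_le_one.2 (min_le_left _ _)

lemma LocalWeights.eventually_sum_sq_le {w : ℕ → ℤ → ℝ} {κ u α : ℝ} (hw : LocalWeights w κ u α) :
    ∀ᶠ n : ℕ in atTop, ∑ t ∈ Finset.Icc (1 : ℤ) n, w n t ^ 2 ≤ κ + 1 := by
  have h := (hw.corr 0).eventually_le_const (lt_add_one κ)
  filter_upwards [h] with n hn
  simpa only [add_zero, ← sq] using hn

/-- Limit of the squared norms of local sums of a stationary sequence of vectors. -/
lemma LocalWeights.tendsto_norm_sq_sum {w : ℕ → ℤ → ℝ} {κ u α : ℝ} (hw : LocalWeights w κ u α)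
    {x : ℤ → E} {γ : ℤ → ℝ} (hγ : Summable γ) (hx : ∀ s t, ⟪x s, x t⟫ = γ (t - s)) :
    Tendsto (fun n : ℕ => ‖∑ t ∈ Finset.Icc (1 : ℤ) n, w n t • x t‖ ^ 2) atTop
      (𝓝 (κ * ∑' h, γ h)) := by
  have hsupp : ∀ᶠ n : ℕ in atTop, ∀ t, w n t ≠ 0 → t ∈ Finset.Icc (1 : ℤ) n := by
    filter_upwards [hw.support 1] with n hn t ht
    exact Finset.mem_Icc.2 (hn t ht)
  have hlim := tendsto_tsum_of_dominated_convergence (𝓕 := (atTop : Filter ℕ))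
    (f := fun n h => (∑ t ∈ Finset.Icc (1 : ℤ) n, w n t * w n (t + h)) * γ h)
    (g := fun h => κ * γ h) (bound := fun h => (κ + 1) * ‖γ h‖) (hγ.norm.mul_left _)
    (fun h => (hw.corr h).mul_const _) ?_
  · rw [tsum_mul_left] at hlim
    refine hlim.congr' ?_
    filter_upwards [hsupp] with n hn
    have e : ∀ h, (∑ t ∈ Finset.Icc (1 : ℤ) n, w n t * w n (t + h)) * γ h
        = ∑ t ∈ Finset.Icc (1 : ℤ) n, w n t * w n (t + h) * γ h := fun h => Finset.sum_mul _ _ _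
    simp only [e]
    -- For fixed `s` only lags `h = t - s` with `t` an observation time contribute, so the sum over
    -- `h` becomes a finite sum over `t`.
    have hz : ∀ s h : ℤ, h ∉ (Finset.Icc (1 : ℤ) n).map (addRightEmbedding (-s)) →
        w n s * w n (s + h) * γ h = 0 := by
      intro s h hh
      have : w n (s + h) = 0 := by
        by_contra h0
        refine hh (Finset.mem_map.2 ⟨s + h, hn _ h0, ?_⟩)
        simp
      simp [this]
    rw [Summable.tsum_finsetSum fun s _ => summable_of_ne_finset_zero (hz s),
      ← real_inner_self_eq_norm_sq, sum_inner]
    refine Finset.sum_congr rfl fun s _ => ?_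
    rw [tsum_eq_sum fun h hh => hz s h hh, Finset.sum_map, inner_sum]
    refine Finset.sum_congr rfl fun t _ => ?_
    rw [real_inner_smul_left, real_inner_smul_right, hx]
    simp only [addRightEmbedding_apply]
    have e1 : s + (t + -s) = t := by ring
    rw [e1, ← sub_eq_add_neg]
    ring
  -- Domination uniform in `h`: the product of two weights is at most half the sum of their squares,
  -- and both sums of squares are at most `κ + 1`.
  · filter_upwards [hsupp, hw.eventually_sum_sq_le] with n hn hC h
    rw [norm_mul]
    refine mul_le_mul_of_nonneg_right ?_ (norm_nonneg _)
    rw [Real.norm_eq_abs]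
    have h1 : ∑ t ∈ Finset.Icc (1 : ℤ) n, w n (t + h) ^ 2 ≤ κ + 1 := by
      refine le_trans ?_ hC
      have : ∑ t ∈ Finset.Icc (1 : ℤ) n, w n (t + h) ^ 2
          = ∑ t ∈ (Finset.Icc (1 : ℤ) n).map (addRightEmbedding h), w n t ^ 2 := by
        rw [Finset.sum_map]; rfl
      rw [this]
      rw [← Finset.sum_filter_of_ne (p := fun t => w n t ≠ 0) fun t _ ht h0 => ht (by simp [h0])]
      exact Finset.sum_le_sum_of_subset_of_nonneg
        (fun t ht => hn t (Finset.mem_filter.1 ht).2) fun t _ _ => sq_nonneg _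
    calc _ ≤ ∑ t ∈ Finset.Icc (1 : ℤ) n, |w n t * w n (t + h)| := Finset.abs_sum_le_sum_abs _ _
      _ ≤ ∑ t ∈ Finset.Icc (1 : ℤ) n, (w n t ^ 2 + w n (t + h) ^ 2) / 2 := by
          refine Finset.sum_le_sum fun t _ => ?_
          rw [abs_mul, ← sq_abs (w n t), ← sq_abs (w n (t + h))]
          nlinarith [sq_nonneg (|w n t| - |w n (t + h)|)]
      _ ≤ κ + 1 := by
          rw [← Finset.sum_div, Finset.sum_add_distrib]
          linarith

end HilbertCenter

/-! ### Independent blocks -/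

section Block

variable {Ω : Type*} [m₀ : MeasurableSpace Ω] {P : Measure Ω}

lemma norm_sq_eq_integral (x : Lp ℝ 2 P) : ‖x‖ ^ 2 = ∫ ω, x ω ^ 2 ∂P := by
  rw [← real_inner_self_eq_norm_sq, L2.inner_def]
  refine integral_congr_ae (.of_forall fun ω => ?_)
  simp

lemma coeFn_sum_smul {ι : Type*} (T : Finset ι) (w : ι → ℝ) (x : ι → Lp ℝ 2 P) {g : ι → Ω → ℝ}
    (hg : ∀ t ∈ T, x t =ᵐ[P] g t) :
    (∑ t ∈ T, w t • x t : Lp ℝ 2 P) =ᵐ[P] fun ω => ∑ t ∈ T, w t * g t ω := by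
  classical
  induction T using Finset.induction_on with
  | empty =>
    simp only [Finset.sum_empty]
    exact Lp.coeFn_zero ℝ 2 P
  | insert t T ht ih =>
    rw [Finset.sum_insert ht]
    filter_upwards [Lp.coeFn_add (w t • x t) (∑ t ∈ T, w t • x t), Lp.coeFn_smul (w t) (x t),
      hg t (Finset.mem_insert_self t T), ih fun s hs => hg s (Finset.mem_insert_of_mem hs)]
      with ω h1 h2 h3 h4
    rw [h1, Pi.add_apply, h2, h4, Finset.sum_insert ht, Pi.smul_apply, h3, smul_eq_mul]

variable [IsProbabilityMeasure P] {ε ε' : ℤ → Ω → ℝ}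

lemma center_toLp_ae_eq (hε : Innovations P ε ε') {t : ℤ} {f : Ω → ℝ}
    (hf : Measurable[sigmaOf ε (Set.Iic t)] f) (hf2 : MemLp f 2 P) :
    (center (futureProj P hε.measurable) t (hf2.toLp f) : Ω → ℝ)
      =ᵐ[P] fun ω => f ω - ∫ ω', f ω' ∂P := by
  have e : center (futureProj P hε.measurable) t (hf2.toLp f)
      = hf2.toLp f - futureProj P hε.measurable (t + 1) (hf2.toLp f) := rfl
  rw [e]
  filter_upwards [Lp.coeFn_sub (hf2.toLp f) (futureProj P hε.measurable (t + 1) (hf2.toLp f)),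
    hf2.coeFn_toLp, futureProj_succ_ae_eq hε hf hf2] with ω h1 h2 h3
  rw [h1, Pi.sub_apply, h2, h3]

/-- This representative depends on the innovations in a finite window only, which is what makes
distinct blocks independent. -/
lemma center_proj_toLp_ae_eq (hε : Innovations P ε ε') {s t : ℤ} (hst : s ≤ t + 1) {f : Ω → ℝ}
    (hf : Measurable[sigmaOf ε (Set.Iic t)] f) (hf2 : MemLp f 2 P) :
    (center (futureProj P hε.measurable) t (futureProj P hε.measurable s (hf2.toLp f)) : Ω → ℝ)
      =ᵐ[P] fun ω => (P[f | sigmaOf ε (Set.Icc s t)]) ω - ∫ ω', f ω' ∂P := by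
  rw [(decreasingProjections_futureProj hε.measurable).center_proj hst]
  filter_upwards [Lp.coeFn_sub (futureProj P hε.measurable s (hf2.toLp f))
      (futureProj P hε.measurable (t + 1) (hf2.toLp f)),
    condProj_toLp_ae_eq (sigmaOf_le hε.measurable (Set.Ici s)) hf2,
    condExp_Ici_eq_Icc hε hst hf (hf2.integrable one_le_two),
    futureProj_succ_ae_eq hε hf hf2] with ω h1 h2 h3 h4
  rw [h1, Pi.sub_apply, h4, ← h3, ← h2]
  rfl

/-- Gaussian approximation of weighted sums of a bounded adapted process after projection onto
blocks of length `L`. -/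
lemma norm_charFun_block_sub_exp_le (hε : Innovations P ε ε') {W : ℤ → Ω → ℝ}
    (hW : ∀ t, Measurable[sigmaOf ε (Set.Iic t)] (W t)) {c : ℝ} (hc : ∀ t ω, |W t ω| ≤ c)
    (hW2 : ∀ t, MemLp (W t) 2 P) {L : ℕ} (hL : 0 < L) (T : Finset ℤ) {w : ℤ → ℝ} {e : ℝ}
    (hw : ∀ t, |w t| ≤ e) {s : ℝ} (hs : |s| * (L * (e * (2 * c))) ≤ 1) {S : Lp ℝ 2 P}
    (hS : S = ∑ t ∈ T, w t • center (futureProj P hε.measurable) t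
      (futureProj P hε.measurable (L * (t / L)) ((hW2 t).toLp (W t)))) :
    ‖charFun (P.map S) s - Real.exp (-(s ^ 2 / 2 * ‖S‖ ^ 2))‖
      ≤ |s| ^ 3 * (L * (e * (2 * c))) * ‖S‖ ^ 2 := by
  classical
  have hL' : (0 : ℤ) < L := by exact_mod_cast hL
  have he0 : 0 ≤ e := (abs_nonneg _).trans (hw 0)
  obtain ⟨ω₀⟩ : Nonempty Ω := nonempty_of_isProbabilityMeasure P
  have hc0 : 0 ≤ c := (abs_nonneg _).trans (hc 0 ω₀)
  have hle : ∀ t : ℤ, (L : ℤ) * (t / L) ≤ t := fun t => Int.mul_ediv_self_le hL'.ne'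
  let g : ℤ → Ω → ℝ := fun t ω =>
    (P[W t | sigmaOf ε (Set.Icc (L * (t / L)) t)]) ω - ∫ ω', W t ω' ∂P
  have hWint : ∀ t, Integrable (W t) P := fun t => (hW2 t).integrable one_le_two
  -- The window from `L (t / L)` to `t` stays inside the block of `t`.
  have hgblock : ∀ t, Measurable[sigmaOf ε {i | i / L = t / L}] (g t) := by
    intro t
    have h1 : Measurable[sigmaOf ε (Set.Icc (L * (t / L)) t)]
        (P[W t | sigmaOf ε (Set.Icc (L * (t / L)) t)]) := stronglyMeasurable_condExp.measurable
    refine (h1.sub_const _).mono (sigmaOf_mono fun i hi => ?_) le_rfl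
    simp only [Set.mem_Icc] at hi
    refine le_antisymm (Int.ediv_le_ediv hL' hi.2) ?_
    rw [Int.le_ediv_iff_mul_le hL', mul_comm]
    exact hi.1
  have hgm : ∀ t, Measurable (g t) := fun t => (hgblock t).mono (sigmaOf_le hε.measurable _) le_rfl
  have hgb : ∀ t, ∀ᵐ ω ∂P, |g t ω| ≤ 2 * c := by
    intro t
    have h1 := ae_bdd_abs_condExp_of_ae_bdd_abs (m := sigmaOf ε (Set.Icc (L * (t / L)) t)) (R := c)
      (f := W t) (μ := P) (.of_forall fun ω => hc t ω)
    have h2 : |∫ ω', W t ω' ∂P| ≤ c := by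
      have := norm_integral_le_of_norm_le_const (μ := P) (f := W t) (C := c)
        (.of_forall fun ω => hc t ω)
      simpa using this
    filter_upwards [h1] with ω hω
    refine (abs_sub _ _).trans ?_
    have : |(P[W t | sigmaOf ε (Set.Icc (L * (t / L)) t)]) ω| ≤ c := hω
    linarith
  have hg0 : ∀ t, ∫ ω, g t ω ∂P = 0 := by
    intro t
    rw [integral_sub integrable_condExp (integrable_const _),
      integral_condExp (sigmaOf_le hε.measurable _)]
    simp
  have hgi : ∀ t, Integrable (g t) P := fun t =>
    Integrable.of_bound (hgm t).aestronglyMeasurable (2 * c) (hgb t)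
  let U : ℤ → Ω → ℝ := fun j ω => ∑ t ∈ T.filter (fun t => t / L = j), w t * g t ω
  have hUblock : ∀ j, Measurable[sigmaOf ε {i | i / L = j}] (U j) := by
    intro j
    refine Finset.measurable_sum _ fun t ht => ?_
    have := hgblock t
    rw [(Finset.mem_filter.1 ht).2] at this
    exact this.const_mul _
  have hUm : ∀ j, AEMeasurable (U j) P := fun j =>
    ((hUblock j).mono (sigmaOf_le hε.measurable _) le_rfl).aemeasurable
  -- A block contains at most `L` times, and each summand is at most `e · 2c`, the factor 2 coming
  -- from centering.
  have hUb : ∀ j, ∀ᵐ ω ∂P, |U j ω| ≤ L * (e * (2 * c)) := by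
    intro j
    filter_upwards [ae_all_iff.2 hgb] with ω hω
    have hcard : (T.filter fun t => t / L = j).card ≤ L := by
      have hsub : (T.filter fun t => t / L = j) ⊆ Finset.Ico (L * j) (L * j + L) := by
        intro t ht
        have h1 := (Finset.mem_filter.1 ht).2
        rw [Finset.mem_Ico, ← h1]
        exact ⟨hle t, Int.lt_mul_ediv_self_add hL'⟩
      simpa using Finset.card_le_card hsub
    calc |U j ω| ≤ ∑ t ∈ T.filter (fun t => t / L = j), |w t * g t ω| :=
          Finset.abs_sum_le_sum_abs _ _
      _ ≤ (T.filter fun t => t / L = j).card • (e * (2 * c)) := by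
          refine Finset.sum_le_card_nsmul _ _ _ fun t _ => ?_
          rw [abs_mul]
          exact mul_le_mul (hw t) (hω t) (abs_nonneg _) he0
      _ ≤ L * (e * (2 * c)) := by
          rw [nsmul_eq_mul]
          refine mul_le_mul_of_nonneg_right (by exact_mod_cast hcard) (by positivity)
  have hU0 : ∀ j, ∫ ω, U j ω ∂P = 0 := by
    intro j
    rw [integral_finsetSum _ fun t _ => (hgi t).const_mul _]
    exact Finset.sum_eq_zero fun t _ => by rw [integral_const_mul, hg0, mul_zero]
  have hind : ∀ (I : Finset ℤ) (j : ℤ), j ∉ I → IndepFun (fun ω => ∑ i ∈ I, U i ω) (U j) P := by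
    intro I j hj
    have h1 : Measurable[sigmaOf ε {i | i / L ∈ I}] (fun ω => ∑ i ∈ I, U i ω) := by
      refine Finset.measurable_sum _ fun i hi => ?_
      refine (hUblock i).mono (sigmaOf_mono fun k hk => ?_) le_rfl
      have hk' : k / (L : ℤ) = i := hk
      change k / (L : ℤ) ∈ I
      rwa [hk']
    have h2 : Indep (sigmaOf ε {i | i / L ∈ I}) (sigmaOf ε {i | i / L = j}) P := by
      refine indep_sigmaOf hε ?_
      rw [Set.disjoint_left]
      intro k hk hk'
      have hk1 : k / (L : ℤ) ∈ I := hk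
      have hk2 : k / (L : ℤ) = j := hk'
      exact hj (hk2 ▸ hk1)
    exact indep_of_indep_of_le h2 h1.comap_le (hUblock j).comap_le
  have hSae : (S : Ω → ℝ) =ᵐ[P] fun ω => ∑ j ∈ T.image (fun t => t / (L : ℤ)), U j ω := by
    rw [hS]
    refine (coeFn_sum_smul T w _ (g := g) fun t _ =>
      center_proj_toLp_ae_eq hε ((hle t).trans (by lia)) (hW t) (hW2 t)).trans ?_
    refine .of_forall fun ω => ?_
    exact (Finset.sum_fiberwise_of_maps_to (fun t ht => Finset.mem_image_of_mem _ ht) _).symm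
  have hmain := norm_charFun_sum_sub_exp_le (T.image fun t => t / (L : ℤ)) hUm hUb hU0 hs hind
  have hn : ‖S‖ ^ 2 = ∫ ω, (∑ j ∈ T.image (fun t => t / (L : ℤ)), U j ω) ^ 2 ∂P := by
    rw [norm_sq_eq_integral]
    exact integral_congr_ae (hSae.mono fun ω hω => by simp only [hω])
  rw [hn, Measure.map_congr hSae]
  exact hmain

end Block

/-! ### Truncation -/

section Truncation

/-- Truncation of a real number at the levels `-c` and `c`. -/
def trunc (c x : ℝ) : ℝ := max (-c) (min c x)

lemma measurable_trunc (c : ℝ) : Measurable (trunc c) := by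
  unfold trunc; fun_prop

lemma abs_trunc_le {c : ℝ} (hc : 0 ≤ c) (x : ℝ) : |trunc c x| ≤ c :=
  abs_le.2 ⟨le_max_left _ _, max_le (by linarith) (min_le_left _ _)⟩

lemma abs_trunc_sub_trunc_le (c x y : ℝ) : |trunc c x - trunc c y| ≤ |x - y| := by
  refine (abs_max_sub_max_le_max _ _ _ _).trans ?_
  rw [sub_self, abs_zero]
  refine max_le (abs_nonneg _) ((abs_min_sub_min_le_max _ _ _ _).trans ?_)
  rw [sub_self, abs_zero]
  exact max_le (abs_nonneg _) le_rfl

lemma trunc_of_abs_le {c x : ℝ} (hx : |x| ≤ c) : trunc c x = x := by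
  rw [abs_le] at hx
  rw [trunc, min_eq_right hx.2, max_eq_right hx.1]

lemma abs_sub_trunc_le {c : ℝ} (hc : 0 ≤ c) (x : ℝ) : |x - trunc c x| ≤ 2 * |x| := by
  have h := abs_trunc_sub_trunc_le c x 0
  rw [trunc_of_abs_le (x := 0) (by simpa using hc), sub_zero, sub_zero] at h
  linarith [abs_sub x (trunc c x)]

variable {Ω : Type*} [MeasurableSpace Ω] {P : Measure Ω}

/-- Dominated convergence for the squares with majorant `(2Y)²`; pointwise the error vanishes once
`c ≥ |Y|`. -/
lemma tendsto_eLpNorm_sub_trunc {Y : Ω → ℝ} (hY : MemLp Y 2 P) :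
    Tendsto (fun c : ℕ => eLpNorm (fun ω => Y ω - trunc c (Y ω)) 2 P) atTop (𝓝 0) := by
  have hm : ∀ c : ℕ, AEStronglyMeasurable (fun ω => Y ω - trunc c (Y ω)) P := fun c =>
    hY.aestronglyMeasurable.sub
      ((measurable_trunc c).comp_aemeasurable hY.aestronglyMeasurable.aemeasurable).aestronglyMeasurable
  have hmem : ∀ c : ℕ, MemLp (fun ω => Y ω - trunc c (Y ω)) 2 P := fun c =>
    (hY.const_mul 2).mono (hm c) (.of_forall fun ω => by
      simpa using abs_sub_trunc_le (Nat.cast_nonneg c) (Y ω))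
  have h1 : Tendsto (fun c : ℕ => ∫ ω, (Y ω - trunc c (Y ω)) ^ 2 ∂P) atTop (𝓝 0) := by
    have := tendsto_integral_of_dominated_convergence (μ := P)
      (F := fun (c : ℕ) ω => (Y ω - trunc c (Y ω)) ^ 2) (f := fun _ => (0 : ℝ))
      (fun ω => (2 * Y ω) ^ 2) (fun c => (hm c).pow 2) (hY.const_mul 2).integrable_sq
      (fun c => .of_forall fun ω => ?_) (.of_forall fun ω => ?_)
    · simpa using this
    · rw [Real.norm_eq_abs, abs_pow, ← sq_abs (2 * Y ω), abs_mul, abs_two]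
      exact pow_le_pow_left₀ (abs_nonneg _) (abs_sub_trunc_le (Nat.cast_nonneg c) _) 2
    · refine tendsto_const_nhds.congr' ?_
      filter_upwards [eventually_ge_atTop ⌈|Y ω|⌉₊] with c hc
      rw [trunc_of_abs_le ((Nat.le_ceil _).trans (by exact_mod_cast hc))]
      simp
  have h2 : ∀ c : ℕ, eLpNorm (fun ω => Y ω - trunc c (Y ω)) 2 P
      = ENNReal.ofReal (√(∫ ω, (Y ω - trunc c (Y ω)) ^ 2 ∂P)) := by
    intro c
    rw [(hmem c).eLpNorm_eq_integral_rpow_norm two_ne_zero ENNReal.ofNat_ne_top, Real.sqrt_eq_rpow]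
    simp
  simp only [h2]
  have h3 := (Real.continuous_sqrt.tendsto 0).comp h1
  rw [Real.sqrt_zero] at h3
  simpa using ENNReal.tendsto_ofReal h3

end Truncation

lemma abs_exp_neg_sub_exp_neg_le {a b : ℝ} (ha : 0 ≤ a) (hb : 0 ≤ b) :
    |Real.exp (-a) - Real.exp (-b)| ≤ |a - b| := by
  wlog hab : a ≤ b generalizing a b
  · rw [abs_sub_comm, abs_sub_comm a b]
    exact this hb ha (le_of_not_ge hab)
  rw [abs_of_nonneg (sub_nonneg.2 (Real.exp_le_exp.2 (by linarith))), abs_sub_comm,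
    abs_of_nonneg (sub_nonneg.2 hab)]
  have h1 : Real.exp (-b) = Real.exp (-a) * Real.exp (-(b - a)) := by
    rw [← Real.exp_add]; congr 1; ring
  have h2 := Real.add_one_le_exp (-(b - a))
  have h3 : Real.exp (-a) ≤ 1 := Real.exp_le_one_iff.2 (by linarith)
  rw [h1]
  nlinarith [Real.exp_pos (-a), Real.exp_pos (-(b - a))]

/-! ### L² approximation by truncated, block-measurable processes -/

section Approximation

variable {Ω : Type*} [MeasurableSpace Ω] {P : Measure Ω} {ε ε' : ℤ → Ω → ℝ}

lemma measurable_past_of_measurable (hε : ∀ t, Measurable (ε t)) (t : ℤ) :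
    Measurable (past ε t) :=
  (measurable_past t).mono (sigmaOf_le hε _) le_rfl

lemma measurable_coupledPast_of_measurable (hε : Innovations P ε ε') (t a : ℤ) :
    Measurable (coupledPast ε ε' t a) :=
  (measurable_coupledPast t a).mono (sup_le (sigmaOf_le hε.measurable _)
    (sup_le (sigmaOf_le hε.measurable _) (hε.measurable_copy a).comap_le)) le_rfl

/-- A functional of the past with functional dependence measure bounded by `d` in `L²`. -/
structure Dependence (P : Measure Ω) (ε ε' : ℤ → Ω → ℝ) (H : (ℕ → ℝ) → ℝ) (d : ℕ → ℝ) : Prop where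
  measurable : Measurable H
  memLp : ∀ t, MemLp (fun ω => H (past ε t ω)) 2 P
  nonneg : ∀ k, 0 ≤ d k
  coupled : ∀ (t : ℤ) (k : ℕ),
    eLpNorm (fun ω => H (past ε t ω) - H (coupledPast ε ε' t (t - k) ω)) 2 P ≤ ENNReal.ofReal (d k)

namespace Dependence

variable {H : (ℕ → ℝ) → ℝ} {d : ℕ → ℝ}

lemma adapted (hH : Dependence P ε ε' H d) (t : ℤ) :
    Measurable[sigmaOf ε (Set.Iic t)] (fun ω => H (past ε t ω)) :=
  hH.measurable.comp (measurable_past t)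

/-- The process at time `t` as an element of `L²`. -/
def vec (hH : Dependence P ε ε' H d) (t : ℤ) : Lp ℝ 2 P := (hH.memLp t).toLp _

lemma norm_vec_sub_vec {H' : (ℕ → ℝ) → ℝ} {d' : ℕ → ℝ} (hH : Dependence P ε ε' H d)
    (hH' : Dependence P ε ε' H' d') (t : ℤ) : ‖hH.vec t - hH'.vec t‖
      = (eLpNorm (fun ω => H (past ε t ω) - H' (past ε t ω)) 2 P).toReal := by
  rw [vec, vec, ← MemLp.toLp_sub, Lp.norm_toLp]
  rfl

variable [IsProbabilityMeasure P]

lemma exhausted_vec (hH : Dependence P ε ε' H d) (hε : Innovations P ε ε') (t : ℤ) :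
    Exhausted (futureProj P hε.measurable) (hH.vec t) :=
  tendsto_futureProj hε.measurable (hH.adapted t) (hH.memLp t)

lemma norm_increment_le (hH : Dependence P ε ε' H d) (hε : Innovations P ε ε') (t : ℤ) (k : ℕ) :
    ‖increment (futureProj P hε.measurable) (t - k) (hH.vec t)‖ ≤ d k := by
  have hmem : MemLp (fun ω => H (past ε t ω) - H (coupledPast ε ε' t (t - k) ω)) 2 P := by
    refine ⟨Measurable.aestronglyMeasurable ?_, (hH.coupled t k).trans_lt ENNReal.ofReal_lt_top⟩
    exact (hH.measurable.comp (measurable_past_of_measurable hε.measurable t)).sub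
      (hH.measurable.comp (measurable_coupledPast_of_measurable hε t _))
  refine (norm_increment_le_of_coupled hε hH.measurable (hH.memLp t) hmem).trans ?_
  exact ENNReal.toReal_le_of_le_ofReal (hH.nonneg k) (hH.coupled t k)

/-- Truncation is 1-Lipschitz, so `d` is unchanged. The block length can therefore be chosen
regardless of the truncation level. -/
lemma truncate (hH : Dependence P ε ε' H d) (hε : Innovations P ε ε') {c : ℝ} (hc : 0 ≤ c) :
    Dependence P ε ε' (fun x => trunc c (H x)) d where
  measurable := (measurable_trunc c).comp hH.measurable
  memLp t := MemLp.of_bound (((measurable_trunc c).comp hH.measurable).comp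
    (measurable_past_of_measurable hε.measurable t)).aestronglyMeasurable c
    (.of_forall fun _ => abs_trunc_le hc _)
  nonneg := hH.nonneg
  coupled t k := (eLpNorm_mono fun ω => by
    simpa using abs_trunc_sub_trunc_le c (H (past ε t ω)) (H (coupledPast ε ε' t (t - k) ω))).trans
    (hH.coupled t k)

lemma inner_center_vec (hH : Dependence P ε ε' H d) (hε : Innovations P ε ε') (s t : ℤ) :
    ⟪center (futureProj P hε.measurable) s (hH.vec s),
      center (futureProj P hε.measurable) t (hH.vec t)⟫
      = cov[fun ω => H (past ε s ω), fun ω => H (past ε t ω); P] := by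
  rw [L2.inner_def, covariance]
  refine integral_congr_ae ?_
  filter_upwards [center_toLp_ae_eq hε (hH.adapted s) (hH.memLp s),
    center_toLp_ae_eq hε (hH.adapted t) (hH.memLp t)] with ω h1 h2
  rw [vec, vec, h1, h2]
  simp [mul_comm]

lemma summable_cov (hH : Dependence P ε ε' H d) (hε : Innovations P ε ε') (hd : Summable d) :
    Summable fun t => cov[fun ω => H (past ε 0 ω), fun ω => H (past ε t ω); P] := by
  have hD := decreasingProjections_futureProj (P := P) hε.measurable
  simp only [← hH.inner_center_vec hε]
  refine hD.summable_inner hd (fun t => hD.proj_center t _)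
    (fun t => hD.exhausted_center (hH.exhausted_vec hε t) t (t + 1)) fun t k => ?_
  rw [hD.increment_center]
  exact hH.norm_increment_le hε t k

variable {w : ℕ → ℤ → ℝ} {κ u α : ℝ}

/-- Truncation has a small effect on local sums. -/
lemma exists_truncate_norm_le (hH : Dependence P ε ε' H d) (hε : Innovations P ε ε')
    (hd : Summable d)
    (hident : ∀ t, IdentDistrib (fun ω => H (past ε t ω)) (fun ω => H (past ε 0 ω)) P P)
    (hw : LocalWeights w κ u α) {η : ℝ} (hη : 0 < η) :
    ∃ (c : ℝ) (hc : 0 ≤ c), ∀ᶠ n : ℕ in atTop, ‖∑ t ∈ Finset.Icc (1 : ℤ) n,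
      w n t • center (futureProj P hε.measurable) t (hH.vec t - (hH.truncate hε hc).vec t)‖ ≤ η := by
  have hD := decreasingProjections_futureProj (P := P) hε.measurable
  have hd2 : Summable fun k => 2 * d k := hd.mul_left 2
  have hd20 : ∀ k, 0 ≤ 2 * d k := fun k => mul_nonneg two_pos.le (hH.nonneg k)
  have h1 := (tendsto_tsum_min_zero hd20 hd2).const_mul √(κ + 1)
  rw [mul_zero] at h1
  have h2 : Tendsto (fun c : ℕ =>
      (eLpNorm (fun ω => H (past ε 0 ω) - trunc c (H (past ε 0 ω))) 2 P).toReal) atTop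
      (𝓝[≥] 0) := by
    refine tendsto_nhdsWithin_iff.2 ⟨?_, .of_forall fun c => ENNReal.toReal_nonneg⟩
    exact (ENNReal.tendsto_toReal ENNReal.zero_ne_top).comp
      (tendsto_eLpNorm_sub_trunc (hH.memLp 0))
  obtain ⟨c, hc⟩ := ((h1.comp h2).eventually_le_const hη).exists
  refine ⟨c, Nat.cast_nonneg c, ?_⟩
  filter_upwards [hw.eventually_sum_sq_le] with n hn
  set ρ := (eLpNorm (fun ω => H (past ε 0 ω) - trunc c (H (past ε 0 ω))) 2 P).toReal with hρ
  have hρ0 : 0 ≤ ρ := ENNReal.toReal_nonneg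
  have hc' : √(κ + 1) * ∑' k, min (2 * d k) ρ ≤ η := hc
  refine (hD.norm_sum_smul_center_le_of_forall (c := fun k => min (2 * d k) ρ)
    (fun t _ => (hH.exhausted_vec hε t).sub ((hH.truncate hε (Nat.cast_nonneg c)).exhausted_vec hε t)) hn
    (fun k => le_min (hd20 k) hρ0)
    (Summable.of_nonneg_of_le (fun k => le_min (hd20 k) hρ0) (fun k => min_le_left _ _) hd2)
    fun t _ _ k => le_min ?_ ?_).trans hc'
  · rw [map_sub]
    refine (norm_sub_le _ _).trans ?_
    have := hH.norm_increment_le hε t k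
    have := (hH.truncate hε (Nat.cast_nonneg c)).norm_increment_le hε t k
    linarith
  -- An increment is a contraction, and the truncation error has the same norm `ρ` at every time
  -- because the marginals agree.
  · refine (hD.norm_increment_le _ _).trans_eq ?_
    rw [norm_vec_sub_vec, hρ]
    congr 1
    exact ((hident t).comp (u := fun x => x - trunc c x)
      (measurable_id.sub (measurable_trunc c))).eLpNorm_eq 2

/-- Projection onto long blocks has a small effect on local sums. -/
lemma exists_block_norm_le (hε : Innovations P ε ε') (hd : Summable d) (hw : LocalWeights w κ u α)
    (hd0 : ∀ k, 0 ≤ d k) {η : ℝ} (hη : 0 < η) :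
    ∃ L : ℕ, 0 < L ∧ ∀ᶠ n : ℕ in atTop, ∀ (H : (ℕ → ℝ) → ℝ) (hH : Dependence P ε ε' H d),
      ‖∑ t ∈ Finset.Icc (1 : ℤ) n, w n t • center (futureProj P hε.measurable) t
        (hH.vec t - futureProj P hε.measurable (L * (t / L)) (hH.vec t))‖ ≤ η := by
  have hD := decreasingProjections_futureProj (P := P) hε.measurable
  obtain ⟨C, hC0, hC⟩ := hw.residue
  have h1 := (tendsto_tsum_mul_sqrt_min_zero hd0 hd).const_mul √C
  rw [mul_zero] at h1
  -- `L` is chosen from `d` and the weights alone, uniformly over the processes with dependence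
  -- bounded by `d`.
  obtain ⟨L, hL, hL0⟩ := ((h1.eventually_le_const hη).and (eventually_gt_atTop 0)).exists
  have hL' : (0 : ℤ) < L := by exact_mod_cast hL0
  refine ⟨L, hL0, ?_⟩
  filter_upwards [hC L hL0] with n hn H hH
  refine le_trans ?_ hL
  rw [← tsum_mul_left]
  have hB0 : ∀ k : ℕ, 0 ≤ √C * (d k * √(min 1 ((k : ℝ) / L))) := fun k =>
    mul_nonneg (Real.sqrt_nonneg _) (mul_nonneg (hd0 k) (Real.sqrt_nonneg _))
  refine hD.norm_sum_smul_center_le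
    (fun t _ => (hH.exhausted_vec hε t).sub (hD.exhausted_proj _ _)) hB0 ?_ fun k => ?_
  · refine Summable.of_nonneg_of_le hB0 (fun k => ?_) (hd.mul_left √C)
    refine mul_le_mul_of_nonneg_left (mul_le_of_le_one_right (hd0 k) ?_) (Real.sqrt_nonneg _)
    exact Real.sqrt_le_one.2 (min_le_left _ _)
  · have hmin : 0 ≤ min 1 ((k : ℝ) / L) := le_min zero_le_one (by positivity)
    rw [mul_pow, mul_pow, Real.sq_sqrt hC0, Real.sq_sqrt hmin]
    -- The block projection keeps the increment at index `t - k` when `t - k ≥ L (t / L)`. The error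
    -- thus has a lag-`k` increment only if `t % L < k`.
    calc _ ≤ ∑ t ∈ Finset.Icc (1 : ℤ) n, if t % L < k then w n t ^ 2 * d k ^ 2 else 0 := by
          refine Finset.sum_le_sum fun t _ => ?_
          have hdiv := Int.mul_ediv_add_emod t L
          split_ifs with h
          · refine mul_le_mul_of_nonneg_left ?_ (sq_nonneg _)
            rw [map_sub, hD.increment_proj_of_lt (by lia), sub_zero]
            exact pow_le_pow_left₀ (norm_nonneg _) (hH.norm_increment_le hε t k) 2
          · rw [map_sub, hD.increment_proj_of_le (by lia), sub_self]
            simp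
      _ = (∑ t ∈ (Finset.Icc (1 : ℤ) n).filter (fun t : ℤ => t % L < k), w n t ^ 2) * d k ^ 2 := by
          rw [← Finset.sum_filter, Finset.sum_mul]
      _ ≤ C * min 1 ((k : ℝ) / L) * d k ^ 2 := mul_le_mul_of_nonneg_right (hn k) (sq_nonneg _)
      _ = _ := by ring

end Dependence

end Approximation

/-! ### Central limit theorem for a stationary process -/

section StationaryCLT

variable {Ω : Type*} [MeasurableSpace Ω] {P : Measure Ω} [IsProbabilityMeasure P]
  {ε ε' : ℤ → Ω → ℝ}

lemma norm_charFun_map_coe_sub_le (S T : Lp ℝ 2 P) (s : ℝ) :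
    ‖charFun (P.map S) s - charFun (P.map T) s‖ ≤ |s| * ‖S - T‖ := by
  have := norm_charFun_map_sub_le (Lp.memLp S) (Lp.memLp T) s
  rwa [Lp.toLp_coeFn, Lp.toLp_coeFn] at this

namespace Dependence

variable {H : (ℕ → ℝ) → ℝ} {d : ℕ → ℝ} {w : ℕ → ℤ → ℝ} {κ u α : ℝ}

/-- The centered local sum of the process as an element of `L²`. -/
def centeredSum (hH : Dependence P ε ε' H d) (hε : Innovations P ε ε') (w : ℕ → ℤ → ℝ) (n : ℕ) :
    Lp ℝ 2 P :=
  ∑ t ∈ Finset.Icc (1 : ℤ) n, w n t • center (futureProj P hε.measurable) t (hH.vec t)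

lemma tendsto_norm_sq_centeredSum (hH : Dependence P ε ε' H d) (hε : Innovations P ε ε')
    (hd : Summable d) (hw : LocalWeights w κ u α) {γ : ℤ → ℝ}
    (hγ : ∀ s t, cov[fun ω => H (past ε s ω), fun ω => H (past ε t ω); P] = γ (t - s)) :
    Tendsto (fun n => ‖hH.centeredSum hε w n‖ ^ 2) atTop (𝓝 (κ * ∑' h, γ h)) := by
  refine hw.tendsto_norm_sq_sum ?_ fun s t => (hH.inner_center_vec hε s t).trans (hγ s t)
  refine (hH.summable_cov hε hd).congr fun t => ?_
  rw [hγ, sub_zero]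

/-- Central limit theorem for local sums of a stationary functional of the past, in terms of
characteristic functions. -/
lemma tendsto_charFun_centeredSum (hH : Dependence P ε ε' H d) (hε : Innovations P ε ε')
    (hd : Summable d) (hw : LocalWeights w κ u α)
    (hident : ∀ t, IdentDistrib (fun ω => H (past ε t ω)) (fun ω => H (past ε 0 ω)) P P) {v : ℝ}
    (hv : Tendsto (fun n => ‖hH.centeredSum hε w n‖ ^ 2) atTop (𝓝 v)) (s : ℝ) :
    Tendsto (fun n => charFun (P.map (hH.centeredSum hε w n)) s) atTop
      (𝓝 (Real.exp (-(s ^ 2 / 2 * v)) : ℝ)) := by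
  have hv0 : 0 ≤ v := ge_of_tendsto' hv fun n => sq_nonneg _
  set C : ℝ := √(v + 1) with hC
  have hC0 : 0 ≤ C := Real.sqrt_nonneg _
  -- `M` collects the coefficients of `θ`: `|s|` from the characteristic functions and `s²/2 · (2C +
  -- 1)` from the Gaussian factors, with 1 added for positivity. The errors total at most `3η/4`:
  -- one quarter for the `θ` terms, one for the block theorem, one for the variance.
  set M : ℝ := |s| + s ^ 2 / 2 * (2 * C + 1) + 1 with hM
  have hM0 : 0 < M := by positivity
  rw [Metric.tendsto_nhds]
  intro η hη
  set θ : ℝ := min 1 (η / (4 * M)) with hθ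
  have hθ0 : 0 < θ := lt_min one_pos (by positivity)
  have hθ1 : θ ≤ 1 := min_le_left _ _
  have hθM : M * θ ≤ η / 4 := by
    calc M * θ ≤ M * (η / (4 * M)) := mul_le_mul_of_nonneg_left (min_le_right _ _) hM0.le
      _ = η / 4 := by field_simp
  obtain ⟨c, hc, htr⟩ := hH.exists_truncate_norm_le hε hd hident hw (half_pos hθ0)
  obtain ⟨L, hL, hbl⟩ := exists_block_norm_le (P := P) hε hd hw hH.nonneg (half_pos hθ0)
  obtain ⟨e, he, hwe⟩ := hw.sup_tendsto
  set hT := hH.truncate hε hc with hTdef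
  have hlim1 : Tendsto (fun n => |s| * (L * (e n * (2 * c)))) atTop (𝓝 0) := by
    simpa using ((he.mul_const (2 * c)).const_mul (L : ℝ)).const_mul |s|
  have hlim2 : Tendsto (fun n => |s| ^ 3 * (L * (e n * (2 * c))) * (C + 1) ^ 2) atTop (𝓝 0) := by
    simpa using (((he.mul_const (2 * c)).const_mul (L : ℝ)).const_mul (|s| ^ 3)).mul_const
      ((C + 1) ^ 2)
  have hlim3 : Tendsto (fun n => s ^ 2 / 2 * |‖hH.centeredSum hε w n‖ ^ 2 - v|) atTop (𝓝 0) := by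
    simpa using ((hv.sub_const v).abs).const_mul (s ^ 2 / 2)
  filter_upwards [htr, hbl, hwe, hlim1.eventually_le_const one_pos,
    hlim2.eventually_le_const (by positivity : 0 < η / 4),
    hlim3.eventually_le_const (by positivity : 0 < η / 4),
    hv.eventually_le_const (lt_add_one v)] with n h1 h2 h3 h4 h5 h6 h7
  set S := hH.centeredSum hε w n with hS
  -- `S'` is truncated and blocked. The level `c` and length `L` are fixed before `n` grows, so the
  -- bound on its blocks tends to zero.
  set S' : Lp ℝ 2 P := ∑ t ∈ Finset.Icc (1 : ℤ) n, w n t • center (futureProj P hε.measurable) t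
    (futureProj P hε.measurable (L * (t / L)) (hT.vec t)) with hS'
  have hSS' : ‖S - S'‖ ≤ θ := by
    have h8 := h2 _ hT
    have e1 : S - S' = ∑ t ∈ Finset.Icc (1 : ℤ) n,
          w n t • center (futureProj P hε.measurable) t (hH.vec t - hT.vec t)
        + ∑ t ∈ Finset.Icc (1 : ℤ) n, w n t • center (futureProj P hε.measurable) t
          (hT.vec t - futureProj P hε.measurable (L * (t / L)) (hT.vec t)) := by
      rw [hS, centeredSum, hS', ← Finset.sum_sub_distrib, ← Finset.sum_add_distrib]
      refine Finset.sum_congr rfl fun t _ => ?_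
      simp only [map_sub, smul_sub]
      abel
    rw [e1]
    refine (norm_add_le _ _).trans ?_
    linarith
  have hSC : ‖S‖ ≤ C := by
    rw [hC]
    exact Real.le_sqrt_of_sq_le h7
  have hSC' : ‖S'‖ ≤ C + 1 := by
    have := norm_sub_norm_le S' S
    rw [norm_sub_rev] at this
    linarith
  have hA : ‖charFun (P.map S) s - charFun (P.map S') s‖ ≤ |s| * θ :=
    (norm_charFun_map_coe_sub_le S S' s).trans (mul_le_mul_of_nonneg_left hSS' (abs_nonneg s))
  have hB : ‖charFun (P.map S') s - Real.exp (-(s ^ 2 / 2 * ‖S'‖ ^ 2))‖ ≤ η / 4 := by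
    refine (norm_charFun_block_sub_exp_le hε (W := fun t ω => trunc c (H (past ε t ω)))
      hT.adapted (fun t ω => abs_trunc_le hc _) hT.memLp hL (Finset.Icc (1 : ℤ) n)
      (w := w n) h3 h4 hS').trans (le_trans ?_ h5)
    have he0 : 0 ≤ e n := (abs_nonneg _).trans (h3 0)
    gcongr
  have hE : ‖((Real.exp (-(s ^ 2 / 2 * ‖S'‖ ^ 2)) : ℝ) : ℂ)
      - (Real.exp (-(s ^ 2 / 2 * ‖S‖ ^ 2)) : ℝ)‖ ≤ s ^ 2 / 2 * (2 * C + 1) * θ := by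
    rw [← Complex.ofReal_sub, Complex.norm_real, Real.norm_eq_abs]
    refine (abs_exp_neg_sub_exp_neg_le (by positivity) (by positivity)).trans ?_
    rw [← mul_sub, abs_mul, abs_of_nonneg (by positivity : 0 ≤ s ^ 2 / 2), mul_assoc]
    refine mul_le_mul_of_nonneg_left ?_ (by positivity)
    have e2 : ‖S'‖ ^ 2 - ‖S‖ ^ 2 = (‖S'‖ + ‖S‖) * (‖S'‖ - ‖S‖) := by ring
    rw [e2, abs_mul, abs_of_nonneg (by positivity)]
    refine mul_le_mul (by linarith) ?_ (abs_nonneg _) (by positivity)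
    refine (abs_norm_sub_norm_le S' S).trans ?_
    rwa [norm_sub_rev]
  have hF : ‖((Real.exp (-(s ^ 2 / 2 * ‖S‖ ^ 2)) : ℝ) : ℂ)
      - (Real.exp (-(s ^ 2 / 2 * v)) : ℝ)‖ ≤ η / 4 := by
    rw [← Complex.ofReal_sub, Complex.norm_real, Real.norm_eq_abs]
    refine (abs_exp_neg_sub_exp_neg_le (by positivity) (by positivity)).trans ?_
    rwa [← mul_sub, abs_mul, abs_of_nonneg (by positivity : 0 ≤ s ^ 2 / 2)]
  rw [dist_eq_norm]
  have htri := (norm_sub_le_norm_sub_add_norm_sub (charFun (P.map S) s) (charFun (P.map S') s)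
    ((Real.exp (-(s ^ 2 / 2 * v)) : ℝ) : ℂ))
  have htri2 := (norm_sub_le_norm_sub_add_norm_sub (charFun (P.map S') s)
    ((Real.exp (-(s ^ 2 / 2 * ‖S'‖ ^ 2)) : ℝ) : ℂ) ((Real.exp (-(s ^ 2 / 2 * v)) : ℝ) : ℂ))
  have htri3 := (norm_sub_le_norm_sub_add_norm_sub
    ((Real.exp (-(s ^ 2 / 2 * ‖S'‖ ^ 2)) : ℝ) : ℂ)
    ((Real.exp (-(s ^ 2 / 2 * ‖S‖ ^ 2)) : ℝ) : ℂ) ((Real.exp (-(s ^ 2 / 2 * v)) : ℝ) : ℂ))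
  have hsum : |s| * θ + s ^ 2 / 2 * (2 * C + 1) * θ ≤ M * θ := by
    rw [hM]; nlinarith
  linarith

end Dependence

end StationaryCLT

/-! ### Reduction from the array to the stationary process at `u` -/

section LocalStationary

variable {Ω : Type*} [MeasurableSpace Ω] {P : Measure Ω} [IsProbabilityMeasure P]
  {ε ε' : ℤ → Ω → ℝ}

lemma eLpNorm_sub_integral_le {f : Ω → ℝ} (hf : MemLp f 2 P) :
    eLpNorm (fun ω => f ω - ∫ ω', f ω' ∂P) 2 P ≤ 2 * eLpNorm f 2 P := by
  have h1 : eLpNorm (fun _ : Ω => ∫ ω', f ω' ∂P) 2 P ≤ eLpNorm f 2 P := by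
    rw [eLpNorm_const _ two_ne_zero (IsProbabilityMeasure.ne_zero P)]
    simp only [measure_univ, ENNReal.one_rpow, mul_one]
    refine (enorm_integral_le_lintegral_enorm f).trans ?_
    rw [← eLpNorm_one_eq_lintegral_enorm]
    exact eLpNorm_le_eLpNorm_of_exponent_le one_le_two hf.aestronglyMeasurable
  refine (eLpNorm_sub_le (g := fun _ : Ω => ∫ ω', f ω' ∂P) hf.aestronglyMeasurable
    aestronglyMeasurable_const one_le_two).trans ?_
  rw [two_mul]
  gcongr

/-- A locally stationary array with `L²` approximation by functionals of the past whose dependence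
measures are uniformly summable. -/
structure LocallyStationary (P : Measure Ω) (ε ε' : ℤ → Ω → ℝ) (Z : ℤ → ℕ → Ω → ℝ)
    (Zs : ℤ → ℝ → Ω → ℝ) (G : ℝ → (ℕ → ℝ) → ℝ) (d : ℕ → ℝ) (α CB : ℝ) (t₀ : ℤ) : Prop where
  measurable : ∀ t n, Measurable (Z t n)
  summable : Summable d
  dependence : ∀ v ∈ Set.Icc (0 : ℝ) 1, Dependence P ε ε' (G v) d
  ae_eq : ∀ v ∈ Set.Icc (0 : ℝ) 1, ∀ t, Zs t v =ᵐ[P] fun ω => G v (past ε t ω)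
  holder : ∀ t, t₀ ≤ t → ∀ v ∈ Set.Icc (0 : ℝ) 1, ∀ v' ∈ Set.Icc (0 : ℝ) 1,
    eLpNorm (fun ω => Zs t v ω - Zs t v' ω) 2 P ≤ ENNReal.ofReal (CB * |v - v'| ^ α)
  approx : ∀ (n : ℕ) (t : ℤ), t₀ ≤ t → t ≤ n →
    eLpNorm (fun ω => Z t n ω - Zs t ((t : ℝ) / n) ω) 2 P ≤ ENNReal.ofReal (CB * (n : ℝ) ^ (-α))

namespace LocallyStationary

variable {Z : ℤ → ℕ → Ω → ℝ} {Zs : ℤ → ℝ → Ω → ℝ} {G : ℝ → (ℕ → ℝ) → ℝ} {d : ℕ → ℝ}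
  {α CB : ℝ} {t₀ : ℤ} {w : ℕ → ℤ → ℝ} {κ u : ℝ}

/-- The stationary approximation at the rescaled time `v`, clamped to `[0, 1]`, as an element of
`L²`. -/
def approxVec (hZ : LocallyStationary P ε ε' Z Zs G d α CB t₀) (t : ℤ) (v : ℝ) : Lp ℝ 2 P :=
  (hZ.dependence _ (Set.projIcc (0 : ℝ) 1 zero_le_one v).2).vec t

/-- Freezing the rescaled time at `u` has a negligible effect on local sums. -/
lemma eventually_norm_freeze_le (hZ : LocallyStationary P ε ε' Z Zs G d α CB t₀)
    (hε : Innovations P ε ε') (hα : 0 < α) (hCB : 0 ≤ CB) (hw : LocalWeights w κ u α)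
    (hu : u ∈ Set.Icc (0 : ℝ) 1) {η : ℝ} (hη : 0 < η) :
    ∀ᶠ n : ℕ in atTop, ‖∑ t ∈ Finset.Icc (1 : ℤ) n, w n t •
      center (futureProj P hε.measurable) t
        (hZ.approxVec t ((t : ℝ) / n) - (hZ.dependence u hu).vec t)‖ ≤ η := by
  have hD := decreasingProjections_futureProj (P := P) hε.measurable
  have hd0 := (hZ.dependence u hu).nonneg
  have hd2 : Summable fun k => 2 * d k := hZ.summable.mul_left 2
  have hd20 : ∀ k, 0 ≤ 2 * d k := fun k => mul_nonneg two_pos.le (hd0 k)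
  have h1 := (tendsto_tsum_min_zero hd20 hd2).const_mul √(κ + 1)
  rw [mul_zero] at h1
  have h2 : Tendsto (fun θ : ℝ => CB * θ ^ α) (𝓝[>] 0) (𝓝[≥] 0) := by
    refine tendsto_nhdsWithin_iff.2 ⟨?_, ?_⟩
    · have h3 : Tendsto (fun θ : ℝ => CB * θ ^ α) (𝓝 0) (𝓝 (CB * 0 ^ α)) :=
        ((Real.continuous_rpow_const hα.le).tendsto 0).const_mul CB
      rw [Real.zero_rpow hα.ne', mul_zero] at h3
      exact h3.mono_left nhdsWithin_le_nhds
    · filter_upwards [self_mem_nhdsWithin] with θ hθ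
      exact mul_nonneg hCB (Real.rpow_nonneg (le_of_lt hθ) α)
  -- `θ` is the width of the neighbourhood of `u` outside which the weights vanish; inside it the
  -- Hölder bound is at most `CB θ^α`.
  obtain ⟨θ, hθ, hθ0⟩ := (((h1.comp h2).eventually_le_const hη).and self_mem_nhdsWithin).exists
  have hθ0' : 0 < θ := hθ0
  have hρ0 : 0 ≤ CB * θ ^ α := mul_nonneg hCB (Real.rpow_nonneg hθ0'.le α)
  filter_upwards [hw.eventually_sum_sq_le, hw.localized θ hθ0', hw.support t₀] with n h3 h4 h5
  have hθ' : √(κ + 1) * ∑' k, min (2 * d k) (CB * θ ^ α) ≤ η := hθ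
  refine (hD.norm_sum_smul_center_le_of_forall (c := fun k => min (2 * d k) (CB * θ ^ α))
    (fun t _ => (Dependence.exhausted_vec _ hε t).sub (Dependence.exhausted_vec _ hε t)) h3
    (fun k => le_min (hd20 k) hρ0)
    (Summable.of_nonneg_of_le (fun k => le_min (hd20 k) hρ0) (fun k => min_le_left _ _) hd2)
    fun t ht hwt k => le_min ?_ ?_).trans hθ'
  · rw [map_sub]
    exact (norm_sub_le _ _).trans ((add_le_add (Dependence.norm_increment_le _ hε t k)
      (Dependence.norm_increment_le _ hε t k)).trans_eq (two_mul _).symm)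
  · refine (hD.norm_increment_le _ _).trans ?_
    refine (Dependence.norm_vec_sub_vec _ _ t).trans_le ?_
    refine ENNReal.toReal_le_of_le_ofReal hρ0 ?_
    rw [Finset.mem_Icc] at ht
    have hn : (0 : ℝ) < n := by
      have : (1 : ℤ) ≤ n := ht.1.trans ht.2
      exact_mod_cast this
    have hmem : (t : ℝ) / n ∈ Set.Icc (0 : ℝ) 1 := by
      have h6 : (1 : ℝ) ≤ t := by exact_mod_cast ht.1
      have h7 : (t : ℝ) ≤ n := by exact_mod_cast ht.2
      exact ⟨by positivity, (div_le_one hn).2 h7⟩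
    rw [Set.projIcc_of_mem zero_le_one hmem]
    have h8 := hZ.holder t (h5 t hwt).1 _ hmem u hu
    refine (eLpNorm_congr_ae ((hZ.ae_eq _ hmem t).sub (hZ.ae_eq u hu t))).symm.trans_le
      (h8.trans (ENNReal.ofReal_le_ofReal ?_))
    exact mul_le_mul_of_nonneg_left
      (Real.rpow_le_rpow (abs_nonneg _) (h4 t hwt) hα.le) hCB

/-- The weighted sum of the centered array is close in `L²` to that of its stationary
approximation at `u`. -/
lemma eventually_norm_sub_centeredSum_le (hZ : LocallyStationary P ε ε' Z Zs G d α CB t₀)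
    (hε : Innovations P ε ε') (hα : 0 < α) (hCB : 0 ≤ CB) (hw : LocalWeights w κ u α)
    (hu : u ∈ Set.Icc (0 : ℝ) 1) {η : ℝ} (hη : 0 < η) :
    ∀ᶠ n : ℕ in atTop, ∃ h : MemLp (fun ω => ∑ t ∈ Finset.Icc (1 : ℤ) n,
        w n t * (Z t n ω - ∫ ω', Z t n ω' ∂P)) 2 P,
      ‖h.toLp _ - (hZ.dependence u hu).centeredSum hε w n‖ ≤ η := by
  have hlim := hw.sum_abs.const_mul (2 * CB)
  rw [mul_zero] at hlim
  filter_upwards [hZ.eventually_norm_freeze_le hε hα hCB hw hu (half_pos hη), hw.support t₀,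
    hlim.eventually_le_const (half_pos hη)] with n h1 h2 h3
  set T := Finset.Icc (1 : ℤ) n with hT
  -- The approximation bound holds for `t ≥ t₀` only. Times of zero weight are dropped, since square
  -- integrability of `Z t n` is not assumed there.
  set T' := T.filter fun t => w n t ≠ 0 with hT'
  have hmem : ∀ t ∈ T, (t : ℝ) / n ∈ Set.Icc (0 : ℝ) 1 := by
    intro t ht
    rw [hT, Finset.mem_Icc] at ht
    have hn : (0 : ℝ) < n := by
      have : (1 : ℤ) ≤ n := ht.1.trans ht.2
      exact_mod_cast this
    have h6 : (1 : ℝ) ≤ t := by exact_mod_cast ht.1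
    have h7 : (t : ℝ) ≤ n := by exact_mod_cast ht.2
    exact ⟨by positivity, (div_le_one hn).2 h7⟩
  have hZs2 : ∀ t ∈ T, MemLp (Zs t ((t : ℝ) / n)) 2 P := fun t ht =>
    ((hZ.dependence _ (hmem t ht)).memLp t).ae_eq (hZ.ae_eq _ (hmem t ht) t).symm
  let Δ : ℤ → Ω → ℝ := fun t ω => Z t n ω - Zs t ((t : ℝ) / n) ω
  have hΔle : ∀ t ∈ T', eLpNorm (Δ t) 2 P ≤ ENNReal.ofReal (CB * (n : ℝ) ^ (-α)) := fun t ht =>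
    hZ.approx n t (h2 t (Finset.mem_filter.1 ht).2).1 (h2 t (Finset.mem_filter.1 ht).2).2
  have hΔ2 : ∀ t ∈ T', MemLp (Δ t) 2 P := fun t ht =>
    ⟨(hZ.measurable t n).aestronglyMeasurable.sub
      (hZs2 t (Finset.mem_filter.1 ht).1).aestronglyMeasurable,
      (hΔle t ht).trans_lt ENNReal.ofReal_lt_top⟩
  let e : ℤ → Ω → ℝ := fun t ω => w n t * (Δ t ω - ∫ ω', Δ t ω' ∂P)
  have he2 : ∀ t ∈ T', MemLp (e t) 2 P := fun t ht =>
    ((hΔ2 t ht).sub (memLp_const _)).const_mul _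
  have hF2 : MemLp (fun ω => ∑ t ∈ T', e t ω) 2 P := memLp_finsetSum T' he2
  -- The array error need not be a functional of the innovations, so only the triangle inequality is
  -- available; it suffices because `∑ |w_t| n^{-α}` tends to zero.
  have hFn : ‖hF2.toLp _‖ ≤ η / 2 := by
    rw [Lp.norm_toLp]
    refine ENNReal.toReal_le_of_le_ofReal (half_pos hη).le ?_
    have hc0 : 0 ≤ CB * (n : ℝ) ^ (-α) := by positivity
    have hsum : (fun ω => ∑ t ∈ T', e t ω) = ∑ t ∈ T', e t := by ext ω; simp
    rw [hsum]
    calc eLpNorm (∑ t ∈ T', e t) 2 P ≤ ∑ t ∈ T', eLpNorm (e t) 2 P :=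
          eLpNorm_sum_le (fun t ht => (he2 t ht).aestronglyMeasurable) one_le_two
      _ ≤ ∑ t ∈ T', ENNReal.ofReal (|w n t| * (2 * (CB * (n : ℝ) ^ (-α)))) := by
          refine Finset.sum_le_sum fun t ht => ?_
          have hsm : e t = w n t • fun ω => Δ t ω - ∫ ω', Δ t ω' ∂P := rfl
          rw [hsm, eLpNorm_const_smul, ENNReal.ofReal_mul (abs_nonneg _),
            ENNReal.ofReal_mul two_pos.le, ENNReal.ofReal_ofNat, Real.enorm_eq_ofReal_abs]
          gcongr
          exact (eLpNorm_sub_integral_le (hΔ2 t ht)).trans (by gcongr; exact hΔle t ht)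
      _ = ENNReal.ofReal (∑ t ∈ T', |w n t| * (2 * (CB * (n : ℝ) ^ (-α)))) :=
          (ENNReal.ofReal_sum_of_nonneg fun t _ => by positivity).symm
      _ ≤ ENNReal.ofReal (η / 2) := by
          refine ENNReal.ofReal_le_ofReal (le_trans ?_ h3)
          rw [← Finset.sum_mul]
          have : ∑ t ∈ T', |w n t| ≤ ∑ t ∈ T, |w n t| :=
            Finset.sum_le_sum_of_subset_of_nonneg (Finset.filter_subset _ _)
              fun t _ _ => abs_nonneg _
          calc _ ≤ (∑ t ∈ T, |w n t|) * (2 * (CB * (n : ℝ) ^ (-α))) := by gcongr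
            _ = _ := by ring
  set R : Lp ℝ 2 P := ∑ t ∈ T, w n t • center (futureProj P hε.measurable) t
    (hZ.approxVec t ((t : ℝ) / n)) with hR
  have hRae : (R : Ω → ℝ) =ᵐ[P] fun ω => ∑ t ∈ T, w n t *
      (Zs t ((t : ℝ) / n) ω - ∫ ω', Zs t ((t : ℝ) / n) ω' ∂P) := by
    refine coeFn_sum_smul T (w n) _ fun t ht => ?_
    have hdep := hZ.dependence _ (hmem t ht)
    have h4 : hZ.approxVec t ((t : ℝ) / n) = hdep.vec t := by
      rw [approxVec]
      congr 1
      rw [Set.projIcc_of_mem zero_le_one (hmem t ht)]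
    rw [h4]
    filter_upwards [center_toLp_ae_eq hε (hdep.adapted t) (hdep.memLp t),
      hZ.ae_eq _ (hmem t ht) t] with ω h5 h6
    rw [Dependence.vec, h5, h6, integral_congr_ae (hZ.ae_eq _ (hmem t ht) t)]
  have hae : (fun ω => ∑ t ∈ T, w n t * (Z t n ω - ∫ ω', Z t n ω' ∂P))
      =ᵐ[P] (hF2.toLp _ + R : Lp ℝ 2 P) := by
    filter_upwards [Lp.coeFn_add (hF2.toLp _) R, hF2.coeFn_toLp, hRae] with ω h4 h5 h6
    rw [h4, Pi.add_apply, h5, h6]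
    have e1 : ∑ t ∈ T', e t ω = ∑ t ∈ T, e t ω :=
      Finset.sum_filter_of_ne fun t _ ht h0 => ht (by simp [e, h0])
    rw [e1, ← Finset.sum_add_distrib]
    refine Finset.sum_congr rfl fun t ht => ?_
    rcases eq_or_ne (w n t) 0 with h0 | h0
    · simp [e, h0]
    · have ht' : t ∈ T' := Finset.mem_filter.2 ⟨ht, h0⟩
      have i1 : Integrable (Zs t ((t : ℝ) / n)) P := (hZs2 t ht).integrable one_le_two
      have i2 : Integrable (Δ t) P := (hΔ2 t ht').integrable one_le_two
      have i3 : ∫ ω', Z t n ω' ∂P = ∫ ω', Δ t ω' ∂P + ∫ ω', Zs t ((t : ℝ) / n) ω' ∂P := by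
        rw [← integral_add i2 i1]
        refine integral_congr_ae (.of_forall fun ω' => ?_)
        simp [Δ]
      simp only [e]
      rw [i3]
      simp only [Δ]
      ring
  have hmemL : MemLp (fun ω => ∑ t ∈ T, w n t * (Z t n ω - ∫ ω', Z t n ω' ∂P)) 2 P :=
    (Lp.memLp (hF2.toLp _ + R : Lp ℝ 2 P)).ae_eq hae.symm
  refine ⟨hmemL, ?_⟩
  have e2 : hmemL.toLp _ = hF2.toLp _ + R := Lp.ext (hmemL.coeFn_toLp.trans hae)
  have e3 : R - (hZ.dependence u hu).centeredSum hε w n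
      = ∑ t ∈ T, w n t • center (futureProj P hε.measurable) t
        (hZ.approxVec t ((t : ℝ) / n) - (hZ.dependence u hu).vec t) := by
    rw [hR, Dependence.centeredSum, ← Finset.sum_sub_distrib]
    exact Finset.sum_congr rfl fun t _ => by rw [map_sub, smul_sub]
  rw [e2, add_sub_assoc, e3]
  refine (norm_add_le _ _).trans ?_
  linarith

end LocallyStationary

end LocalStationary

/-! ### Local central limit theorem under L² approximation -/

section LocalLimit

/-- If the integral vanished, `K` would be zero almost everywhere, against `∫ K = 1`. Positivity
allows the sign of `∫ K² · σ²` to be passed on to `σ²`. -/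
lemma LocalizingKernel.integral_sq_pos {K : ℝ → ℝ} (hK : LocalizingKernel K) :
    0 < ∫ x, K x ^ 2 := by
  obtain ⟨B, hB⟩ := hK.bounded
  obtain ⟨v, V, hv, hV, hKv⟩ := exists_monotone_variation hK.boundedVariation
  have hmeas : Measurable K := measurable_of_abs_sub_le hv hKv
  have hsupp : Function.support (fun x => K x ^ 2) = Function.support K := by
    ext x; simp
  have hint : Integrable (fun x => K x ^ 2) := by
    rw [← integrableOn_iff_integrable_of_support_subset (hsupp.trans_subset hK.support_subset)]
    refine Measure.integrableOn_of_bounded (M := B ^ 2) (by simp)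
      (hmeas.pow_const 2).aestronglyMeasurable (.of_forall fun x => ?_)
    rw [Real.norm_eq_abs, abs_pow]
    exact pow_le_pow_left₀ (abs_nonneg _) (hB x) 2
  rw [integral_pos_iff_support_of_nonneg (fun x => sq_nonneg _) hint, hsupp, pos_iff_ne_zero]
  intro h0
  have h1 : K =ᵐ[volume] 0 := by
    rw [Filter.EventuallyEq, ae_iff]
    simpa [Function.support] using h0
  have := hK.integral_eq_one
  rw [integral_congr_ae h1] at this
  simp at this

variable {Ω : Type*} [MeasurableSpace Ω] {P : Measure Ω} {ε ε' : ℤ → Ω → ℝ}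

lemma covariance_congr_ae {X X' Y Y' : Ω → ℝ} (hX : X =ᵐ[P] X') (hY : Y =ᵐ[P] Y') :
    cov[X, Y; P] = cov[X', Y'; P] := by
  rw [covariance, covariance, integral_congr_ae hX, integral_congr_ae hY]
  refine integral_congr_ae ?_
  filter_upwards [hX, hY] with ω h1 h2
  rw [h1, h2]

lemma IdentDistrib.covariance_eq {Ω' E : Type*} [MeasurableSpace Ω'] [MeasurableSpace E]
    {Q : Measure Ω'} {U : Ω → E} {V : Ω' → E} (h : IdentDistrib U V P Q) {f g : E → ℝ}
    (hf : Measurable f) (hg : Measurable g) :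
    cov[fun ω => f (U ω), fun ω => g (U ω); P] = cov[fun ω => f (V ω), fun ω => g (V ω); Q] := by
  have h1 : ∫ ω, f (U ω) ∂P = ∫ ω, f (V ω) ∂Q := (h.comp hf).integral_eq
  have h2 : ∫ ω, g (U ω) ∂P = ∫ ω, g (V ω) ∂Q := (h.comp hg).integral_eq
  rw [covariance, covariance, h1, h2]
  exact (h.comp (u := fun x => (f x - ∫ ω, f (V ω) ∂Q) * (g x - ∫ ω, g (V ω) ∂Q))
    (by fun_prop)).integral_eq

/-- Local central limit theorem for locally stationary arrays. -/
theorem LocallyStationary.localCLT [IsProbabilityMeasure P] {Z : ℤ → ℕ → Ω → ℝ} {Zs : ℤ → ℝ → Ω → ℝ}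
    {G : ℝ → (ℕ → ℝ) → ℝ} {d : ℕ → ℝ} {α CB : ℝ} {t₀ : ℤ}
    (hZ : LocallyStationary P ε ε' Z Zs G d α CB t₀) (hε : Innovations P ε ε')
    (hα : 0 < α) (hCB : 0 ≤ CB) {K : ℝ → ℝ} (hK : LocalizingKernel K) {b : ℕ → ℝ}
    (hb : Tendsto b atTop (𝓝 0)) (hnb : Tendsto (fun n : ℕ => (n : ℝ) * b n) atTop atTop)
    (hbα : Tendsto (fun n : ℕ => √((n : ℝ) * b n) * (n : ℝ) ^ (-α)) atTop (𝓝 0))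
    {u : ℝ} (hu : u ∈ Set.Ioo (0 : ℝ) 1)
    (hstat : ∀ t : ℤ, IdentDistrib (fun ω (s : ℤ) => Zs (s + t) u ω) (fun ω s => Zs s u ω) P P) :
    LocalCLT P K Z Zs b u := by
  have hw := localWeights_kernelWeight hK hb hnb hbα hu
  have hu' : u ∈ Set.Icc (0 : ℝ) 1 := Set.Ioo_subset_Icc_self hu
  have hG := hZ.dependence u hu'
  have hcov : ∀ s t, cov[fun ω => G u (past ε s ω), fun ω => G u (past ε t ω); P]
      = autocov P Zs u (t - s) := by
    intro s t
    rw [← covariance_congr_ae (hZ.ae_eq u hu' s) (hZ.ae_eq u hu' t), autocov]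
    have := IdentDistrib.covariance_eq (hstat s) (measurable_pi_apply (0 : ℤ))
      (measurable_pi_apply (t - s))
    simpa using this
  have hident : ∀ t, IdentDistrib (fun ω => G u (past ε t ω)) (fun ω => G u (past ε 0 ω)) P P := by
    intro t
    have h1 : IdentDistrib (Zs t u) (Zs 0 u) P P := by
      simpa [Function.comp_def] using (hstat t).comp (measurable_pi_apply (0 : ℤ))
    have h2 : ∀ t, IdentDistrib (Zs t u) (fun ω => G u (past ε t ω)) P P := fun t =>
      IdentDistrib.of_ae_eq
        (((hG.memLp t).aestronglyMeasurable.congr (hZ.ae_eq u hu' t).symm).aemeasurable)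
        (hZ.ae_eq u hu' t)
    exact (h2 t).symm.trans (h1.trans (h2 0))
  have hsum : Summable (autocov P Zs u) :=
    (hG.summable_cov hε hZ.summable).congr fun t => by rw [hcov, sub_zero]
  have hv := hG.tendsto_norm_sq_centeredSum hε hZ.summable hw hcov
  change Tendsto _ _ (𝓝 ((∫ x, K x ^ 2) * longRunVar P Zs u)) at hv
  have hv0 : 0 ≤ (∫ x, K x ^ 2) * longRunVar P Zs u := ge_of_tendsto' hv fun n => sq_nonneg _
  have hloc : ∀ n : ℕ, localSum P K Z (b n) u n = fun ω => ∑ t ∈ Finset.Icc (1 : ℤ) n,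
      kernelWeight K b u n t * (Z t n ω - ∫ ω', Z t n ω' ∂P) := by
    intro n
    ext ω
    simp only [localSum, kernelWeight, Finset.mul_sum, mul_assoc]
  have hmeas : ∀ n : ℕ, AEMeasurable (localSum P K Z (b n) u n) P := by
    intro n
    rw [hloc n]
    exact (Finset.measurable_fun_sum _ fun t _ =>
      ((hZ.measurable t n).sub_const _).const_mul _).aemeasurable
  refine ⟨hsum, nonneg_of_mul_nonneg_right hv0 hK.integral_sq_pos, hmeas, aemeasurable_id, ?_⟩
  refine ProbabilityMeasure.tendsto_iff_tendsto_charFun.2 fun s => ?_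
  have hlim := hG.tendsto_charFun_centeredSum hε hZ.summable hw hident hv s
  have hgauss : charFun ((gaussianReal 0 ((∫ x, K x ^ 2) * longRunVar P Zs u).toNNReal).map id) s
      = (Real.exp (-(s ^ 2 / 2 * ((∫ x, K x ^ 2) * longRunVar P Zs u))) : ℝ) := by
    rw [Measure.map_id, charFun_gaussianReal, Complex.ofReal_exp]
    congr 1
    rw [Real.coe_toNNReal _ hv0]
    push_cast
    ring
  change Tendsto (fun n : ℕ => charFun (P.map (localSum P K Z (b n) u n)) s) atTop
    (𝓝 (charFun ((gaussianReal 0 ((∫ x, K x ^ 2) * longRunVar P Zs u).toNNReal).map id) s))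
  rw [hgauss]
  -- The local sum and the frozen stationary sum are L²-close, so their characteristic functions
  -- have the same limit.
  refine hlim.congr_dist ?_
  rw [Metric.tendsto_nhds]
  intro η hη
  have hη' : 0 < η / (|s| + 1) / 2 := by positivity
  filter_upwards [hZ.eventually_norm_sub_centeredSum_le hε hα hCB hw hu' hη'] with n hn
  obtain ⟨hmem, hle⟩ := hn
  rw [Real.dist_eq, sub_zero, abs_of_nonneg dist_nonneg, dist_comm, dist_eq_norm, hloc n]
  have h3 := norm_charFun_map_sub_le hmem (Lp.memLp (hG.centeredSum hε (kernelWeight K b u) n)) s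
  rw [Lp.toLp_coeFn] at h3
  refine (h3.trans (mul_le_mul_of_nonneg_left hle (abs_nonneg s))).trans_lt ?_
  calc |s| * (η / (|s| + 1) / 2) ≤ (|s| + 1) * (η / (|s| + 1) / 2) := by gcongr; linarith
    _ = η / 2 := by field_simp
    _ < η := half_lt_self hη

end LocalLimit

/-! ### Locally Lipschitz functions of polynomial growth -/

section PolynomialLipschitz

variable {r : ℕ} {M C : ℝ} {g : (Fin r → ℝ) → ℝ}

/-- Each of the three terms in the growth factor is at most the `M`-th power of one sum that is at
least 1, whence the constant 3. A single power is the form to which Hölder's inequality applies. -/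
lemma ClassL.abs_sub_le (hg : ClassL r M C g) (y y' : Fin r → ℝ) :
    |g y - g y'| ≤ 3 * max C 0 * (∑ i, |y i - y' i|) * (1 + ∑ i, |y i| + ∑ i, |y' i|) ^ M := by
  rcases eq_or_ne y y' with rfl | hne
  · simp
  have ha : 0 ≤ ∑ i, |y i| := Finset.sum_nonneg fun i _ => abs_nonneg _
  have hb : 0 ≤ ∑ i, |y' i| := Finset.sum_nonneg fun i _ => abs_nonneg _
  have hD : 0 < ∑ i, |y i - y' i| := by
    obtain ⟨i, hi⟩ := Function.ne_iff.1 hne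
    exact Finset.sum_pos' (fun i _ => abs_nonneg _)
      ⟨i, Finset.mem_univ i, abs_pos.2 (sub_ne_zero.2 hi)⟩
  have h1 := hg.2 y y' hne
  rw [div_le_iff₀ (by positivity)] at h1
  have hS : 1 + (∑ i, |y i|) ^ M + (∑ i, |y' i|) ^ M
      ≤ 3 * (1 + ∑ i, |y i| + ∑ i, |y' i|) ^ M := by
    have e1 : (1 : ℝ) ≤ (1 + ∑ i, |y i| + ∑ i, |y' i|) ^ M :=
      Real.one_le_rpow (by linarith) hg.1
    have e2 : (∑ i, |y i|) ^ M ≤ (1 + ∑ i, |y i| + ∑ i, |y' i|) ^ M :=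
      Real.rpow_le_rpow ha (by linarith) hg.1
    have e3 : (∑ i, |y' i|) ^ M ≤ (1 + ∑ i, |y i| + ∑ i, |y' i|) ^ M :=
      Real.rpow_le_rpow hb (by linarith) hg.1
    linarith
  calc |g y - g y'| ≤ C * ((∑ i, |y i - y' i|) * (1 + (∑ i, |y i|) ^ M + (∑ i, |y' i|) ^ M)) := h1
    _ ≤ max C 0 * ((∑ i, |y i - y' i|) * (3 * (1 + ∑ i, |y i| + ∑ i, |y' i|) ^ M)) := by
        gcongr
        exact le_max_left _ _
    _ = _ := by ring

lemma ClassL.continuous (hg : ClassL r M C g) : Continuous g := by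
  rw [continuous_iff_continuousAt]
  intro y
  rw [ContinuousAt, tendsto_iff_norm_sub_tendsto_zero]
  refine squeeze_zero (fun _ => norm_nonneg _) (fun x => hg.abs_sub_le x y) ?_
  have hc : Continuous fun x : Fin r → ℝ =>
      3 * max C 0 * (∑ i, |x i - y i|) * (1 + ∑ i, |x i| + ∑ i, |y i|) ^ M := by
    refine Continuous.mul (by fun_prop) (Continuous.rpow_const (by fun_prop) fun x => .inr hg.1)
  have := hc.tendsto y
  simpa using this

variable {Ω : Type*} [MeasurableSpace Ω] {P : Measure Ω}

/-- Hölder's inequality for the product of a factor and the `M`-th power of another one. -/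
lemma eLpNorm_mul_rpow_le (hM : 0 ≤ M) {D S : Ω → ℝ} (hD : AEStronglyMeasurable D P)
    (hS : AEStronglyMeasurable S P) (hS0 : ∀ ω, 0 ≤ S ω) :
    eLpNorm (fun ω => D ω * S ω ^ M) 2 P ≤ eLpNorm D (ENNReal.ofReal (2 * (M + 1))) P *
      eLpNorm S (ENNReal.ofReal (2 * (M + 1))) P ^ M := by
  rcases hM.eq_or_lt with rfl | hM
  · simp
  have hSM : (fun ω => S ω ^ M) = fun ω => ‖S ω‖ ^ M := by
    ext ω
    rw [Real.norm_eq_abs, abs_of_nonneg (hS0 ω)]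
  have hS' : AEStronglyMeasurable (fun ω => S ω ^ M) P :=
    (hS.aemeasurable.pow_const M).aestronglyMeasurable
  -- The exponents satisfy `1/(2(M+1)) + M/(2(M+1)) = 1/2`, and the second makes the norm of `S^M`
  -- equal to the `M`-th power of the `L^{2(M+1)}` norm of `S`.
  have htr : ENNReal.HolderTriple (ENNReal.ofReal (2 * (M + 1)))
      (ENNReal.ofReal (2 * (M + 1) / M)) 2 := by
    constructor
    rw [← ENNReal.ofReal_inv_of_pos (by positivity), ← ENNReal.ofReal_inv_of_pos (by positivity),
      ← ENNReal.ofReal_add (by positivity) (by positivity), ← ENNReal.ofReal_ofNat 2,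
      ← ENNReal.ofReal_inv_of_pos two_pos]
    congr 1
    field_simp
    ring
  have h1 := eLpNorm_smul_le_mul_eLpNorm (p := ENNReal.ofReal (2 * (M + 1)))
    (q := ENNReal.ofReal (2 * (M + 1) / M)) (r := 2) hS' hD
  refine h1.trans_eq ?_
  rw [hSM, eLpNorm_norm_rpow S hM, ← ENNReal.ofReal_mul (by positivity),
    div_mul_cancel₀ _ hM.ne']

lemma eLpNorm_sum_abs_le {p : ℝ≥0∞} (hp : 1 ≤ p) {Y : Fin r → Ω → ℝ}
    (hY : ∀ j, AEStronglyMeasurable (Y j) P) {ρ : Fin r → ℝ} (hρ0 : ∀ j, 0 ≤ ρ j)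
    (hρ : ∀ j, eLpNorm (Y j) p P ≤ ENNReal.ofReal (ρ j)) :
    eLpNorm (fun ω => ∑ j, |Y j ω|) p P ≤ ENNReal.ofReal (∑ j, ρ j) := by
  have e : (fun ω => ∑ j, |Y j ω|) = ∑ j, fun ω => ‖Y j ω‖ := by
    ext ω; simp
  rw [e, ENNReal.ofReal_sum_of_nonneg fun j _ => hρ0 j]
  refine (eLpNorm_sum_le (fun j _ => (hY j).norm) hp).trans (Finset.sum_le_sum fun j _ => ?_)
  rw [eLpNorm_norm]
  exact hρ j

/-- A function in `L_r(M, C)` maps `L^{2(M+1)}`-close bounded arguments to `L²`-close values. -/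
lemma ClassL.eLpNorm_sub_le [IsProbabilityMeasure P] (hg : ClassL r M C g)
    {Y Y' : Fin r → Ω → ℝ} (hY : ∀ j, AEStronglyMeasurable (Y j) P)
    (hY' : ∀ j, AEStronglyMeasurable (Y' j) P) {A : ℝ} (hA : 0 ≤ A) {ρ : Fin r → ℝ}
    (hρ0 : ∀ j, 0 ≤ ρ j)
    (hYA : ∀ j, eLpNorm (Y j) (ENNReal.ofReal (2 * (M + 1))) P ≤ ENNReal.ofReal A)
    (hYA' : ∀ j, eLpNorm (Y' j) (ENNReal.ofReal (2 * (M + 1))) P ≤ ENNReal.ofReal A)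
    (hρ : ∀ j, eLpNorm (fun ω => Y j ω - Y' j ω) (ENNReal.ofReal (2 * (M + 1))) P
      ≤ ENNReal.ofReal (ρ j)) :
    eLpNorm (fun ω => g (fun j => Y j ω) - g fun j => Y' j ω) 2 P
      ≤ ENNReal.ofReal (3 * max C 0 * (1 + 2 * r * A) ^ M * ∑ j, ρ j) := by
  have hM := hg.1
  have hC0 : 0 ≤ 3 * max C 0 := by positivity
  set p := ENNReal.ofReal (2 * (M + 1)) with hp
  have hp1 : 1 ≤ p := by
    rw [hp, ENNReal.one_le_ofReal]; linarith
  let D : Ω → ℝ := fun ω => ∑ j, |Y j ω - Y' j ω|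
  let S : Ω → ℝ := fun ω => 1 + ∑ j, |Y j ω| + ∑ j, |Y' j ω|
  have hab : ∀ {W : Fin r → Ω → ℝ}, (∀ j, AEStronglyMeasurable (W j) P) →
      AEStronglyMeasurable (fun ω => ∑ j, |W j ω|) P := fun hW =>
    (Finset.aemeasurable_fun_sum _ fun j _ =>
      (hW j).norm.aemeasurable).aestronglyMeasurable
  have hD : AEStronglyMeasurable D P := hab fun j => (hY j).sub (hY' j)
  have hS1 : AEStronglyMeasurable (fun ω => 1 + ∑ j, |Y j ω|) P :=
    aestronglyMeasurable_const.add (hab hY)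
  have hS : AEStronglyMeasurable S P := hS1.add (hab hY')
  have hS0 : ∀ ω, 0 ≤ S ω := fun ω => by positivity
  have hDn : eLpNorm D p P ≤ ENNReal.ofReal (∑ j, ρ j) :=
    eLpNorm_sum_abs_le hp1 (fun j => (hY j).sub (hY' j)) hρ0 hρ
  have hSn : eLpNorm S p P ≤ ENNReal.ofReal (1 + 2 * r * A) := by
    have h1 : eLpNorm (fun _ : Ω => (1 : ℝ)) p P = 1 := by
      rw [eLpNorm_const _ (by positivity) (IsProbabilityMeasure.ne_zero P)]
      simp
    have h2 := eLpNorm_sum_abs_le hp1 hY (fun _ => hA) hYA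
    have h3 := eLpNorm_sum_abs_le hp1 hY' (fun _ => hA) hYA'
    refine (eLpNorm_add_le hS1 (hab hY') hp1).trans ?_
    refine (add_le_add ((eLpNorm_add_le aestronglyMeasurable_const (hab hY) hp1).trans
      (add_le_add h1.le h2)) h3).trans_eq ?_
    rw [← ENNReal.ofReal_one, ← ENNReal.ofReal_add zero_le_one (by positivity),
      ← ENNReal.ofReal_add (by positivity) (by positivity)]
    congr 1
    simp
    ring
  calc eLpNorm (fun ω => g (fun j => Y j ω) - g fun j => Y' j ω) 2 P
      ≤ eLpNorm ((3 * max C 0) • fun ω => D ω * S ω ^ M) 2 P := by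
        refine eLpNorm_mono fun ω => ?_
        rw [Real.norm_eq_abs, Real.norm_eq_abs]
        refine (hg.abs_sub_le _ _).trans (le_trans (le_of_eq ?_) (le_abs_self _))
        simp only [Pi.smul_apply, smul_eq_mul, D, S]
        ring
    _ ≤ ENNReal.ofReal (3 * max C 0) * (ENNReal.ofReal (∑ j, ρ j)
        * ENNReal.ofReal (1 + 2 * r * A) ^ M) := by
        rw [eLpNorm_const_smul, Real.enorm_eq_ofReal hC0]
        gcongr
        refine (eLpNorm_mul_rpow_le hM hD hS hS0).trans ?_
        gcongr
    _ = _ := by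
        rw [ENNReal.ofReal_rpow_of_nonneg (by positivity) hM,
          ← ENNReal.ofReal_mul (Finset.sum_nonneg fun j _ => hρ0 j), ← ENNReal.ofReal_mul hC0]
        congr 1
        ring

end PolynomialLipschitz

/-! ### Shift invariance of the law -/

section Stationarity

variable {Ω : Type*} [MeasurableSpace Ω] {P : Measure Ω}

/-- Invariance under the unit shift is iterated forwards; for negative `t` the same equality of laws
is read backwards. -/
lemma StationaryErgodic.identDistrib {Y : ℤ → Ω → ℝ} (hY : StationaryErgodic P Y)
    (hm : ∀ t, Measurable (Y t)) (t : ℤ) :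
    IdentDistrib (fun ω (s : ℤ) => Y (s + t) ω) (fun ω s => Y s ω) P P := by
  have hpath : ∀ t : ℤ, Measurable fun ω (s : ℤ) => Y (s + t) ω := fun t =>
    measurable_pi_lambda _ fun s => hm (s + t)
  have hpath0 : Measurable fun ω (s : ℤ) => Y s ω := measurable_pi_lambda _ hm
  have hshift : ∀ a : ℤ, Measurable fun (x : ℤ → ℝ) (s : ℤ) => x (s + a) := fun a =>
    measurable_pi_lambda _ fun s => measurable_pi_apply (s + a)
  have hone : IdentDistrib (fun ω (s : ℤ) => Y (s + 1) ω) (fun ω s => Y s ω) P P := by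
    refine ⟨(hpath 1).aemeasurable, hpath0.aemeasurable, ?_⟩
    have := hY.toMeasurePreserving.map_eq
    rwa [Measure.map_map (hshift 1) hpath0] at this
  induction t using Int.induction_on with
  | zero => simpa using IdentDistrib.refl hpath0.aemeasurable
  | succ i ih =>
    have h1 := hone.comp (hshift i)
    simp only [Function.comp_def] at h1
    refine IdentDistrib.trans ?_ (h1.trans ih)
    simpa [add_assoc] using IdentDistrib.refl (μ := P) (hpath (i + 1)).aemeasurable
  | pred i ih =>
    have h1 := hone.comp (hshift (-i - 1))
    simp only [Function.comp_def] at h1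
    refine h1.symm.trans (IdentDistrib.trans ?_ ih)
    have e : (fun ω (s : ℤ) => Y (s + (-i - 1) + 1) ω) = fun ω (s : ℤ) => Y (s + -i) ω := by
      ext ω s
      congr 1
      ring_nf
    rw [e]
    exact IdentDistrib.refl (hpath (-i)).aemeasurable

end Stationarity

/-! ### Lagged pasts -/

section Shift

variable {Ω : Type*}

/-- The past at time `t - j` is a tail of the past at time `t`, so a function of several lagged
values is again a functional of `F_t`. -/
lemma past_add (ε : ℤ → Ω → ℝ) (t : ℤ) (ω : Ω) (j : ℕ) :
    (fun i => past ε t ω (i + j)) = past ε (t - j) ω := by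
  ext i
  simp only [past]
  congr 1
  push_cast
  ring

lemma coupledPast_add (ε ε' : ℤ → Ω → ℝ) (t s : ℤ) (ω : Ω) (j : ℕ) :
    (fun i => coupledPast ε ε' t s ω (i + j)) = coupledPast ε ε' (t - j) s ω := by
  ext i
  have e : t - ((i + j : ℕ) : ℤ) = t - j - i := by push_cast; ring
  simp only [coupledPast, e]

lemma coupledPast_of_lt (ε ε' : ℤ → Ω → ℝ) {t s : ℤ} (h : t < s) (ω : Ω) :
    coupledPast ε ε' t s ω = past ε t ω := by
  ext i
  rw [coupledPast, if_neg (by lia), past]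

lemma summable_shift {δ : ℕ → ℝ} (hδ : Summable δ) (j : ℕ) :
    Summable fun k => if j ≤ k then δ (k - j) else 0 := by
  rw [← summable_nat_add_iff j]
  simpa using hδ

end Shift

/-! ### Transfer of the conditions to functions of lagged values -/

section LagTransform

variable {Ω : Type*} [MeasurableSpace Ω] {P : Measure Ω} {ε ε' : ℤ → Ω → ℝ}
  {X : ℤ → ℕ → Ω → ℝ} {Xs : ℤ → ℝ → Ω → ℝ} {H : ℝ → (ℕ → ℝ) → ℝ} {δ : ℕ → ℝ} {α CB A : ℝ}

/-- Uniform version of the conditions on an array and its stationary approximation, in `L^p`. -/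
structure UniformApprox (P : Measure Ω) (ε ε' : ℤ → Ω → ℝ) (X : ℤ → ℕ → Ω → ℝ)
    (Xs : ℤ → ℝ → Ω → ℝ) (H : ℝ → (ℕ → ℝ) → ℝ) (δ : ℕ → ℝ) (α CB A : ℝ) (p : ℝ≥0∞) : Prop where
  measurable_array : ∀ t n, Measurable (X t n)
  measurable_approx : ∀ t, ∀ v ∈ Set.Icc (0 : ℝ) 1, Measurable (Xs t v)
  measurable : ∀ v ∈ Set.Icc (0 : ℝ) 1, Measurable (H v)
  ae_eq : ∀ v ∈ Set.Icc (0 : ℝ) 1, ∀ t, Xs t v =ᵐ[P] fun ω => H v (past ε t ω)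
  nonneg : ∀ k, 0 ≤ δ k
  summable : Summable δ
  coupled : ∀ v ∈ Set.Icc (0 : ℝ) 1, ∀ (t : ℤ) (k : ℕ),
    eLpNorm (fun ω => H v (past ε t ω) - H v (coupledPast ε ε' t (t - k) ω)) p P
      ≤ ENNReal.ofReal (δ k)
  const_nonneg : 0 ≤ CB
  bound_nonneg : 0 ≤ A
  moment : ∀ v ∈ Set.Icc (0 : ℝ) 1, ∀ t, eLpNorm (Xs t v) p P ≤ ENNReal.ofReal A
  holder : ∀ t, 1 ≤ t → ∀ v ∈ Set.Icc (0 : ℝ) 1, ∀ v' ∈ Set.Icc (0 : ℝ) 1,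
    eLpNorm (fun ω => Xs t v ω - Xs t v' ω) p P ≤ ENNReal.ofReal (CB * |v - v'| ^ α)
  approx : ∀ (n : ℕ) (t : ℤ), 1 ≤ t → t ≤ n →
    eLpNorm (fun ω => X t n ω - Xs t ((t : ℝ) / n) ω) p P ≤ ENNReal.ofReal (CB * (n : ℝ) ^ (-α))

/-- On a probability space the norms increase with the exponent, so the order can be lowered to `p`.
Stationarity makes the moment bound at time 0 valid at all times. -/
lemma exists_uniformApprox [IsProbabilityMeasure P] (hε : Innovations P ε ε')
    (hX : ∀ t n, Measurable (X t n))
    (hXs : ∀ t, ∀ u ∈ Set.Icc (0 : ℝ) 1, Measurable (Xs t u))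
    (hstat : ∀ u ∈ Set.Icc (0 : ℝ) 1, StationaryErgodic P (fun t => Xs t u)) {p q : ℝ}
    (hpq : p ≤ q) (hS : CondS1 P X Xs q α) (hM : CondM1 P ε ε' Xs q) :
    ∃ H δ CB A, UniformApprox P ε ε' X Xs H δ α CB A (ENNReal.ofReal p) := by
  obtain ⟨H, hH, hae, hsum⟩ := hM
  obtain ⟨CB, hCB, happ⟩ := hS.approx
  have hle : ∀ {f : Ω → ℝ}, Measurable f →
      eLpNorm f (ENNReal.ofReal p) P ≤ lqNorm P q f := fun hf =>
    eLpNorm_le_eLpNorm_of_exponent_le (ENNReal.ofReal_le_ofReal hpq) hf.aestronglyMeasurable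
  refine ⟨H, fun k => (⨆ u ∈ Set.Icc (0 : ℝ) 1, depMeasure P ε ε' (H u) q k).toReal, CB,
    (⨆ u ∈ Set.Icc (0 : ℝ) 1, lqNorm P q (Xs 0 u)).toReal, hX, hXs, hH, hae,
    fun k => ENNReal.toReal_nonneg, ENNReal.summable_toReal hsum.ne, ?_, hCB.le,
    ENNReal.toReal_nonneg, ?_, ?_, ?_⟩
  · intro v hv t k
    rw [ENNReal.ofReal_toReal (ENNReal.ne_top_of_tsum_ne_top hsum.ne k)]
    refine (hle ?_).trans ?_
    · exact ((hH v hv).comp (measurable_past_of_measurable hε.measurable t)).sub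
        ((hH v hv).comp (measurable_coupledPast_of_measurable hε t _))
    · refine le_trans ?_ (le_iSup₂ (f := fun u _ => depMeasure P ε ε' (H u) q k) v hv)
      exact le_iSup (fun t : ℤ => lqNorm P q fun ω =>
        H v (past ε t ω) - H v (coupledPast ε ε' t (t - k) ω)) t
  · intro v hv t
    rw [ENNReal.ofReal_toReal (hS.moment 0).ne]
    have h1 : IdentDistrib (Xs t v) (Xs 0 v) P P := by
      simpa [Function.comp_def] using
        ((hstat v hv).identDistrib (fun t => hXs t v hv) t).comp (measurable_pi_apply (0 : ℤ))
    rw [h1.eLpNorm_eq]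
    exact (hle (hXs 0 v hv)).trans (le_iSup₂ (f := fun u _ => lqNorm P q (Xs 0 u)) v hv)
  · intro t ht v hv v' hv'
    -- The Hölder condition is stated alongside a sample size `n ≥ t`; `n = t` serves.
    exact (hle ((hXs t v hv).sub (hXs t v' hv'))).trans
      ((happ t.toNat t ht (by lia)).1 v hv v' hv')
  · intro n t ht htn
    have hn : (0 : ℝ) < n := by
      have : (1 : ℤ) ≤ n := ht.trans htn
      exact_mod_cast this
    have hmem : (t : ℝ) / n ∈ Set.Icc (0 : ℝ) 1 := by
      have h6 : (1 : ℝ) ≤ t := by exact_mod_cast ht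
      have h7 : (t : ℝ) ≤ n := by exact_mod_cast htn
      exact ⟨by positivity, (div_le_one hn).2 h7⟩
    exact (hle ((hX t n).sub (hXs t _ hmem))).trans (happ n t ht htn).2

lemma UniformApprox.exists_locallyStationary [IsProbabilityMeasure P] {r : ℕ} {M C : ℝ}
    {g : (Fin r → ℝ) → ℝ}
    (hg : ClassL r M C g) (hε : Innovations P ε ε') (hα : 0 < α)
    (hX : UniformApprox P ε ε' X Xs H δ α CB A (ENNReal.ofReal (2 * (M + 1)))) :
    ∃ G d CB', 0 ≤ CB' ∧
      LocallyStationary P ε ε' (lagTransform g X) (lagTransform g Xs) G d α CB' r := by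
  have hM := hg.1
  set p := ENNReal.ofReal (2 * (M + 1)) with hp
  have hp1 : 1 ≤ p := by
    rw [hp, ENNReal.one_le_ofReal]; linarith
  have hgm : Measurable g := hg.continuous.measurable
  have hCB := hX.const_nonneg
  have hA := hX.bound_nonneg
  have hδs0 : 0 ≤ ∑' k, δ k := tsum_nonneg hX.nonneg
  -- `CB` is the approximation error at `(t-j)/n`, and `CB r^α` pays for moving from `(t-j)/n` to
  -- `t/n`.
  set c : ℝ := CB * (1 + (r : ℝ) ^ α) with hc
  have hc0 : 0 ≤ c := by positivity
  -- `B` bounds the `L^p` norms of all arguments fed to `g`: the stationary ones by `A`, the coupled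
  -- ones by `A + ∑ δ`, the array by `A + c`.
  set B : ℝ := A + ∑' k, δ k + c with hB
  have hB0 : 0 ≤ B := by positivity
  set Λ : ℝ := 3 * max C 0 * (1 + 2 * r * B) ^ M with hΛ
  have hΛ0 : 0 ≤ Λ := by positivity
  have hAB : ENNReal.ofReal A ≤ ENNReal.ofReal B := ENNReal.ofReal_le_ofReal (by linarith)
  have hXsB : ∀ v ∈ Set.Icc (0 : ℝ) 1, ∀ t, eLpNorm (Xs t v) p P ≤ ENNReal.ofReal B :=
    fun v hv t => (hX.moment v hv t).trans hAB
  have hpm : ∀ v ∈ Set.Icc (0 : ℝ) 1, ∀ t, Measurable fun ω => H v (past ε t ω) :=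
    fun v hv t => (hX.measurable v hv).comp (measurable_past_of_measurable hε.measurable t)
  have hcm : ∀ v ∈ Set.Icc (0 : ℝ) 1, ∀ t s, Measurable fun ω => H v (coupledPast ε ε' t s ω) :=
    fun v hv t s => (hX.measurable v hv).comp (measurable_coupledPast_of_measurable hε t s)
  have hHA : ∀ v ∈ Set.Icc (0 : ℝ) 1, ∀ t,
      eLpNorm (fun ω => H v (past ε t ω)) p P ≤ ENNReal.ofReal A := fun v hv t =>
    (eLpNorm_congr_ae (hX.ae_eq v hv t)).symm.trans_le (hX.moment v hv t)
  -- Replacing the innovation at `t - k` affects the value at `t - j` at lag `k - j`, and not at all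
  -- when `k < j`.
  let δ' : Fin r → ℕ → ℝ := fun j k => if (j : ℕ) ≤ k then δ (k - j) else 0
  have hδ'0 : ∀ j k, 0 ≤ δ' j k := fun j k => by
    simp only [δ']
    split_ifs
    exacts [hX.nonneg _, le_rfl]
  have hδ'le : ∀ j k, δ' j k ≤ ∑' k, δ k := fun j k => by
    simp only [δ']
    split_ifs
    exacts [hX.summable.le_tsum _ fun i _ => hX.nonneg i, hδs0]
  have hcoup : ∀ v ∈ Set.Icc (0 : ℝ) 1, ∀ (t : ℤ) (j : Fin r) (k : ℕ),
      eLpNorm (fun ω => H v (past ε (t - (j : ℕ)) ω)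
        - H v (coupledPast ε ε' (t - (j : ℕ)) (t - k) ω)) p P ≤ ENNReal.ofReal (δ' j k) := by
    intro v hv t j k
    simp only [δ']
    split_ifs with hjk
    · have e : t - (k : ℤ) = t - (j : ℕ) - ((k - j : ℕ) : ℤ) := by lia
      rw [e]
      exact hX.coupled v hv _ _
    · have hlt : t - ((j : ℕ) : ℤ) < t - k := by lia
      simp [coupledPast_of_lt ε ε' hlt]
  have hcoupB : ∀ v ∈ Set.Icc (0 : ℝ) 1, ∀ (t : ℤ) (j : Fin r) (k : ℕ),
      eLpNorm (fun ω => H v (coupledPast ε ε' (t - (j : ℕ)) (t - k) ω)) p P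
        ≤ ENNReal.ofReal B := by
    intro v hv t j k
    have e : (fun ω => H v (coupledPast ε ε' (t - (j : ℕ)) (t - k) ω))
        = (fun ω => H v (past ε (t - (j : ℕ)) ω)) - fun ω => H v (past ε (t - (j : ℕ)) ω)
          - H v (coupledPast ε ε' (t - (j : ℕ)) (t - k) ω) := by
      ext ω; simp
    rw [e]
    refine (eLpNorm_sub_le (hpm v hv _).aestronglyMeasurable
      ((hpm v hv _).sub (hcm v hv _ _)).aestronglyMeasurable hp1).trans ?_
    refine (add_le_add (hHA v hv _) (hcoup v hv t j k)).trans ?_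
    rw [← ENNReal.ofReal_add hA (hδ'0 j k)]
    exact ENNReal.ofReal_le_ofReal (by linarith [hδ'le j k])
  refine ⟨fun v x => g fun j => H v fun i => x (i + (j : ℕ)), fun k => Λ * ∑ j, δ' j k,
    Λ * (r * c), by positivity, ?_, ?_, ?_, ?_, ?_, ?_⟩
  · exact fun t n => hgm.comp (measurable_pi_lambda _ fun j => hX.measurable_array _ n)
  · have hsum : ∀ j ∈ Finset.univ, Summable (δ' j) := fun j _ => summable_shift hX.summable j
    exact (summable_sum hsum).mul_left Λ
  · intro v hv
    refine ⟨?_, fun t => ?_, fun k => ?_, fun t k => ?_⟩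
    · refine hgm.comp (measurable_pi_lambda _ fun j => (hX.measurable v hv).comp ?_)
      exact measurable_pi_lambda _ fun i => measurable_pi_apply _
    · simp only [past_add]
      have h0 : ∀ j : Fin r, AEStronglyMeasurable (fun ω => H v (past ε (t - (j : ℕ)) ω)) P :=
        fun j => (hpm v hv _).aestronglyMeasurable
      -- Square integrability follows by comparison with the constant `g 0`.
      have h1 := hg.eLpNorm_sub_le (Y' := fun _ _ => 0) h0 (fun _ => aestronglyMeasurable_const)
        hB0 (ρ := fun _ => A) (fun _ => hA) (fun j => (hHA v hv _).trans hAB) (by simp)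
        (fun j => by simpa only [sub_zero] using hHA v hv (t - (j : ℕ)))
      have hm : Measurable fun ω => g fun j : Fin r => H v (past ε (t - (j : ℕ)) ω) :=
        hgm.comp (measurable_pi_lambda _ fun j => hpm v hv _)
      have h2 : MemLp (fun ω => (g fun j : Fin r => H v (past ε (t - (j : ℕ)) ω))
          - g fun _ => 0) 2 P :=
        ⟨(hm.sub_const _).aestronglyMeasurable, h1.trans_lt ENNReal.ofReal_lt_top⟩
      have h3 := h2.add (memLp_const (g fun _ => 0))
      refine h3.ae_eq (.of_forall fun ω => ?_)
      simp
    · exact mul_nonneg hΛ0 (Finset.sum_nonneg fun j _ => hδ'0 j k)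
    · simp only [past_add, coupledPast_add]
      exact hg.eLpNorm_sub_le (fun j => (hpm v hv _).aestronglyMeasurable)
        (fun j => (hcm v hv _ _).aestronglyMeasurable) hB0 (fun j => hδ'0 j k)
        (fun j => (hHA v hv _).trans hAB) (fun j => hcoupB v hv t j k) fun j => hcoup v hv t j k
  · intro v hv t
    have : ∀ᵐ ω ∂P, ∀ j : Fin r, Xs (t - (j : ℕ)) v ω = H v (past ε (t - (j : ℕ)) ω) :=
      ae_all_iff.2 fun j => hX.ae_eq v hv _
    filter_upwards [this] with ω hω
    simp only [past_add, lagTransform, hω]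
  · intro t ht v hv v' hv'
    -- This is why the starting time is `r`: every lagged time is then at least 1.
    have h1 : ∀ j : Fin r, 1 ≤ t - (j : ℕ) := fun j => by have := j.2; lia
    refine (hg.eLpNorm_sub_le (fun j => (hX.measurable_approx _ v hv).aestronglyMeasurable)
      (fun j => (hX.measurable_approx _ v' hv').aestronglyMeasurable) hB0
      (fun j => by positivity) (fun j => hXsB v hv _) (fun j => hXsB v' hv' _)
      fun j => hX.holder _ (h1 j) v hv v' hv').trans (ENNReal.ofReal_le_ofReal ?_)
    have h2 : CB ≤ c := le_mul_of_one_le_right hCB (by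
      have : (0 : ℝ) ≤ (r : ℝ) ^ α := by positivity
      linarith)
    rw [Finset.sum_const, Finset.card_univ, Fintype.card_fin, nsmul_eq_mul, ← hΛ]
    calc Λ * (r * (CB * |v - v'| ^ α)) ≤ Λ * (r * (c * |v - v'| ^ α)) := by gcongr
      _ = _ := by ring
  · intro n t ht htn
    have h0 : ∀ j : Fin r, (0 : ℝ) < n := fun j => by
      have := j.2
      have : (1 : ℤ) ≤ n := by lia
      exact_mod_cast this
    have h1 : ∀ j : Fin r, 1 ≤ t - (j : ℕ) := fun j => by have := j.2; lia
    have hmem : ∀ s : ℤ, 0 ≤ s → s ≤ n → (s : ℝ) / n ∈ Set.Icc (0 : ℝ) 1 := by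
      intro s hs hsn
      have h6 : (0 : ℝ) ≤ s := by exact_mod_cast hs
      have h7 : (s : ℝ) ≤ n := by exact_mod_cast hsn
      exact ⟨by positivity, div_le_one_of_le₀ h7 (by positivity)⟩
    have ht0 : 0 ≤ t := (Nat.cast_nonneg r).trans ht
    have htm := hmem t ht0 htn
    have hρ : ∀ j : Fin r, eLpNorm (fun ω => X (t - (j : ℕ)) n ω
        - Xs (t - (j : ℕ)) ((t : ℝ) / n) ω) p P ≤ ENNReal.ofReal (c * (n : ℝ) ^ (-α)) := by
      intro j
      set s := t - (j : ℕ) with hs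
      have hsm := hmem s (by have := h1 j; lia) (by lia)
      have e : (fun ω => X s n ω - Xs s ((t : ℝ) / n) ω)
          = (fun ω => X s n ω - Xs s ((s : ℝ) / n) ω)
            + fun ω => Xs s ((s : ℝ) / n) ω - Xs s ((t : ℝ) / n) ω := by
        ext ω; simp
      rw [e]
      refine (eLpNorm_add_le
        ((hX.measurable_array s n).sub (hX.measurable_approx s _ hsm)).aestronglyMeasurable
        ((hX.measurable_approx s _ hsm).sub (hX.measurable_approx s _ htm)).aestronglyMeasurable
        hp1).trans ?_
      refine (add_le_add (hX.approx n s (h1 j) (by lia))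
        (hX.holder s (h1 j) _ hsm _ htm)).trans ?_
      rw [← ENNReal.ofReal_add (by positivity) (by positivity)]
      refine ENNReal.ofReal_le_ofReal ?_
      have h2 : |(s : ℝ) / n - t / n| ≤ r * (n : ℝ)⁻¹ := by
        have e3 : (s : ℝ) / n - t / n = -((j : ℕ) * (n : ℝ)⁻¹) := by
          rw [hs]; push_cast; ring
        rw [e3, abs_neg, abs_of_nonneg (by positivity)]
        gcongr
        exact j.2.le
      have h3 : |(s : ℝ) / n - t / n| ^ α ≤ (r : ℝ) ^ α * (n : ℝ) ^ (-α) := by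
        refine (Real.rpow_le_rpow (abs_nonneg _) h2 hα.le).trans_eq ?_
        rw [Real.mul_rpow (by positivity) (by positivity), Real.inv_rpow (by positivity),
          Real.rpow_neg (by positivity)]
      calc CB * (n : ℝ) ^ (-α) + CB * |(s : ℝ) / n - t / n| ^ α
          ≤ CB * (n : ℝ) ^ (-α) + CB * ((r : ℝ) ^ α * (n : ℝ) ^ (-α)) := by gcongr
        _ = c * (n : ℝ) ^ (-α) := by rw [hc]; ring
    have hXB : ∀ j : Fin r, eLpNorm (X (t - (j : ℕ)) n) p P ≤ ENNReal.ofReal B := by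
      intro j
      have e : X (t - (j : ℕ)) n = Xs (t - (j : ℕ)) ((t : ℝ) / n)
          + fun ω => X (t - (j : ℕ)) n ω - Xs (t - (j : ℕ)) ((t : ℝ) / n) ω := by
        ext ω; simp
      rw [e]
      refine (eLpNorm_add_le (hX.measurable_approx _ _ htm).aestronglyMeasurable
        ((hX.measurable_array _ n).sub (hX.measurable_approx _ _ htm)).aestronglyMeasurable
        hp1).trans ?_
      refine (add_le_add (hX.moment _ htm _) (hρ j)).trans ?_
      rw [← ENNReal.ofReal_add hA (by positivity)]
      refine ENNReal.ofReal_le_ofReal ?_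
      have h4 : (n : ℝ) ^ (-α) ≤ 1 := by
        refine Real.rpow_le_one_of_one_le_of_nonpos ?_ (by linarith)
        exact_mod_cast Nat.one_le_iff_ne_zero.2 (by exact_mod_cast (h0 j).ne')
      have h5 : c * (n : ℝ) ^ (-α) ≤ c := mul_le_of_le_one_right hc0 h4
      linarith
    refine (hg.eLpNorm_sub_le (fun j => (hX.measurable_array _ n).aestronglyMeasurable)
      (fun j => (hX.measurable_approx _ _ htm).aestronglyMeasurable) hB0
      (fun j => by positivity) hXB (fun j => hXsB _ htm _) hρ).trans_eq ?_
    rw [Finset.sum_const, Finset.card_univ, Fintype.card_fin, nsmul_eq_mul, ← hΛ]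
    congr 1
    ring

lemma IdentDistrib.lagTransform {r : ℕ} {g : (Fin r → ℝ) → ℝ} (hg : Measurable g) {u : ℝ} {t : ℤ}
    (h : IdentDistrib (fun ω (s : ℤ) => Xs (s + t) u ω) (fun ω s => Xs s u ω) P P) :
    IdentDistrib (fun ω (s : ℤ) => lagTransform g Xs (s + t) u ω)
      (fun ω s => lagTransform g Xs s u ω) P P := by
  have hm : Measurable fun (x : ℤ → ℝ) (s : ℤ) => g fun j : Fin r => x (s - (j : ℕ)) :=
    measurable_pi_lambda _ fun s => hg.comp (measurable_pi_lambda _ fun j => measurable_pi_apply _)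
  have h1 := h.comp hm
  simp only [Function.comp_def] at h1
  simpa only [LocStat.lagTransform, sub_add_eq_add_sub] using h1

end LagTransform

/-- With `M = 0` the growth factor is `1 + 1 + 1 = 3`, whence the constant `1/3`. -/
lemma classL_eval_zero : ClassL 1 0 (1 / 3) fun y => y 0 := by
  refine ⟨le_rfl, fun y y' hne => ?_⟩
  have h0 : |y 0 - y' 0| ≠ 0 := by
    rw [abs_ne_zero, sub_ne_zero]
    exact fun h => hne (funext fun i => by rwa [Subsingleton.elim i 0])
  simp only [Finset.univ_unique, Fin.default_eq_zero, Finset.sum_singleton, Real.rpow_zero]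
  rw [← div_div, div_self h0]
  norm_num

lemma lagTransform_eval_zero {Ω ι : Type*} [MeasurableSpace Ω] (X : ℤ → ι → Ω → ℝ) :
    lagTransform (fun y : Fin 1 → ℝ => y 0) X = X := by
  ext t i ω
  simp [lagTransform]

end LocStat

end

theorem theorem2p10 {Ω : Type*} [MeasurableSpace Ω] (P : Measure Ω) [IsProbabilityMeasure P]
    (K : ℝ → ℝ) (hK : LocStat.LocalizingKernel K)
    -- the array and its stationary approximation
    (X : ℤ → ℕ → Ω → ℝ) (hX : ∀ t n, Measurable (X t n))
    (Xs : ℤ → ℝ → Ω → ℝ) (hXs : ∀ t, ∀ u ∈ Set.Icc (0 : ℝ) 1, Measurable (Xs t u))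
    (hstat : ∀ u ∈ Set.Icc (0 : ℝ) 1, LocStat.StationaryErgodic P (fun t => Xs t u))
    -- i.i.d. innovations and their independent copies
    (ε ε' : ℤ → Ω → ℝ) (hε : LocStat.Innovations P ε ε')
    (q : ℝ) (hq : 2 ≤ q) (α : ℝ) (hα : 0 < α) (hα' : α ≤ 1)
    -- bandwidths
    (b : ℕ → ℝ) (hb : Tendsto b atTop (𝓝 0))
    (hnb : Tendsto (fun n : ℕ => (n : ℝ) * b n) atTop atTop)
    (hbα : Tendsto (fun n : ℕ => √((n : ℝ) * b n) * (n : ℝ) ^ (-α)) atTop (𝓝 0))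
    (u : ℝ) (hu : u ∈ Set.Ioo (0 : ℝ) 1) :
    (LocStat.CondS1 P X Xs q α → LocStat.CondS2 P Xs q → LocStat.CondM1 P ε ε' Xs q →
      LocStat.LocalCLT P K X Xs b u) ∧
    (∀ (r : ℕ) (M C : ℝ) (g : (Fin r → ℝ) → ℝ), LocStat.ClassL r M C g →
      LocStat.CondS1 P X Xs (q * (M + 1)) α → LocStat.CondS2 P Xs (q * (M + 1)) →
      LocStat.CondM1 P ε ε' Xs (q * (M + 1)) →
      LocStat.LocalCLT P K (LocStat.lagTransform g X) (LocStat.lagTransform g Xs) b u) := by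
  have hu' : u ∈ Set.Icc (0 : ℝ) 1 := Set.Ioo_subset_Icc_self hu
  have main : ∀ (r : ℕ) (M C : ℝ) (g : (Fin r → ℝ) → ℝ), LocStat.ClassL r M C g →
      LocStat.CondS1 P X Xs (q * (M + 1)) α → LocStat.CondM1 P ε ε' Xs (q * (M + 1)) →
      LocStat.LocalCLT P K (LocStat.lagTransform g X) (LocStat.lagTransform g Xs) b u := by
    intro r M C g hg hS hM
    -- From `q ≥ 2` the order `q(M+1)` is at least `2(M+1)`, exactly what L² bounds on `g` require.
    obtain ⟨H, δ, CB, A, happ⟩ := LocStat.exists_uniformApprox hε hX hXs hstat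
      (mul_le_mul_of_nonneg_right hq (by linarith [hg.1])) hS hM
    obtain ⟨G, d, CB', hCB', hZ⟩ := happ.exists_locallyStationary hg hε hα
    refine hZ.localCLT hε hα hCB' hK hb hnb hbα hu fun t => ?_
    exact LocStat.IdentDistrib.lagTransform hg.continuous.measurable
      ((hstat u hu').identDistrib (fun t => hXs t u hu') t)
  refine ⟨fun hS _ hM => ?_, fun r M C g hg hS _ hM => main r M C g hg hS hM⟩
  -- The first assertion is the case of one lag and the coordinate function, where `q(M+1) = q`.
  have h := main 1 0 (1 / 3) (fun y => y 0) LocStat.classL_eval_zero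
    (by simpa using hS) (by simpa using hM)
  rwa [LocStat.lagTransform_eval_zero, LocStat.lagTransform_eval_zero] at h
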